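/- Let $d \ge 1$ be an integer, write the points of $\mathbb{R}^d$ as $(y,\theta) \in \mathbb{R}^{d-1} \times \mathbb{R}$, and for $k \in \mathbb{N}$ let $$\Gamma^k(\mathbb{R}^d) := \left\{ u \in L^2(\mathbb{R}^d;\mathbb{R}) \, : \, \theta^\alpha \, \partial_{y,\theta}^\beta u \in L^2(\mathbb{R}^d) \ \text{ for all } \alpha \in \mathbb{N}, \ \beta \in \mathbb{N}^d \text{ with } \alpha+|\beta| \le k \right\}$$ (derivatives in the sense of distributions), with the norm $$\| u \|_{\Gamma^k(\mathbb{R}^d)}^2 := \sum_{\alpha+|\beta| \le k} \| \theta^\alpha \, \partial_{y,\theta}^\beta u \|_{L^2(\mathbb{R}^d)}^2 .$$ Let $\mathbf{w} \in \mathbb{R}^{d-1}$, $c,\mu \in \mathbb{R}$, and let $\delta_1,\delta_3$ be nonzero real numbers with $\delta_3 = 1+\delta_1$. For functions $u,v$ of $(y,\theta)$ set $$\mathbb{F}_{\rm pul}(u,v)(y,\theta) := \int_0^{+\infty} u(y,\theta+\delta_1 X) \, v(y,\theta+\delta_3 X) \, \mathrm{d}X .$$ Let $k_0$ be the smallest integer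 with $k_0 > (d+1)/2$, and let $k \ge 2k_0+1$ be an integer. Then for every $R>0$ there exists a time $T>0$ (depending only on $k$, $R$ and the fixed data $d,\mathbf{w},c,\mu,\delta_1,\delta_3$) such that for every $a_0 \in \Gamma^k(\mathbb{R}^d)$ with $\| a_0 \|_{\Gamma^k(\mathbb{R}^d)} \le R$ there exists a unique solution $a \in \mathcal{C}([0,T];\Gamma^k(\mathbb{R}^d))$ to the Cauchy problem $$\partial_t a + \mathbf{w} \cdot \nabla_y a + c \, a \, \partial_\theta a + \mu \, \mathbb{F}_{\rm pul}(\partial_\theta a, \partial_\theta a) = 0 , \qquad a|_{t=0} = a_0 .$$ Here a solution is a function $a \in \mathcal{C}([0,T];\Gamma^k(\mathbb{R}^d))$ with $a(0)=a_0$ that is differentiable as a map from $[0,T]$ to $L^2(\mathbb{R}^d)$ (one-sidedly at the end points) and satisfies the equation in $L^2(\mathbb{R}^d)$ for every $t \in [0,T]$. -/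

import Mathlib

open MeasureTheory
open scoped ContDiff

namespace MachStem

noncomputable section

/-- The space `ℝ^d` with `d = n + 1`. Its points are `x = (y, θ)`, where `y ∈ ℝ^(d-1)` consists of
the first `n` coordinates and `θ` is the last one. -/
abbrev Space (n : ℕ) : Type := EuclideanSpace ℝ (Fin (n + 1))

/-- The space `L²(ℝ^d)` of (classes of) real-valued square integrable functions. -/
abbrev L2 (n : ℕ) : Type := Lp ℝ 2 (volume : Measure (Space n))

/-- The unit vector of the `θ` direction. -/
def thetaDir (n : ℕ) : Space n := EuclideanSpace.single (Fin.last n) 1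

/-- The classical partial derivative in the `i`-th coordinate. -/
def partialDeriv {n : ℕ} (i : Fin (n + 1)) (f : Space n → ℝ) : Space n → ℝ :=
  fun x => fderiv ℝ f x (EuclideanSpace.single i 1)

/-- The classical derivative `∂^β f` for a multi-index `β`, used for smooth `f` only. -/
def multiDeriv {n : ℕ} (β : Fin (n + 1) → ℕ) (f : Space n → ℝ) : Space n → ℝ :=
  (List.finRange (n + 1)).foldr (fun i g => (partialDeriv i)^[β i] g) f

/-- Test functions: smooth functions with compact support. -/
def IsTest {n : ℕ} (φ : Space n → ℝ) : Prop := ContDiff ℝ ∞ φ ∧ HasCompactSupport φ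

/-- Multiplication by the weight `θ^α`. -/
def weight {n : ℕ} (α : ℕ) (f : Space n → ℝ) : Space n → ℝ :=
  fun x => x (Fin.last n) ^ α * f x

/-- The identity `g = θ^α ∂^β u` in the sense of distributions:
`∫ g φ = (-1)^|β| ∫ u ∂^β(θ^α φ)` for all test functions `φ`. -/
def IsWeightedDeriv {n : ℕ} (α : ℕ) (β : Fin (n + 1) → ℕ) (u g : L2 n) : Prop :=
  ∀ φ : Space n → ℝ, IsTest φ →
    ∫ x, g x * φ x = (-1) ^ (∑ i, β i) * ∫ x, u x * multiDeriv β (weight α φ) x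

theorem IsTest.partialDeriv {n : ℕ} {φ : Space n → ℝ} (h : IsTest φ) (i : Fin (n + 1)) :
    IsTest (partialDeriv i φ) := by
  refine ⟨?_, ?_⟩
  · exact (h.1.fderiv_right (m := ∞) (by simp)).clm_apply contDiff_const
  · exact h.2.fderiv_apply ℝ (EuclideanSpace.single i 1)

theorem IsTest.iterate_partialDeriv {n : ℕ} {φ : Space n → ℝ} (h : IsTest φ) (i : Fin (n + 1))
    (m : ℕ) : IsTest ((MachStem.partialDeriv i)^[m] φ) := by
  induction m with
  | zero => exact h
  | succ m ih => rw [Function.iterate_succ_apply']; exact ih.partialDeriv i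

theorem IsTest.multiDeriv {n : ℕ} {φ : Space n → ℝ} (h : IsTest φ) (β : Fin (n + 1) → ℕ) :
    IsTest (multiDeriv β φ) := by
  unfold MachStem.multiDeriv
  induction List.finRange (n + 1) with
  | nil => exact h
  | cons i l ih => exact ih.iterate_partialDeriv i (β i)

theorem IsTest.weight {n : ℕ} {φ : Space n → ℝ} (h : IsTest φ) (α : ℕ) :
    IsTest (weight α φ) := by
  refine ⟨?_, h.2.mul_left⟩
  unfold MachStem.weight
  have := h.1
  fun_prop

theorem IsTest.integrable_mul {n : ℕ} {φ : Space n → ℝ} (h : IsTest φ) (u : L2 n) :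
    Integrable (fun x => u x * φ x) :=
  MemLp.integrable_mul (p := 2) (q := 2) (Lp.memLp u)
    (h.1.continuous.memLp_of_hasCompactSupport h.2)

theorem IsWeightedDeriv.unique {n : ℕ} {α : ℕ} {β : Fin (n + 1) → ℕ} {u g g' : L2 n}
    (h : IsWeightedDeriv α β u g) (h' : IsWeightedDeriv α β u g') : g = g' := by
  refine Lp.ext ?_
  refine ae_eq_of_integral_contDiff_smul_eq ((Lp.memLp g).locallyIntegrable (by norm_num))
    ((Lp.memLp g').locallyIntegrable (by norm_num)) ?_
  intro φ h1 h2
  have := (h φ ⟨h1, h2⟩).trans (h' φ ⟨h1, h2⟩).symm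
  simpa [mul_comm] using this

theorem IsWeightedDeriv.add {n : ℕ} {α : ℕ} {β : Fin (n + 1) → ℕ} {u v g g' : L2 n}
    (h : IsWeightedDeriv α β u g) (h' : IsWeightedDeriv α β v g') :
    IsWeightedDeriv α β (u + v) (g + g') := by
  intro φ hφ
  have hψ := (hφ.weight α).multiDeriv β
  have e1 : ∀ (f f' : L2 n) (χ : Space n → ℝ), IsTest χ →
      ∫ x, (f + f' : L2 n) x * χ x = (∫ x, f x * χ x) + ∫ x, f' x * χ x := by
    intro f f' χ hχ
    rw [← integral_add (hχ.integrable_mul f) (hχ.integrable_mul f')]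
    refine integral_congr_ae ?_
    filter_upwards [Lp.coeFn_add f f'] with x hx
    rw [hx, Pi.add_apply, add_mul]
  rw [e1 _ _ _ hφ, e1 _ _ _ hψ, h φ hφ, h' φ hφ, mul_add]

theorem IsWeightedDeriv.smul {n : ℕ} {α : ℕ} {β : Fin (n + 1) → ℕ} {u g : L2 n} (r : ℝ)
    (h : IsWeightedDeriv α β u g) : IsWeightedDeriv α β (r • u) (r • g) := by
  intro φ hφ
  have e1 : ∀ (f : L2 n) (χ : Space n → ℝ),
      ∫ x, (r • f : L2 n) x * χ x = r * ∫ x, f x * χ x := by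
    intro f χ
    rw [← integral_const_mul]
    refine integral_congr_ae ?_
    filter_upwards [Lp.coeFn_smul r f] with x hx
    rw [hx, Pi.smul_apply, smul_eq_mul, mul_assoc]
  rw [e1, e1, h φ hφ]
  ring

theorem isWeightedDeriv_zero_zero {n : ℕ} (u : L2 n) : IsWeightedDeriv 0 0 u u := by
  intro φ _
  have : ∀ l : List (Fin (n + 1)), l.foldr
      (fun i g => (partialDeriv i)^[(0 : Fin (n + 1) → ℕ) i] g) (weight 0 φ) = φ := by
    intro l
    induction l with
    | nil => funext x; simp [weight]
    | cons i l ih => rw [List.foldr_cons, ih]; rfl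
  have e : multiDeriv 0 (weight 0 φ) = φ := this _
  simp [e]

/-- The function `θ^α ∂^β u ∈ L²(ℝ^d)`; it is unique where it exists, and `0` by convention when
the distribution `θ^α ∂^β u` is not in `L²(ℝ^d)`. -/
def weightedDeriv {n : ℕ} (α : ℕ) (β : Fin (n + 1) → ℕ) (u : L2 n) : L2 n :=
  open Classical in if h : ∃ g, IsWeightedDeriv α β u g then h.choose else 0

theorem weightedDeriv_eq {n : ℕ} {α : ℕ} {β : Fin (n + 1) → ℕ} {u g : L2 n}
    (h : IsWeightedDeriv α β u g) : weightedDeriv α β u = g := by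
  have hex : ∃ g, IsWeightedDeriv α β u g := ⟨g, h⟩
  rw [weightedDeriv, dif_pos hex]
  exact hex.choose_spec.unique h

/-- The vector space of all `u ∈ L²(ℝ^d)` with `θ^α ∂^β u ∈ L²(ℝ^d)` whenever `α + |β| ≤ k`. -/
def gammaSubmodule (n k : ℕ) : Submodule ℝ (L2 n) where
  carrier := {u | ∀ (α : ℕ) (β : Fin (n + 1) → ℕ), α + ∑ i, β i ≤ k →
    ∃ g, IsWeightedDeriv α β u g}
  add_mem' := fun hu hv α β h => by
    obtain ⟨g, hg⟩ := hu α β h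
    obtain ⟨g', hg'⟩ := hv α β h
    exact ⟨g + g', hg.add hg'⟩
  zero_mem' := fun α β _ => ⟨0, fun φ _ => by
    have e : ∀ χ : Space n → ℝ, ∫ x, (0 : L2 n) x * χ x = 0 := by
      intro χ
      rw [← integral_zero (Space n) ℝ]
      refine integral_congr_ae ?_
      filter_upwards [Lp.coeFn_zero ℝ 2 (volume : Measure (Space n))] with x hx
      rw [hx, Pi.zero_apply, zero_mul]
    rw [e, e, mul_zero]⟩
  smul_mem' := fun r u hu α β h => by
    obtain ⟨g, hg⟩ := hu α β h
    exact ⟨r • g, hg.smul r⟩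

/-- The weighted Sobolev space `Γ^k(ℝ^d)`, `d = n + 1`. It is a separate type because it does not
carry the norm of `L²(ℝ^d)`. -/
def Gamma (n k : ℕ) : Type := gammaSubmodule n k

instance (n k : ℕ) : AddCommGroup (Gamma n k) :=
  inferInstanceAs (AddCommGroup (gammaSubmodule n k))

instance (n k : ℕ) : Module ℝ (Gamma n k) :=
  inferInstanceAs (Module ℝ (gammaSubmodule n k))

/-- The inclusion of `Γ^k(ℝ^d)` in `L²(ℝ^d)`. -/
def Gamma.toL2 {n k : ℕ} : Gamma n k →ₗ[ℝ] L2 n := (gammaSubmodule n k).subtype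

theorem Gamma.isWeightedDeriv {n k : ℕ} (u : Gamma n k) {α : ℕ} {β : Fin (n + 1) → ℕ}
    (h : α + ∑ i, β i ≤ k) : IsWeightedDeriv α β u.toL2 (weightedDeriv α β u.toL2) := by
  obtain ⟨g, hg⟩ := u.2 α β h
  have e : weightedDeriv α β u.toL2 = g := weightedDeriv_eq hg
  rw [e]
  exact hg

/-- The finite set of all `(α, β)` with `α + |β| ≤ k`. -/
def gammaIndex (n k : ℕ) : Finset (ℕ × (Fin (n + 1) → ℕ)) :=
  (Finset.range (k + 1) ×ˢ Fintype.piFinset (fun _ => Finset.range (k + 1))).filter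
    (fun p => p.1 + ∑ i, p.2 i ≤ k)

theorem mem_gammaIndex {n k : ℕ} {p : ℕ × (Fin (n + 1) → ℕ)} :
    p ∈ gammaIndex n k ↔ p.1 + ∑ i, p.2 i ≤ k := by
  simp only [gammaIndex, Finset.mem_filter, Finset.mem_product, Finset.mem_range,
    Fintype.mem_piFinset, and_iff_right_iff_imp]
  intro h
  refine ⟨by omega, fun i => ?_⟩
  have := Finset.single_le_sum (f := p.2) (fun _ _ => Nat.zero_le _) (Finset.mem_univ i)
  omega

/-- The linear map `u ↦ (θ^α ∂^β u)_{α + |β| ≤ k}` into a Hilbert sum of copies of `L²(ℝ^d)`. -/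
def Gamma.jet (n k : ℕ) : Gamma n k →ₗ[ℝ] PiLp 2 (fun _ : gammaIndex n k => L2 n) where
  toFun u := WithLp.toLp 2 (fun p => weightedDeriv p.1.1 p.1.2 u.toL2)
  map_add' u v := by
    ext1 p
    have hp := mem_gammaIndex.1 p.2
    have e := weightedDeriv_eq ((u.isWeightedDeriv hp).add (v.isWeightedDeriv hp))
    simpa using e
  map_smul' r u := by
    ext1 p
    have hp := mem_gammaIndex.1 p.2
    have e := weightedDeriv_eq ((u.isWeightedDeriv hp).smul r)
    simpa using e

theorem Gamma.jet_injective (n k : ℕ) : Function.Injective (Gamma.jet n k) := by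
  intro u v h
  have h0 : ((0, 0) : ℕ × (Fin (n + 1) → ℕ)) ∈ gammaIndex n k := mem_gammaIndex.2 (by simp)
  have e : weightedDeriv 0 0 u.toL2 = weightedDeriv 0 0 v.toL2 :=
    congrArg (fun U : PiLp 2 (fun _ : gammaIndex n k => L2 n) => U ⟨(0, 0), h0⟩) h
  rw [weightedDeriv_eq (isWeightedDeriv_zero_zero _),
    weightedDeriv_eq (isWeightedDeriv_zero_zero _)] at e
  exact Subtype.ext e

/-- The norm of `Γ^k(ℝ^d)`: `‖u‖² = ∑_{α + |β| ≤ k} ‖θ^α ∂^β u‖²_{L²}`. -/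
instance (n k : ℕ) : NormedAddCommGroup (Gamma n k) :=
  NormedAddCommGroup.induced _ _ (Gamma.jet n k) (Gamma.jet_injective n k)

instance (n k : ℕ) : NormedSpace ℝ (Gamma n k) :=
  NormedSpace.induced ℝ _ _ (Gamma.jet n k)

theorem Gamma.norm_sq_eq {n k : ℕ} (u : Gamma n k) :
    ‖u‖ ^ 2 = ∑ p ∈ gammaIndex n k, ‖weightedDeriv p.1 p.2 u.toL2‖ ^ 2 := by
  have e : ‖u‖ = ‖Gamma.jet n k u‖ := rfl
  rw [e, PiLp.norm_sq_eq_of_L2,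
    ← Finset.sum_coe_sort (gammaIndex n k) (fun p => ‖weightedDeriv p.1 p.2 u.toL2‖ ^ 2)]
  rfl

/-- The first order weak derivative `∂_i u ∈ L²(ℝ^d)` of `u ∈ Γ^k(ℝ^d)`, `k ≥ 1`. -/
def Gamma.deriv {n k : ℕ} (i : Fin (n + 1)) (u : Gamma n k) : L2 n :=
  weightedDeriv 0 (Pi.single i 1) u.toL2

/-- `F_pul(u, v)(y, θ) = ∫_0^∞ u(y, θ + δ₁ X) v(y, θ + δ₃ X) dX`. For `u, v ∈ L²(ℝ^d)` and nonzero
`δ₁ ≠ δ₃` the integral converges absolutely at almost every point, and up to null sets it does not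
depend on the representatives of `u` and `v`. -/
def Fpul {n : ℕ} (δ₁ δ₃ : ℝ) (u v : L2 n) (x : Space n) : ℝ :=
  ∫ X in Set.Ioi (0 : ℝ), u (x + (δ₁ * X) • thetaDir n) * v (x + (δ₃ * X) • thetaDir n)

/-- `a ∈ C([0,T]; Γ^k(ℝ^d))` solves
`∂_t a + w·∇_y a + c a ∂_θ a + μ F_pul(∂_θ a, ∂_θ a) = 0` on `[0,T]`, with `a = a₀` at `t = 0`. The
time derivative is that of `a` as a curve in `L²(ℝ^d)` (one-sided at the end points), and the
equation holds in `L²(ℝ^d)`, that is, at almost every point `x = (y, θ)`, for every `t ∈ [0,T]`. -/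
structure IsSolution {n k : ℕ} (w : EuclideanSpace ℝ (Fin n)) (c μ δ₁ δ₃ T : ℝ)
    (a₀ : Gamma n k) (a : ℝ → Gamma n k) : Prop where
  continuousOn : ContinuousOn a (Set.Icc 0 T)
  initial : a 0 = a₀
  equation : ∀ t ∈ Set.Icc 0 T, ∃ a' : L2 n,
    HasDerivWithinAt (fun s => (a s).toL2) a' (Set.Icc 0 T) t ∧
    ∀ᵐ x : Space n,
      a' x + ∑ i : Fin n, w i * (a t).deriv i.castSucc x
        + c * (a t).toL2 x * (a t).deriv (Fin.last n) x
        + μ * Fpul δ₁ δ₃ ((a t).deriv (Fin.last n)) ((a t).deriv (Fin.last n)) x = 0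

end

end MachStem

/-! ### Abstract evolution equations: regularisation, energy estimates, local well-posedness. -/

namespace MachStem

section Evolution

open Set Filter Topology

/-! Write the equation as `a' = N a`. The transport terms lose one derivative but are antisymmetric
in `L²` up to bounded operators; the nonlocal term loses none and is a bounded bilinear map on
`Γ^k`. The problem is therefore solved by energy estimates in `Γ^k`, with `L²` as a weak space in
which approximations converge and differences are measured.

The nonlocal term. Integrating the derivative of the integrand along the ray gives `δ₁ F(∂_θ u, v) +
δ₃ F(u, ∂_θ v) = -u v` (`fp_d_last`). When all derivatives fall on one factor, this moves the extra
`∂_θ` to the other one. Derivatives obey the Leibniz rule (`d_fp`), and `θ F(u, v)` is a combination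
of `F(θ u, v)` and `F(u, θ v)` (`th_fp`). The `L²` bound (`exists_norm_fp_le`) comes from
Cauchy–Schwarz on the ray with the weight `1 + θ²` on one factor. The other coordinates are shared
out: in each of them one factor is estimated by its supremum, at the price of one derivative. The
price is `n + 1` operators in all, as for the pointwise product (`norm_mul_le`). An induction based
on the Leibniz rules (`bilinBound_of_closed`) lifts these bounds from `L²` to `Γ^k`.

The transport terms. Derivatives are replaced by symmetric difference quotients `cdq` of step `h`.
For fixed `h` they are bounded on `Γ^k`. They are antisymmetric in `L²`, commute with derivatives,
and commute with `θ` up to an average of translations. Hence the energy estimates are uniform in `h`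
(`exists_inner_mul_cdq_le`), while the error in `L²` is `O(h)` (`norm_cdq_sub_dv_le`).

The regularised equations are ordinary differential equations in `Γ^k`. Their solutions live on a
common time interval and are Cauchy in `L²` uniformly in time; the limit stays in `Γ^k` because
balls of `Γ^k` are closed in `L²`. Uniqueness is the `L²` estimate of a difference. For continuity
with values in `Γ^k`, the equation is restarted at an arbitrary time, forwards and backwards. By
uniqueness this bounds the norm near `t₀` by `exp (C |t - t₀|) ‖a t₀‖`, and together with weak
continuity this gives strong continuity.

All estimates are proved for test functions, which are dense in `Γ^k` (`denseRange_toGamma`), and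
extended by continuity. It remains to identify the extended terms almost everywhere with the product
and with `Fpul` (`ae_eq_mul`, `ae_eq_Fpul`). -/

theorem le_exp_mul_of_hasDerivWithinAt {f f' : ℝ → ℝ} {T K δ : ℝ} (hK : 0 ≤ K) (hδ : 0 ≤ δ)
    (hf : ∀ t ∈ Icc 0 T, HasDerivWithinAt f (f' t) (Icc 0 T) t)
    (hb : ∀ t ∈ Icc 0 T, f' t ≤ K * f t + δ) :
    ∀ t ∈ Icc 0 T, f t ≤ Real.exp (K * t) * (f 0 + δ * t) := by
  intro t ht
  have hg : ∀ s ∈ Icc 0 T, HasDerivWithinAt (fun s => Real.exp (-(K * s)) * f s - δ * s)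
      (Real.exp (-(K * s)) * (f' s - K * f s) - δ) (Icc 0 T) s := by
    intro s hs
    have h1 : HasDerivAt (fun s => Real.exp (-(K * s))) (Real.exp (-(K * s)) * (-(K * 1))) s :=
      ((hasDerivAt_id s).const_mul K).neg.exp
    have h2 := (h1.hasDerivWithinAt.mul (hf s hs)).sub
      (((hasDerivAt_id s).const_mul δ).hasDerivWithinAt)
    refine h2.congr_deriv ?_
    ring
  have hanti : AntitoneOn (fun s => Real.exp (-(K * s)) * f s - δ * s) (Icc 0 T) := by
    refine antitoneOn_of_deriv_nonpos (convex_Icc 0 T)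
      (fun s hs => (hg s hs).continuousWithinAt) ?_ ?_
    · intro s hs
      exact ((hg s (interior_subset hs)).differentiableWithinAt).mono interior_subset
    · intro s hs
      have hs' := interior_subset hs
      rw [((hg s hs').hasDerivAt (mem_interior_iff_mem_nhds.1 hs)).deriv]
      have h3 : Real.exp (-(K * s)) * (f' s - K * f s) ≤ Real.exp (-(K * s)) * δ :=
        mul_le_mul_of_nonneg_left (by linarith [hb s hs']) (Real.exp_pos _).le
      have h4 : Real.exp (-(K * s)) ≤ 1 := by
        rw [Real.exp_le_one_iff]
        have := mul_nonneg hK hs'.1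
        linarith
      nlinarith
  have h0 : (0 : ℝ) ∈ Icc 0 T := ⟨le_rfl, ht.1.trans ht.2⟩
  have := hanti h0 ht ht.1
  simp only [mul_zero, neg_zero, Real.exp_zero, one_mul, sub_zero] at this
  have h5 : f t = Real.exp (K * t) * (Real.exp (-(K * t)) * f t) := by
    rw [← mul_assoc, ← Real.exp_add]; simp
  rw [h5]
  exact mul_le_mul_of_nonneg_left (by linarith) (Real.exp_pos _).le

variable {H X : Type*} [NormedAddCommGroup H] [InnerProductSpace ℝ H]
  [NormedAddCommGroup X] [InnerProductSpace ℝ X]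

/-- Smooth approximations `F j` on `H` of an unbounded vector field `N : H → X`, with estimates
that are uniform in `j` on the balls of `H`. -/
structure IsApproximation (ι : H →L[ℝ] X) (F : ℕ → H → H) (N : H → X) : Prop where
  lipschitz : ∀ j M, ∃ K, LipschitzOnWith K (F j) (Metric.closedBall 0 M)
  energy : ∀ M, ∃ C, 0 ≤ C ∧ ∀ j a, ‖a‖ ≤ M → |inner ℝ (F j a) a| ≤ C * ‖a‖ ^ 2
  weak_energy : ∀ M, ∃ C, 0 ≤ C ∧ ∀ j a b, ‖a‖ ≤ M → ‖b‖ ≤ M →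
    |inner ℝ (ι (F j a) - ι (F j b)) (ι a - ι b)| ≤ C * ‖ι a - ι b‖ ^ 2
  consistent : ∀ M, ∃ ε : ℕ → ℝ, Tendsto ε atTop (𝓝 0) ∧
    ∀ j a, ‖a‖ ≤ M → ‖ι (F j a) - N a‖ ≤ ε j
  weak_lipschitz : ∀ j M, ∃ C, ∀ a b, ‖a‖ ≤ M → ‖b‖ ≤ M →
    ‖ι (F j a) - ι (F j b)‖ ≤ C * ‖ι a - ι b‖

variable {ι : H →L[ℝ] X} {F : ℕ → H → H} {N : H → X}

/-- The estimates are two-sided, so they survive a change of sign. This makes the equation solvable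
backwards in time, which is needed for continuity from the left. -/
theorem IsApproximation.neg (h : IsApproximation ι F N) :
    IsApproximation ι (fun j a => - F j a) (fun a => - N a) where
  lipschitz j M := by
    obtain ⟨K, hK⟩ := h.lipschitz j M
    exact ⟨K, hK.neg⟩
  energy M := by
    obtain ⟨C, hC, h⟩ := h.energy M
    refine ⟨C, hC, fun j a ha => ?_⟩
    rw [inner_neg_left, abs_neg]
    exact h j a ha
  weak_energy M := by
    obtain ⟨C, hC, h⟩ := h.weak_energy M
    refine ⟨C, hC, fun j a b ha hb => ?_⟩
    rw [map_neg, map_neg, ← neg_sub', inner_neg_left, abs_neg]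
    exact h j a b ha hb
  consistent M := by
    obtain ⟨ε, hε, h⟩ := h.consistent M
    refine ⟨ε, hε, fun j a ha => ?_⟩
    rw [map_neg, ← neg_sub', norm_neg]
    exact h j a ha
  weak_lipschitz j M := by
    obtain ⟨C, h⟩ := h.weak_lipschitz j M
    refine ⟨C, fun a b ha hb => ?_⟩
    rw [map_neg, map_neg, ← neg_sub', norm_neg]
    exact h a b ha hb

/-- The one-sided Lipschitz bound passes to the limit field. It yields uniqueness although `N`
itself is not Lipschitz in the weak norm. -/
theorem IsApproximation.limit_weak_energy (h : IsApproximation ι F N) (M : ℝ) :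
    ∃ C, 0 ≤ C ∧ ∀ a b, ‖a‖ ≤ M → ‖b‖ ≤ M →
      inner ℝ (N a - N b) (ι a - ι b) ≤ C * ‖ι a - ι b‖ ^ 2 := by
  obtain ⟨C, hC, h1⟩ := h.weak_energy M
  obtain ⟨ε, hε, h2⟩ := h.consistent M
  have hlim : ∀ a, ‖a‖ ≤ M → Tendsto (fun j => ι (F j a)) atTop (𝓝 (N a)) := by
    intro a ha
    rw [tendsto_iff_norm_sub_tendsto_zero]
    exact squeeze_zero (fun _ => norm_nonneg _) (fun j => h2 j a ha) hε
  refine ⟨C, hC, fun a b ha hb => ?_⟩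
  refine le_of_tendsto (((hlim a ha).sub (hlim b hb)).inner tendsto_const_nhds)
    (Eventually.of_forall fun j => (le_abs_self _).trans (h1 j a b ha hb))

/-- On a ball of `H` the field `N` is a uniform limit of maps that are Lipschitz in the weak norm.
Their constants may blow up with the index, so only uniform continuity remains; it suffices for
passing to the limit in the equation. -/
theorem IsApproximation.limit_uniformContinuous (h : IsApproximation ι F N) (M : ℝ) {δ : ℝ}
    (hδ : 0 < δ) : ∃ η, 0 < η ∧ ∀ a b, ‖a‖ ≤ M → ‖b‖ ≤ M → ‖ι a - ι b‖ ≤ η →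
      ‖N a - N b‖ ≤ δ := by
  obtain ⟨ε, hε, h2⟩ := h.consistent M
  obtain ⟨i, hi⟩ := (hε.eventually_le_const (by positivity : (0 : ℝ) < δ / 3)).exists
  obtain ⟨C, hC⟩ := h.weak_lipschitz i M
  refine ⟨δ / 3 / (|C| + 1), by positivity, fun a b ha hb hab => ?_⟩
  have e : N a - N b = (ι (F i a) - ι (F i b)) - (ι (F i a) - N a) + (ι (F i b) - N b) := by abel
  have h3 : ‖ι (F i a) - ι (F i b)‖ ≤ δ / 3 := by
    calc _ ≤ C * ‖ι a - ι b‖ := hC a b ha hb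
      _ ≤ (|C| + 1) * (δ / 3 / (|C| + 1)) := by
          gcongr
          linarith [le_abs_self C]
      _ = δ / 3 := by field_simp
  rw [e]
  refine (norm_add_le _ _).trans ((add_le_add_left (norm_sub_le _ _) _).trans ?_)
  linarith [h2 i a ha, h2 i b hb]

/-- A solution of `a' = N a` in the weak space that is bounded in the strong space. -/
structure IsWeakSolution (ι : H →L[ℝ] X) (N : H → X) (T M : ℝ) (a : ℝ → H) : Prop where
  bound : ∀ t ∈ Icc 0 T, ‖a t‖ ≤ M
  deriv : ∀ t ∈ Icc 0 T, HasDerivWithinAt (fun s => ι (a s)) (N (a t)) (Icc 0 T) t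

theorem IsWeakSolution.mono {T M T' M' : ℝ} {a : ℝ → H} (h : IsWeakSolution ι N T M a)
    (hT : T' ≤ T) (hM : M ≤ M') : IsWeakSolution ι N T' M' a where
  bound t ht := (h.bound t ⟨ht.1, ht.2.trans hT⟩).trans hM
  deriv t ht := (h.deriv t ⟨ht.1, ht.2.trans hT⟩).mono (Icc_subset_Icc_right hT)

theorem IsWeakSolution.shift {T M t₀ : ℝ} {a : ℝ → H} (h : IsWeakSolution ι N T M a)
    (ht₀ : 0 ≤ t₀) : IsWeakSolution ι N (T - t₀) M (fun s => a (t₀ + s)) where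
  bound t ht := h.bound _ ⟨by linarith [ht.1], by linarith [ht.2]⟩
  deriv t ht := by
    have h1 := h.deriv (t₀ + t) ⟨by linarith [ht.1], by linarith [ht.2]⟩
    have h2 : HasDerivWithinAt (fun s : ℝ => t₀ + s) 1 (Icc 0 (T - t₀)) t :=
      ((hasDerivAt_id t).const_add t₀).hasDerivWithinAt
    have := h1.scomp t h2 (fun s hs => ⟨by linarith [hs.1], by linarith [hs.2]⟩)
    simpa [Function.comp_def] using this

theorem IsWeakSolution.reverse {T M t₀ : ℝ} {a : ℝ → H} (h : IsWeakSolution ι N T M a)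
    (ht₀ : t₀ ≤ T) : IsWeakSolution ι (fun a => - N a) t₀ M (fun s => a (t₀ - s)) where
  bound t ht := h.bound _ ⟨by linarith [ht.2], by linarith [ht.1]⟩
  deriv t ht := by
    have h1 := h.deriv (t₀ - t) ⟨by linarith [ht.2], by linarith [ht.1]⟩
    have h2 : HasDerivWithinAt (fun s : ℝ => t₀ - s) (-1) (Icc 0 t₀) t :=
      ((hasDerivAt_id t).const_sub t₀).hasDerivWithinAt
    have := h1.scomp t h2 (fun s hs => ⟨by linarith [hs.2], by linarith [hs.1]⟩)
    simpa [Function.comp_def] using this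

/-- Grönwall's inequality for the squared weak norm of the difference, which vanishes at time zero.
-/
theorem IsWeakSolution.unique (h : IsApproximation ι F N) (hι : Function.Injective ι)
    {T M : ℝ} {a b : ℝ → H} (ha : IsWeakSolution ι N T M a) (hb : IsWeakSolution ι N T M b)
    (h0 : a 0 = b 0) : EqOn a b (Icc 0 T) := by
  obtain ⟨C, hC, hE⟩ := h.limit_weak_energy M
  intro t ht
  have h1 := le_exp_mul_of_hasDerivWithinAt (f := fun s => ‖ι (a s) - ι (b s)‖ ^ 2)
    (f' := fun s => 2 * inner ℝ (ι (a s) - ι (b s)) (N (a s) - N (b s))) (T := T) (K := 2 * C)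
    (δ := 0) (by positivity) le_rfl
    (fun s hs => by simpa using ((ha.deriv s hs).sub (hb.deriv s hs)).norm_sq)
    (fun s hs => by
      have := hE (a s) (b s) (ha.bound s hs) (hb.bound s hs)
      rw [real_inner_comm]
      linarith) t ht
  simp only [h0, sub_self, norm_zero, ne_eq, OfNat.ofNat_ne_zero, not_false_eq_true, zero_pow,
    zero_mul, add_zero, mul_zero] at h1
  have h2 : ‖ι (a t) - ι (b t)‖ = 0 := by
    have := sq_nonneg ‖ι (a t) - ι (b t)‖
    exact pow_eq_zero_iff (two_ne_zero) |>.1 (le_antisymm h1 this)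
  exact hι (sub_eq_zero.1 (norm_eq_zero.1 h2))

variable [CompleteSpace H]

/-- The orthogonal complement of the range of the adjoint is the kernel of `ι`. Consequently,
pairings in `H` with a dense set of vectors can be computed in `X`. -/
theorem denseRange_adjoint [CompleteSpace X] (hι : Function.Injective ι) :
    DenseRange (ContinuousLinearMap.adjoint ι) := by
  have h1 := ContinuousLinearMap.orthogonal_range (ContinuousLinearMap.adjoint ι)
  rw [ContinuousLinearMap.adjoint_adjoint] at h1
  have h2 : LinearMap.ker (ι : H →ₗ[ℝ] X) = ⊥ := LinearMap.ker_eq_bot.2 hι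
  have h3 : (LinearMap.range (ContinuousLinearMap.adjoint ι).toLinearMap)ᗮ = ⊥ := by
    rw [h1]; exact h2
  have h4 := Submodule.topologicalClosure_eq_top_iff.2 h3
  have h5 := Submodule.dense_iff_topologicalClosure_eq_top.2 h4
  exact h5

/-- The closed balls of `H` are closed in the topology of `X`. -/
theorem exists_norm_le_of_tendsto [CompleteSpace X] (hι : Function.Injective ι) {u : ℕ → H} {r : ℝ}
    (hr : 0 ≤ r) (hu : ∀ j, ‖u j‖ ≤ r) {y : X} (hy : Tendsto (fun j => ι (u j)) atTop (𝓝 y)) :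
    ∃ a : H, ι a = y ∧ ‖a‖ ≤ r := by
  have hd := denseRange_adjoint hι
  -- The pairing with `y` is bounded by `r` times the norm of the adjoint image, so it descends to a
  -- functional of norm at most `r` on `H`; its Riesz representative is the wanted preimage of `y`.
  let f : X →ₗ[ℝ] ℝ := (innerSL ℝ y : X →L[ℝ] ℝ)
  let e : X →ₗ[ℝ] H := (ContinuousLinearMap.adjoint ι : X →L[ℝ] H)
  have hde : DenseRange e := hd
  have hb : ∀ x, ‖f x‖ ≤ r * ‖e x‖ := by
    intro x
    refine le_of_tendsto ((hy.inner (tendsto_const_nhds (x := x))).norm)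
      (Eventually.of_forall fun j => ?_)
    have : inner ℝ (ι (u j)) x = inner ℝ (u j) (ContinuousLinearMap.adjoint ι x) := by
      rw [ContinuousLinearMap.adjoint_inner_right]
    rw [this]
    exact (norm_inner_le_norm _ _).trans (mul_le_mul_of_nonneg_right (hu j) (norm_nonneg _))
  let g : H →L[ℝ] ℝ := f.extendOfNorm e
  have hg : ∀ x, g (e x) = f x := fun x => LinearMap.extendOfNorm_eq hde ⟨r, hb⟩ x
  have hgn : ‖g‖ ≤ r := LinearMap.opNorm_extendOfNorm_le hde hr hb
  refine ⟨(InnerProductSpace.toDual ℝ H).symm g, ?_, by rwa [LinearIsometryEquiv.norm_map]⟩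
  refine ext_inner_right ℝ fun x => ?_
  rw [← ContinuousLinearMap.adjoint_inner_right, InnerProductSpace.toDual_symm_apply]
  exact hg x

/-- The Lipschitz constants depend on `j`, so a local existence time would too. A cutoff makes the
field globally bounded, and the truncated equation is solved on any interval. The energy estimate,
uniform in `j`, keeps the solution up to time `T` where the cutoff equals one. -/
theorem IsApproximation.exists_ode_solution (h : IsApproximation ι F N) {R : ℝ} (hR : 0 < R) :
    ∃ T C, 0 < T ∧ 0 ≤ C ∧ Real.exp (C * T) ≤ 2 ∧ ∀ j a₀, ‖a₀‖ ≤ R → ∃ u : ℝ → H, u 0 = a₀ ∧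
      ∀ t ∈ Icc 0 T, HasDerivWithinAt u (F j (u t)) (Icc 0 T) t ∧
        ‖u t‖ ≤ Real.exp (C * t) * ‖a₀‖ := by
  -- The radius `4 * R` contains the support of the cutoff. The time `log 2 / (C + 1)` lets the norm
  -- at most double, so that solutions stay in the ball of radius `2 * R`, where the cutoff is one.
  obtain ⟨C, hC, hE⟩ := h.energy (4 * R)
  have hT2 : Real.exp (C * (Real.log 2 / (C + 1))) ≤ 2 := by
    have : C * (Real.log 2 / (C + 1)) ≤ Real.log 2 := by
      rw [← mul_div_assoc, div_le_iff₀ (by positivity)]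
      nlinarith [Real.log_pos (one_lt_two)]
    exact (Real.exp_le_exp.2 this).trans (Real.exp_log two_pos).le
  have hT0 : 0 < Real.log 2 / (C + 1) := div_pos (Real.log_pos one_lt_two) (by positivity)
  refine ⟨Real.log 2 / (C + 1), C, hT0, hC, hT2, fun j a₀ ha₀ => ?_⟩
  generalize Real.log 2 / (C + 1) = T at hT0 hT2
  have hM : (0 : ℝ) < 2 * R := by positivity
  let χ : H → ℝ := fun a => max 0 (min 1 (2 - ‖a‖ / (2 * R)))
  have hχ0 : ∀ a, 0 ≤ χ a := fun a => le_max_left _ _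
  have hχ1 : ∀ a, χ a ≤ 1 := fun a => max_le zero_le_one (min_le_left _ _)
  have hχe : ∀ a, ‖a‖ ≤ 2 * R → χ a = 1 := by
    intro a ha
    have : ‖a‖ / (2 * R) ≤ 1 := (div_le_one hM).2 ha
    simp only [χ]
    rw [min_eq_left (by linarith), max_eq_right zero_le_one]
  have hχz : ∀ a, 4 * R < ‖a‖ → χ a = 0 := by
    intro a ha
    have : 2 < ‖a‖ / (2 * R) := (lt_div_iff₀ hM).2 (by linarith)
    simp only [χ]
    rw [min_eq_right (by linarith), max_eq_left (by linarith)]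
  have hχl : ∀ a b, |χ a - χ b| ≤ (1 / (2 * R)) * ‖a - b‖ := by
    intro a b
    have h1 : |χ a - χ b| ≤ |min 1 (2 - ‖a‖ / (2 * R)) - min 1 (2 - ‖b‖ / (2 * R))| := by
      simp only [χ]
      exact (abs_max_sub_max_le_max _ _ _ _).trans (by simp)
    have h2 : |min 1 (2 - ‖a‖ / (2 * R)) - min 1 (2 - ‖b‖ / (2 * R))| ≤
        |(2 - ‖a‖ / (2 * R)) - (2 - ‖b‖ / (2 * R))| :=
      (abs_min_sub_min_le_max _ _ _ _).trans (by simp)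
    refine h1.trans (h2.trans ?_)
    have : (2 - ‖a‖ / (2 * R)) - (2 - ‖b‖ / (2 * R)) = (1 / (2 * R)) * (‖b‖ - ‖a‖) := by ring
    rw [this, abs_mul, abs_of_pos (by positivity : 0 < 1 / (2 * R)), abs_sub_comm]
    gcongr
    exact abs_norm_sub_norm_le a b
  have hbd : ∀ M, ∃ L : NNReal, ∀ a, ‖a‖ ≤ M → ‖F j a‖ ≤ L := by
    intro M
    obtain ⟨K, hK⟩ := h.lipschitz j (max M 0)
    refine ⟨K * (max M 0).toNNReal + ‖F j 0‖₊, fun a ha => ?_⟩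
    have h1 := hK.dist_le_mul a (by simpa using Or.inl ha) 0 (by simp)
    rw [dist_eq_norm, dist_zero_right] at h1
    have h2 : ‖F j a‖ ≤ ‖F j a - F j 0‖ + ‖F j 0‖ := by
      simpa using norm_add_le (F j a - F j 0) (F j 0)
    simp only [NNReal.coe_add, NNReal.coe_mul, coe_nnnorm, Real.coe_toNNReal', le_max_iff, le_refl, or_true, sup_of_le_left]
    have h3 : (K : ℝ) * ‖a‖ ≤ K * max M 0 :=
      mul_le_mul_of_nonneg_left (ha.trans (le_max_left _ _)) K.2
    linarith
  obtain ⟨L, hL⟩ := hbd (4 * R)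
  let G : H → H := fun a => χ a • F j a
  have hGL : ∀ a, ‖G a‖ ≤ L := by
    intro a
    simp only [G, norm_smul, Real.norm_eq_abs, abs_of_nonneg (hχ0 a)]
    by_cases ha : ‖a‖ ≤ 4 * R
    · calc χ a * ‖F j a‖ ≤ 1 * L := by
            gcongr
            · exact hχ1 a
            · exact hL a ha
        _ = L := one_mul _
    · rw [hχz a (not_le.1 ha), zero_mul]; exact L.2
  have hGlip : ∃ K, LipschitzOnWith K G (Metric.closedBall a₀ (L * T)) := by
    obtain ⟨K, hK⟩ := h.lipschitz j (‖a₀‖ + L * T)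
    obtain ⟨B, hB⟩ := hbd (‖a₀‖ + L * T)
    have hsub : ∀ a ∈ Metric.closedBall a₀ (L * T), ‖a‖ ≤ ‖a₀‖ + L * T := by
      intro a ha
      rw [mem_closedBall_iff_norm] at ha
      calc ‖a‖ = ‖a₀ + (a - a₀)‖ := by simp
        _ ≤ ‖a₀‖ + ‖a - a₀‖ := norm_add_le _ _
        _ ≤ _ := by linarith
    refine ⟨K + (1 / (2 * R)).toNNReal * B, LipschitzOnWith.of_dist_le_mul fun a ha b hb => ?_⟩
    rw [dist_eq_norm, dist_eq_norm]
    have e1 : G a - G b = χ a • (F j a - F j b) + (χ a - χ b) • F j b := by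
      simp only [G, smul_sub, sub_smul]; abel
    have h1 := hK.dist_le_mul a (by simpa using hsub a ha) b (by simpa using hsub b hb)
    rw [dist_eq_norm, dist_eq_norm] at h1
    rw [e1]
    refine (norm_add_le _ _).trans ?_
    rw [norm_smul, norm_smul, Real.norm_eq_abs, Real.norm_eq_abs, abs_of_nonneg (hχ0 a)]
    have h2 : χ a * ‖F j a - F j b‖ ≤ 1 * (K * ‖a - b‖) := by
      gcongr
      exact hχ1 a
    have h3 : |χ a - χ b| * ‖F j b‖ ≤ ((1 / (2 * R)) * ‖a - b‖) * B := by
      gcongr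
      · exact hχl a b
      · exact hB b (hsub b hb)
    rw [NNReal.coe_add, NNReal.coe_mul, Real.coe_toNNReal _ (by positivity : 0 ≤ 1 / (2 * R))]
    linarith
  obtain ⟨K, hK⟩ := hGlip
  -- The speed is at most `L`, so the ball of radius `L * T` cannot be left before time `T`; this
  -- makes the full interval admissible.
  have hPL : IsPicardLindelof (fun _ => G) (tmin := 0) (tmax := T) ⟨0, le_rfl, hT0.le⟩ a₀
      (L * T.toNNReal) 0 L K :=
    { lipschitzOnWith := fun t _ => by
        have : ((L * T.toNNReal : NNReal) : ℝ) = L * T := by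
          rw [NNReal.coe_mul, Real.coe_toNNReal _ hT0.le]
        rw [this]; exact hK
      continuousOn := fun _ _ => continuousOn_const
      norm_le := fun _ _ a _ => hGL a
      mul_max_le := by simp [hT0.le] }
  obtain ⟨u, hu0, hu⟩ := hPL.exists_eq_forall_mem_Icc_hasDerivWithinAt₀
  refine ⟨u, hu0, ?_⟩
  have hbound : ∀ t ∈ Icc 0 T, ‖u t‖ ≤ Real.exp (C * t) * ‖a₀‖ := by
    intro t ht
    have h1 := le_exp_mul_of_hasDerivWithinAt (f := fun s => ‖u s‖ ^ 2)
      (f' := fun s => 2 * inner ℝ (u s) (G (u s))) (T := T) (K := 2 * C)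
      (δ := 0) (by positivity) le_rfl (fun s hs => (hu s hs).norm_sq)
      (fun s hs => by
        simp only [G, inner_smul_right]
        rw [real_inner_comm]
        by_cases hs' : ‖u s‖ ≤ 4 * R
        · have h3 := hE j (u s) hs'
          have h4 : χ (u s) * inner ℝ (F j (u s)) (u s) ≤ 1 * (C * ‖u s‖ ^ 2) := by
            calc χ (u s) * inner ℝ (F j (u s)) (u s)
                ≤ χ (u s) * (C * ‖u s‖ ^ 2) :=
                  mul_le_mul_of_nonneg_left ((le_abs_self _).trans h3) (hχ0 _)
              _ ≤ _ := mul_le_mul_of_nonneg_right (hχ1 _) (by positivity)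
          linarith
        · rw [hχz _ (not_le.1 hs')]
          simp only [zero_mul, mul_zero, add_zero]
          positivity) t ht
    simp only [hu0, zero_mul, add_zero] at h1
    have h2 : Real.exp (2 * C * t) * ‖a₀‖ ^ 2 = (Real.exp (C * t) * ‖a₀‖) ^ 2 := by
      rw [mul_pow, ← Real.exp_nat_mul]; congr 2; push_cast; ring
    rw [h2] at h1
    exact (sq_le_sq₀ (norm_nonneg _) (by positivity)).1 h1
  intro t ht
  refine ⟨?_, hbound t ht⟩
  have h2R : ‖u t‖ ≤ 2 * R := by
    refine (hbound t ht).trans ?_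
    have : Real.exp (C * t) ≤ 2 :=
      (Real.exp_le_exp.2 (mul_le_mul_of_nonneg_left ht.2 hC)).trans hT2
    exact mul_le_mul this ha₀ (norm_nonneg _) (by norm_num)
  have := hu t ht
  simp only [G, hχe _ h2R, one_smul] at this
  exact this

/-- The approximate solutions are Cauchy in `X` uniformly in time by weak energy and consistency.
Their strong bounds survive in the limit, and the equation passes to the limit in integral form. -/
theorem IsApproximation.exists_weakSolution [CompleteSpace X] (h : IsApproximation ι F N)
    (hι : Function.Injective ι) {R : ℝ} (hR : 0 < R) :
    ∃ T C, 0 < T ∧ 0 ≤ C ∧ ∀ a₀, ‖a₀‖ ≤ R → ∃ a : ℝ → H, a 0 = a₀ ∧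
      IsWeakSolution ι N T (2 * R) a ∧ ∀ t ∈ Icc 0 T, ‖a t‖ ≤ Real.exp (C * t) * ‖a₀‖ := by
  obtain ⟨T, C, hT, hC, hCT, hsol⟩ := h.exists_ode_solution hR
  refine ⟨T, C, hT, hC, fun a₀ ha₀ => ?_⟩
  choose u hu0 hu using fun j => hsol j a₀ ha₀
  have hexp : ∀ t ∈ Icc 0 T, Real.exp (C * t) * ‖a₀‖ ≤ 2 * R := by
    intro t ht
    have : Real.exp (C * t) ≤ 2 :=
      (Real.exp_le_exp.2 (mul_le_mul_of_nonneg_left ht.2 hC)).trans hCT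
    exact mul_le_mul this ha₀ (norm_nonneg _) (by norm_num)
  have huM : ∀ j, ∀ t ∈ Icc 0 T, ‖u j t‖ ≤ 2 * R :=
    fun j t ht => (hu j t ht).2.trans (hexp t ht)
  have hud : ∀ j, ∀ t ∈ Icc 0 T,
      HasDerivWithinAt (fun s => ι (u j s)) (ι (F j (u j t))) (Icc 0 T) t :=
    fun j t ht => ι.hasFDerivAt.comp_hasDerivWithinAt t (hu j t ht).1
  obtain ⟨E, hE, hE'⟩ := h.weak_energy (2 * R)
  obtain ⟨ε, hε, hε'⟩ := h.consistent (2 * R)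
  let M' := ‖ι‖ * (2 * R) + ‖ι‖ * (2 * R)
  have hM' : 0 ≤ M' := by positivity
  -- The difference of the two fields is split into `F i` at two points, controlled by the weak
  -- energy estimate, and the consistency errors of `F i` and `F j` at the same point `u j s`.
  have hdiff : ∀ i j, ∀ t ∈ Icc 0 T, ‖ι (u i t) - ι (u j t)‖ ^ 2 ≤
      Real.exp (2 * E * T) * (2 * (|ε i| + |ε j|) * M' * T) := by
    intro i j t ht
    have h1 := le_exp_mul_of_hasDerivWithinAt (f := fun s => ‖ι (u i s) - ι (u j s)‖ ^ 2)
      (f' := fun s => 2 * inner ℝ (ι (u i s) - ι (u j s)) (ι (F i (u i s)) - ι (F j (u j s))))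
      (T := T) (K := 2 * E) (δ := 2 * (|ε i| + |ε j|) * M') (by positivity) (by positivity)
      (fun s hs => ((hud i s hs).sub (hud j s hs)).norm_sq)
      (fun s hs => by
        have e1 : ι (F i (u i s)) - ι (F j (u j s)) = (ι (F i (u i s)) - ι (F i (u j s)))
          + ((ι (F i (u j s)) - N (u j s)) - (ι (F j (u j s)) - N (u j s))) := by abel
        rw [e1, inner_add_right]
        have h2 := (le_abs_self _).trans (hE' i (u i s) (u j s) (huM i s hs) (huM j s hs))
        rw [real_inner_comm] at h2
        have h3 := (le_abs_self _).trans (abs_real_inner_le_norm (ι (u i s) - ι (u j s))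
          ((ι (F i (u j s)) - N (u j s)) - (ι (F j (u j s)) - N (u j s))))
        have h4 : ‖ι (u i s) - ι (u j s)‖ ≤ M' := by
          refine (norm_sub_le _ _).trans (add_le_add ?_ ?_)
          · exact (ι.le_opNorm _).trans
              (mul_le_mul_of_nonneg_left (huM i s hs) (norm_nonneg _))
          · exact (ι.le_opNorm _).trans
              (mul_le_mul_of_nonneg_left (huM j s hs) (norm_nonneg _))
        have h5 : ‖(ι (F i (u j s)) - N (u j s)) - (ι (F j (u j s)) - N (u j s))‖ ≤
            |ε i| + |ε j| :=
          (norm_sub_le _ _).trans (add_le_add ((hε' i _ (huM j s hs)).trans (le_abs_self _))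
            ((hε' j _ (huM j s hs)).trans (le_abs_self _)))
        have h6 := mul_le_mul h4 h5 (norm_nonneg _) hM'
        nlinarith) t ht
    simp only [hu0, sub_self, norm_zero, ne_eq, OfNat.ofNat_ne_zero, not_false_eq_true, zero_pow,
      zero_add] at h1
    refine h1.trans ?_
    have := ht.2
    have := ht.1
    gcongr
  have hcau : ∀ η > 0, ∃ J, ∀ i ≥ J, ∀ j ≥ J, ∀ t ∈ Icc 0 T,
      ‖ι (u i t) - ι (u j t)‖ ≤ η := by
    intro η hη
    have hlim : Tendsto (fun j => Real.exp (2 * E * T) * (2 * (|ε j| + |ε j|) * M' * T)) atTop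
        (𝓝 (Real.exp (2 * E * T) * (2 * (|(0 : ℝ)| + |(0 : ℝ)|) * M' * T))) :=
      ((((hε.abs.add hε.abs).const_mul 2).mul_const M').mul_const T).const_mul _
    simp only [abs_zero, add_zero, mul_zero, zero_mul] at hlim
    obtain ⟨J, hJ⟩ := eventually_atTop.1
      (hlim.eventually_le_const (by positivity : (0 : ℝ) < η ^ 2))
    refine ⟨J, fun i hi j hj t ht => ?_⟩
    rw [← sq_le_sq₀ (norm_nonneg _) hη.le]
    have h1 := hdiff i j t ht
    have h2 := hJ i hi
    have h3 := hJ j hj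
    have h4 : Real.exp (2 * E * T) * (2 * (|ε i| + |ε j|) * M' * T) =
        (Real.exp (2 * E * T) * (2 * (|ε i| + |ε i|) * M' * T) +
        Real.exp (2 * E * T) * (2 * (|ε j| + |ε j|) * M' * T)) / 2 := by ring
    linarith
  have hlim : ∀ t ∈ Icc 0 T, ∃ a : H, Tendsto (fun j => ι (u j t)) atTop (𝓝 (ι a)) ∧
      ‖a‖ ≤ Real.exp (C * t) * ‖a₀‖ := by
    intro t ht
    have hc : CauchySeq (fun j => ι (u j t)) := by
      rw [Metric.cauchySeq_iff']
      intro η hη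
      obtain ⟨J, hJ⟩ := hcau (η / 2) (by positivity)
      refine ⟨J, fun i hi => ?_⟩
      rw [dist_eq_norm]
      exact (hJ i hi J le_rfl t ht).trans_lt (by linarith)
    obtain ⟨y, hy⟩ := cauchySeq_tendsto_of_complete hc
    obtain ⟨a, rfl, ha⟩ := exists_norm_le_of_tendsto hι (by positivity)
      (fun j => (hu j t ht).2) hy
    exact ⟨a, hy, ha⟩
  choose! a ha hab using hlim
  have haM : ∀ t ∈ Icc 0 T, ‖a t‖ ≤ 2 * R := fun t ht => (hab t ht).trans (hexp t ht)
  have hunif : ∀ η > 0, ∃ J, ∀ i ≥ J, ∀ t ∈ Icc 0 T, ‖ι (u i t) - ι (a t)‖ ≤ η := by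
    intro η hη
    obtain ⟨J, hJ⟩ := hcau η hη
    refine ⟨J, fun i hi t ht => ?_⟩
    exact le_of_tendsto (tendsto_const_nhds.sub (ha t ht)).norm
      (eventually_atTop.2 ⟨J, fun j hj => hJ i hi j hj t ht⟩)
  have h0T : (0 : ℝ) ∈ Icc 0 T := ⟨le_rfl, hT.le⟩
  have ha0 : a 0 = a₀ := by
    refine hι (tendsto_nhds_unique (ha 0 h0T) ?_)
    simp only [hu0]
    exact tendsto_const_nhds
  have hcont : ContinuousOn (fun t => ι (a t)) (Icc 0 T) := by
    have hU : TendstoUniformlyOn (fun j t => ι (u j t)) (fun t => ι (a t)) atTop (Icc 0 T) := by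
      rw [Metric.tendstoUniformlyOn_iff]
      intro η hη
      obtain ⟨J, hJ⟩ := hunif (η / 2) (by positivity)
      filter_upwards [eventually_ge_atTop J] with i hi t ht
      rw [dist_comm, dist_eq_norm]
      exact (hJ i hi t ht).trans_lt (by linarith)
    exact hU.continuousOn
      (Frequently.of_forall fun j t ht => (hud j t ht).continuousWithinAt)
  have hNcont : ContinuousOn (fun t => N (a t)) (Icc 0 T) := by
    rw [Metric.continuousOn_iff]
    intro t ht δ hδ
    obtain ⟨η, hη, hη'⟩ := h.limit_uniformContinuous (2 * R) (half_pos hδ)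
    obtain ⟨r, hr, hr'⟩ := Metric.continuousOn_iff.1 hcont t ht η hη
    refine ⟨r, hr, fun s hs hst => ?_⟩
    rw [dist_eq_norm]
    have := hr' s hs hst
    rw [dist_eq_norm] at this
    exact (hη' _ _ (haM s hs) (haM t ht) this.le).trans_lt (by linarith)
  -- A continuous extension to all of `ℝ`, so that its primitive is differentiable at every point,
  -- including the end points.
  let g : ℝ → X := IccExtend hT.le (fun t : Icc 0 T => N (a t))
  have hg : Continuous g := (continuousOn_iff_continuous_domRestrict.1 hNcont).Icc_extend'
  have hgN : ∀ t ∈ Icc 0 T, g t = N (a t) := fun t ht => IccExtend_of_mem _ _ ht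
  have hFN : ∀ δ > 0, ∃ J, ∀ i ≥ J, ∀ t ∈ Icc 0 T, ‖ι (F i (u i t)) - g t‖ ≤ δ := by
    intro δ hδ
    obtain ⟨η, hη, hη'⟩ := h.limit_uniformContinuous (2 * R) (half_pos hδ)
    obtain ⟨J, hJ⟩ := hunif η hη
    obtain ⟨J', hJ'⟩ := eventually_atTop.1 (hε.eventually_le_const (half_pos hδ))
    refine ⟨max J J', fun i hi t ht => ?_⟩
    rw [hgN t ht]
    have e : ι (F i (u i t)) - N (a t) = (ι (F i (u i t)) - N (u i t)) + (N (u i t) - N (a t)) := by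
      abel
    rw [e]
    refine (norm_add_le _ _).trans ?_
    have h1 := hε' i _ (huM i t ht)
    have h2 := hJ' i ((le_max_right _ _).trans hi)
    have h3 := hη' _ _ (huM i t ht) (haM t ht) (hJ i ((le_max_left _ _).trans hi) t ht)
    linarith
  have hy : ∀ t, HasDerivAt (fun t => ι a₀ + ∫ s in (0 : ℝ)..t, g s) (g t) t := fun t =>
    (hg.integral_hasStrictDerivAt 0 t).hasDerivAt.const_add _
  have hay : ∀ t ∈ Icc 0 T, ι (a t) = ι a₀ + ∫ s in (0 : ℝ)..t, g s := by
    intro t ht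
    -- The approximate solution and the primitive start at the same point and have uniformly close
    -- derivatives, so the mean value inequality bounds their distance.
    refine tendsto_nhds_unique (ha t ht) ?_
    rw [Metric.tendsto_atTop]
    intro δ hδ
    obtain ⟨J, hJ⟩ := hFN (δ / (T + 1)) (by positivity)
    refine ⟨J, fun i hi => ?_⟩
    have h1 := (convex_Icc 0 T).norm_image_sub_le_of_norm_hasDerivWithin_le
      (fun s hs => (hud i s hs).sub (hy s).hasDerivWithinAt) (fun s hs => hJ i hi s hs) h0T ht
    simp only [hu0, Pi.sub_apply, intervalIntegral.integral_same, add_zero, sub_self, sub_zero] at h1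
    rw [dist_eq_norm]
    refine h1.trans_lt ?_
    rw [Real.norm_eq_abs, abs_of_nonneg ht.1, div_mul_eq_mul_div, div_lt_iff₀ (by positivity)]
    nlinarith [ht.2]
  refine ⟨a, ha0, ⟨haM, fun t ht => ?_⟩, hab⟩
  rw [← hgN t ht]
  exact (hy t).hasDerivWithinAt.congr hay (hay t ht)

/-- Weak continuity and an upper bound for the norm give strong continuity. -/
theorem continuousWithinAt_of_norm_le [CompleteSpace X] (hι : Function.Injective ι) {a : ℝ → H}
    {s : Set ℝ} {t₀ M : ℝ} {γ : ℝ → ℝ} (hM : ∀ t ∈ s, ‖a t‖ ≤ M) (ht₀ : t₀ ∈ s)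
    (hw : ContinuousWithinAt (fun t => ι (a t)) s t₀)
    (hγ : Tendsto γ (𝓝[s] t₀) (𝓝 ‖a t₀‖)) (hb : ∀ᶠ t in 𝓝[s] t₀, ‖a t‖ ≤ γ t) :
    ContinuousWithinAt a s t₀ := by
  -- Weak continuity against `a t₀` itself: this vector is approximated by an adjoint image, for
  -- which the pairing is computed in `X`; boundedness of `a` absorbs the error.
  have hinner : Tendsto (fun t => inner ℝ (a t) (a t₀)) (𝓝[s] t₀) (𝓝 (inner ℝ (a t₀) (a t₀))) := by
    rw [Metric.tendsto_nhds]
    intro δ hδ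
    obtain ⟨x, hx⟩ := (denseRange_adjoint hι).exists_dist_lt (a t₀)
      (by positivity : 0 < δ / (4 * (|M| + 1)))
    rw [dist_eq_norm] at hx
    have h0 : Tendsto (fun t => inner ℝ (ι (a t)) x) (𝓝[s] t₀) (𝓝 (inner ℝ (ι (a t₀)) x)) :=
      Filter.Tendsto.inner hw tendsto_const_nhds
    have h1 := Metric.tendsto_nhds.1 h0 (δ / 2) (by positivity)
    filter_upwards [h1, self_mem_nhdsWithin] with t ht hts
    rw [Real.dist_eq] at ht ⊢
    have e : inner ℝ (a t) (a t₀) - inner ℝ (a t₀) (a t₀) =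
        inner ℝ (a t - a t₀) (a t₀ - ContinuousLinearMap.adjoint ι x) +
        (inner ℝ (ι (a t)) x - inner ℝ (ι (a t₀)) x) := by
      rw [← ContinuousLinearMap.adjoint_inner_right, ← ContinuousLinearMap.adjoint_inner_right,
        ← inner_sub_left, ← inner_sub_left, ← inner_add_right]
      simp
    have h2 := abs_real_inner_le_norm (a t - a t₀) (a t₀ - ContinuousLinearMap.adjoint ι x)
    have h3 : ‖a t - a t₀‖ ≤ 2 * (|M| + 1) := by
      refine (norm_sub_le _ _).trans ?_
      linarith [hM t hts, hM t₀ ht₀, le_abs_self M]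
    have h4 : ‖a t - a t₀‖ * ‖a t₀ - ContinuousLinearMap.adjoint ι x‖ ≤
        2 * (|M| + 1) * (δ / (4 * (|M| + 1))) :=
      mul_le_mul h3 hx.le (norm_nonneg _) (by positivity)
    have h5 : 2 * (|M| + 1) * (δ / (4 * (|M| + 1))) = δ / 2 := by field_simp; ring
    rw [e]
    refine (abs_add_le _ _).trans_lt ?_
    linarith
  -- Expanding the square, `‖a t - a t₀‖²` is at most this expression, and its limit is zero.
  have h2 : Tendsto (fun t => γ t ^ 2 - 2 * inner ℝ (a t) (a t₀) + ‖a t₀‖ ^ 2) (𝓝[s] t₀)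
      (𝓝 (‖a t₀‖ ^ 2 - 2 * inner ℝ (a t₀) (a t₀) + ‖a t₀‖ ^ 2)) :=
    ((hγ.pow 2).sub (hinner.const_mul 2)).add tendsto_const_nhds
  rw [real_inner_self_eq_norm_sq, show ‖a t₀‖ ^ 2 - 2 * ‖a t₀‖ ^ 2 + ‖a t₀‖ ^ 2 = 0 by ring] at h2
  have h3 : Tendsto (fun t => ‖a t - a t₀‖ ^ 2) (𝓝[s] t₀) (𝓝 0) := by
    refine squeeze_zero' (Eventually.of_forall fun _ => sq_nonneg _) ?_ h2
    filter_upwards [hb] with t ht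
    rw [norm_sub_sq_real]
    have := pow_le_pow_left₀ (norm_nonneg _) ht 2
    linarith
  have h4 : Tendsto (fun t => ‖a t - a t₀‖) (𝓝[s] t₀) (𝓝 0) := by
    have := h3.sqrt
    simpa [Real.sqrt_sq (norm_nonneg _)] using this
  exact tendsto_iff_norm_sub_tendsto_zero.2 h4

/-- A solution restarted at `t₀` coincides by uniqueness with the constructed one, which obeys the
exponential bound. The time `τ` depends only on the bound `M`, so it does not shrink with `t₀`. -/
theorem IsApproximation.norm_le_of_isWeakSolution [CompleteSpace X] (h : IsApproximation ι F N)
    (hι : Function.Injective ι) {M : ℝ} (hM : 0 < M) :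
    ∃ τ C, 0 < τ ∧ ∀ T (a : ℝ → H), IsWeakSolution ι N T M a → ∀ t₀ ∈ Icc 0 T, ∀ s ∈ Icc 0 τ,
      t₀ + s ≤ T → ‖a (t₀ + s)‖ ≤ Real.exp (C * s) * ‖a t₀‖ := by
  obtain ⟨τ, C, hτ, -, hex⟩ := h.exists_weakSolution hι hM
  refine ⟨τ, C, hτ, fun T a ha t₀ ht₀ s hs hsT => ?_⟩
  obtain ⟨b, hb0, hb, hbe⟩ := hex (a t₀) (ha.bound t₀ ht₀)
  have h1 := (ha.shift ht₀.1).mono (T' := s) (M' := 2 * M) (by linarith) (by linarith)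
  have h2 := h1.unique h hι (hb.mono hs.2 le_rfl) (by simp [hb0]) ⟨hs.1, le_rfl⟩
  have h3 : a (t₀ + s) = b s := h2
  rw [h3]
  exact hbe s hs

theorem IsWeakSolution.continuousOn [CompleteSpace X] (h : IsApproximation ι F N)
    (hι : Function.Injective ι) {T M : ℝ} (hM : 0 < M) {a : ℝ → H}
    (ha : IsWeakSolution ι N T M a) : ContinuousOn a (Icc 0 T) := by
  intro t₀ ht₀
  obtain ⟨τ, C, hτ, h1⟩ := h.norm_le_of_isWeakSolution hι hM
  obtain ⟨τ', C', hτ', h2⟩ := h.neg.norm_le_of_isWeakSolution hι hM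
  refine continuousWithinAt_of_norm_le hι ha.bound ht₀ (ha.deriv t₀ ht₀).continuousWithinAt
    (γ := fun t => max (Real.exp (C * (t - t₀)) * ‖a t₀‖) (Real.exp (C' * (t₀ - t)) * ‖a t₀‖))
    ?_ ?_
  · have hc : Continuous fun t =>
        max (Real.exp (C * (t - t₀)) * ‖a t₀‖) (Real.exp (C' * (t₀ - t)) * ‖a t₀‖) := by
      fun_prop
    have := hc.tendsto t₀
    simp only [sub_self, mul_zero, Real.exp_zero, one_mul, max_self] at this
    exact this.mono_left nhdsWithin_le_nhds
  · have hn : Ioo (t₀ - τ') (t₀ + τ) ∈ 𝓝[Icc 0 T] t₀ :=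
      mem_nhdsWithin_of_mem_nhds (Ioo_mem_nhds (by linarith) (by linarith))
    filter_upwards [hn, self_mem_nhdsWithin] with t ht htT
    rcases le_total t₀ t with h3 | h3
    · refine le_trans ?_ (le_max_left _ _)
      have := h1 T a ha t₀ ht₀ (t - t₀) ⟨by linarith, by linarith [ht.2]⟩ (by linarith [htT.2])
      simpa using this
    -- Before `t₀`, the curve run backwards solves the equation with the opposite sign.
    · refine le_trans ?_ (le_max_right _ _)
      have := h2 t₀ _ (ha.reverse ht₀.2) 0 ⟨le_rfl, ht₀.1⟩ (t₀ - t)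
        ⟨by linarith, by linarith [ht.1]⟩ (by linarith [htT.1])
      simpa using this

/-- Local well-posedness of `a' = N a` in the strong space. -/
theorem IsApproximation.exists_unique_solution [CompleteSpace X] (h : IsApproximation ι F N)
    (hι : Function.Injective ι) {R : ℝ} (hR : 0 < R) :
    ∃ T, 0 < T ∧ ∀ a₀, ‖a₀‖ ≤ R → ∃ a : ℝ → H,
      (ContinuousOn a (Icc 0 T) ∧ a 0 = a₀ ∧
        ∀ t ∈ Icc 0 T, HasDerivWithinAt (fun s => ι (a s)) (N (a t)) (Icc 0 T) t) ∧
      ∀ b : ℝ → H, ContinuousOn b (Icc 0 T) → b 0 = a₀ →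
        (∀ t ∈ Icc 0 T, HasDerivWithinAt (fun s => ι (b s)) (N (b t)) (Icc 0 T) t) →
        EqOn b a (Icc 0 T) := by
  obtain ⟨T, C, hT, -, hex⟩ := h.exists_weakSolution hι hR
  refine ⟨T, hT, fun a₀ ha₀ => ?_⟩
  obtain ⟨a, ha0, ha, -⟩ := hex a₀ ha₀
  refine ⟨a, ⟨ha.continuousOn h hι (by positivity), ha0, ha.deriv⟩, fun b hb hb0 hbd => ?_⟩
  -- A competitor carries no a priori bound; compactness of the time interval supplies one, and the
  -- uniqueness estimate holds on every ball.
  obtain ⟨M, hM⟩ := isCompact_Icc.exists_bound_of_continuousOn hb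
  have hbw : IsWeakSolution ι N T (max M (2 * R)) b :=
    ⟨fun t ht => (hM t ht).trans (le_max_left _ _), hbd⟩
  exact hbw.unique h hι (ha.mono le_rfl (le_max_right _ _)) (hb0.trans ha0.symm)

end Evolution

end MachStem

/-! ### The algebra of test functions, and `Γ^k` as a Hilbert space. -/

namespace MachStem

noncomputable section

variable {n : ℕ}

/-- The vector space of test functions. -/
def testSubmodule (n : ℕ) : Submodule ℝ (Space n → ℝ) where
  carrier := {φ | IsTest φ}
  add_mem' h h' := ⟨h.1.add h'.1, h.2.add h'.2⟩
  zero_mem' := ⟨contDiff_const, HasCompactSupport.zero⟩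
  smul_mem' c _ h := ⟨contDiff_const.smul h.1, h.2.smul_left (f := fun _ => c)⟩

abbrev Test (n : ℕ) : Type := testSubmodule n

instance : CoeFun (Test n) (fun _ => Space n → ℝ) := ⟨fun φ => φ.1⟩

namespace Test

@[ext]
theorem ext' {φ ψ : Test n} (h : ∀ x, φ x = ψ x) : φ = ψ := Subtype.ext (funext h)

theorem contDiff (φ : Test n) : ContDiff ℝ ∞ φ.1 := φ.2.1

theorem hasCompactSupport (φ : Test n) : HasCompactSupport φ.1 := φ.2.2

theorem continuous (φ : Test n) : Continuous φ.1 := φ.contDiff.continuous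

theorem differentiable (φ : Test n) : Differentiable ℝ φ.1 := φ.contDiff.differentiable (by simp)

@[simp] theorem add_apply (φ ψ : Test n) (x : Space n) : (φ + ψ) x = φ x + ψ x := rfl

@[simp] theorem sub_apply (φ ψ : Test n) (x : Space n) : (φ - ψ) x = φ x - ψ x := rfl

@[simp] theorem neg_apply (φ : Test n) (x : Space n) : (-φ) x = -φ x := rfl

@[simp] theorem smul_apply (c : ℝ) (φ : Test n) (x : Space n) : (c • φ) x = c * φ x := rfl

theorem memLp (φ : Test n) (p : ENNReal) : MemLp φ.1 p volume :=
  φ.continuous.memLp_of_hasCompactSupport φ.hasCompactSupport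

/-- The partial derivative in the `i`-th coordinate. -/
def d (i : Fin (n + 1)) : Test n →ₗ[ℝ] Test n where
  toFun φ := ⟨partialDeriv i φ, φ.2.partialDeriv i⟩
  map_add' φ ψ := by
    ext x
    simp [partialDeriv, fderiv_add φ.differentiable.differentiableAt
      ψ.differentiable.differentiableAt]
  map_smul' c φ := by
    ext x
    simp [partialDeriv, fderiv_const_smul φ.differentiable.differentiableAt]

theorem d_apply (i : Fin (n + 1)) (φ : Test n) (x : Space n) :
    d i φ x = fderiv ℝ φ x (EuclideanSpace.single i 1) := rfl

theorem d_coe (i : Fin (n + 1)) (φ : Test n) : (d i φ : Test n).1 = partialDeriv i φ.1 := rfl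

/-- Multiplication by `θ`. -/
def th : Test n →ₗ[ℝ] Test n where
  toFun φ := ⟨fun x => x (Fin.last n) * φ x, by
    have h := φ.2.weight 1
    have e : MachStem.weight 1 φ.1 = fun x => x (Fin.last n) * φ x := by
      funext x; simp [MachStem.weight]
    exact e ▸ h⟩
  map_add' φ ψ := by ext x; simp [mul_add]
  map_smul' c φ := by ext x; simp; ring

theorem th_apply (φ : Test n) (x : Space n) : th φ x = x (Fin.last n) * φ x := rfl

/-- The pointwise product. -/
def mul (φ ψ : Test n) : Test n := ⟨fun x => φ x * ψ x, φ.contDiff.mul ψ.contDiff,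
  φ.hasCompactSupport.mul_right⟩

theorem mul_apply (φ ψ : Test n) (x : Space n) : mul φ ψ x = φ x * ψ x := rfl

/-- The class of a test function in `L²`. -/
def toL2 : Test n →ₗ[ℝ] L2 n where
  toFun φ := (φ.memLp 2).toLp φ
  map_add' φ ψ := (MemLp.toLp_add (φ.memLp 2) (ψ.memLp 2))
  map_smul' c φ := (MemLp.toLp_const_smul c (φ.memLp 2))

theorem coeFn_toL2 (φ : Test n) : toL2 φ =ᵐ[volume] φ.1 := MemLp.coeFn_toLp (φ.memLp 2)

theorem inner_toL2 (u : L2 n) (φ : Test n) : inner ℝ u (toL2 φ) = ∫ x, u x * φ x := by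
  rw [L2.inner_def]
  refine integral_congr_ae ?_
  filter_upwards [φ.coeFn_toL2] with x hx
  rw [hx]
  simp [mul_comm]

theorem inner_toL2_toL2 (φ ψ : Test n) : inner ℝ (toL2 φ) (toL2 ψ) = ∫ x, φ x * ψ x := by
  rw [inner_toL2]
  refine integral_congr_ae ?_
  filter_upwards [φ.coeFn_toL2] with x hx
  rw [hx]

theorem integrable_mul (φ ψ : Test n) : Integrable (fun x => φ x * ψ x) :=
  (mul φ ψ).continuous.integrable_of_hasCompactSupport (mul φ ψ).hasCompactSupport

theorem norm_toL2_sq (φ : Test n) : ‖toL2 φ‖ ^ 2 = ∫ x, φ x ^ 2 := by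
  rw [← real_inner_self_eq_norm_sq, inner_toL2_toL2]
  simp only [sq]

theorem d_comm (i j : Fin (n + 1)) : Commute (d i : Module.End ℝ (Test n)) (d j) := by
  refine LinearMap.ext fun φ => ext' fun x => ?_
  have hd : Differentiable ℝ (fun y => fderiv ℝ φ.1 y) :=
    (φ.contDiff.fderiv_right (m := ∞) (by simp)).differentiable (by simp)
  have h1 : ∀ a b : Fin (n + 1), (d a * d b : Module.End ℝ (Test n)) φ x =
      fderiv ℝ (fun y => fderiv ℝ φ.1 y) x (EuclideanSpace.single a 1)
        (EuclideanSpace.single b 1) := by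
    intro a b
    rw [Module.End.mul_apply, d_apply]
    have : (d b φ).1 = fun y => fderiv ℝ φ.1 y (EuclideanSpace.single b 1) := rfl
    rw [this, fderiv_clm_apply (hd x) (differentiableAt_const _)]
    simp
  rw [h1, h1]
  have hs : IsSymmSndFDerivAt ℝ φ.1 x :=
    φ.contDiff.contDiffAt.isSymmSndFDerivAt (by
      rw [minSmoothness_of_isRCLikeNormedField]; exact WithTop.coe_le_coe.2 (le_top : (2 : ℕ∞) ≤ ⊤))
  exact hs _ _

theorem hasFDerivAt (φ : Test n) (x : Space n) : HasFDerivAt φ.1 (fderiv ℝ φ.1 x) x :=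
  (φ.differentiable x).hasFDerivAt

theorem d_mul (i : Fin (n + 1)) (φ ψ : Test n) :
    d i (mul φ ψ) = mul (d i φ) ψ + mul φ (d i ψ) := by
  ext x
  rw [d_apply]
  have : (mul φ ψ).1 = fun x => φ x * ψ x := rfl
  have h2 : HasFDerivAt (fun x => φ x * ψ x) _ x := (φ.hasFDerivAt x).mul (ψ.hasFDerivAt x)
  rw [this, h2.fderiv]
  simp [mul_apply, d_apply]
  ring

theorem th_mul (φ ψ : Test n) : th (mul φ ψ) = mul (th φ) ψ := by
  ext x; simp [th_apply, mul_apply]; ring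

theorem mul_comm' (φ ψ : Test n) : mul φ ψ = mul ψ φ := by
  ext x; simp only [mul_apply]; ring

theorem d_th (i : Fin (n + 1)) (φ : Test n) :
    d i (th φ) = th (d i φ) + (if i = Fin.last n then φ else 0) := by
  ext x
  rw [d_apply]
  have h1 : HasFDerivAt (fun x : Space n => x (Fin.last n))
      (EuclideanSpace.proj (Fin.last n) : Space n →L[ℝ] ℝ) x :=
    (EuclideanSpace.proj (Fin.last n) : Space n →L[ℝ] ℝ).hasFDerivAt
  have : (th φ).1 = fun x => x (Fin.last n) * φ x := rfl
  have h2 : HasFDerivAt (fun x : Space n => x (Fin.last n) * φ x) _ x := h1.mul (φ.hasFDerivAt x)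
  rw [this, h2.fderiv]
  by_cases hi : i = Fin.last n
  · subst hi
    simp [th_apply, d_apply]
  · have : Fin.last n ≠ i := fun h => hi h.symm
    simp [th_apply, d_apply, hi, this]

/-- Integration by parts. -/
theorem integral_d_mul (i : Fin (n + 1)) (φ ψ : Test n) :
    ∫ x, d i φ x * ψ x = - ∫ x, φ x * d i ψ x := by
  have := integral_mul_fderiv_eq_neg_fderiv_mul_of_integrable (μ := (volume : Measure (Space n)))
    (f := φ.1) (g := ψ.1) (v := EuclideanSpace.single i 1)
    ((d i φ).integrable_mul ψ) (φ.integrable_mul (d i ψ)) (φ.integrable_mul ψ)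
    (fun x _ => φ.differentiable x) (fun x _ => ψ.differentiable x)
  have h2 : ∫ x, φ x * d i ψ x = - ∫ x, d i φ x * ψ x := this
  rw [h2, neg_neg]

/-- The derivative `∂^β`. -/
def D (β : Fin (n + 1) → ℕ) : Module.End ℝ (Test n) :=
  ((List.finRange (n + 1)).map fun i => d i ^ β i).prod

theorem coe_pow_d (i : Fin (n + 1)) (m : ℕ) (φ : Test n) :
    ((d i ^ m : Module.End ℝ (Test n)) φ).1 = (partialDeriv i)^[m] φ.1 := by
  induction m with
  | zero => rfl
  | succ m ih => rw [pow_succ', Module.End.mul_apply, d_coe, ih, Function.iterate_succ_apply']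

theorem coe_D (β : Fin (n + 1) → ℕ) (φ : Test n) : (D β φ).1 = multiDeriv β φ.1 := by
  unfold D multiDeriv
  induction List.finRange (n + 1) with
  | nil => rfl
  | cons i l ih =>
    rw [List.map_cons, List.prod_cons, Module.End.mul_apply, coe_pow_d, ih, List.foldr_cons]

theorem coe_pow_th (α : ℕ) (φ : Test n) :
    ((th ^ α : Module.End ℝ (Test n)) φ).1 = weight α φ.1 := by
  induction α with
  | zero => funext x; simp [weight]
  | succ α ih =>
    funext x
    have := congrFun ih x
    rw [pow_succ', Module.End.mul_apply, th_apply, this]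
    simp [weight, pow_succ']
    ring

theorem D_zero : (D 0 : Module.End ℝ (Test n)) = 1 := by
  unfold D
  refine List.prod_eq_one fun x hx => ?_
  obtain ⟨i, -, rfl⟩ := List.mem_map.1 hx
  simp

/-- The ordered product defining `D` places the new factor in the middle; partial derivatives
commute, so it can be brought to the front. This makes induction on multi-indices possible. -/
theorem D_add_single (β : Fin (n + 1) → ℕ) (j : Fin (n + 1)) :
    D (β + Pi.single j 1) = d j * D β := by
  have key : ∀ l : List (Fin (n + 1)), l.Nodup →
      (l.map fun i => (d i : Module.End ℝ (Test n)) ^ (β + Pi.single j 1 : Fin (n + 1) → ℕ) i).prod =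
        if j ∈ l then d j * (l.map fun i => (d i : Module.End ℝ (Test n)) ^ β i).prod
        else (l.map fun i => (d i : Module.End ℝ (Test n)) ^ β i).prod := by
    intro l
    induction l with
    | nil => simp
    | cons i l ih =>
      intro hl
      rw [List.nodup_cons] at hl
      rw [List.map_cons, List.prod_cons, ih hl.2, List.map_cons, List.prod_cons]
      by_cases hij : j = i
      · subst hij
        simp [hl.1, pow_succ', mul_assoc]
      · have h1 : (β + Pi.single j 1 : Fin (n + 1) → ℕ) i = β i := by
          simp [Ne.symm hij]
        rw [h1]
        by_cases hjl : j ∈ l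
        · rw [if_pos hjl, if_pos (List.mem_cons_of_mem _ hjl), ← mul_assoc, ← mul_assoc,
            ((d_comm j i).pow_right (β i)).eq]
        · rw [if_neg hjl, if_neg (by simp [hij, hjl])]
  have := key _ (List.nodup_finRange (n + 1))
  rwa [if_pos (List.mem_finRange j)] at this

/-- Induction on multi-indices. -/
theorem multiIndex_induction {P : (Fin (n + 1) → ℕ) → Prop} (h0 : P 0)
    (hs : ∀ β j, P β → P (β + Pi.single j 1)) (β : Fin (n + 1) → ℕ) : P β := by
  induction hm : ∑ i, β i generalizing β with
  | zero =>
    have : β = 0 := by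
      funext i
      simpa using (Finset.sum_eq_zero_iff.1 hm) i (Finset.mem_univ i)
    rw [this]; exact h0
  | succ m ih =>
    obtain ⟨j, -, hj⟩ := Finset.exists_ne_zero_of_sum_ne_zero (by rw [hm]; omega)
    have e : β = (β - Pi.single j 1) + Pi.single j 1 := by
      funext i
      by_cases hij : i = j
      · subst hij; simp; omega
      · simp [hij]
    rw [e]
    refine hs _ j (ih _ ?_)
    have h2 : ∑ i, β i = ∑ i, (β - Pi.single j 1 : Fin (n + 1) → ℕ) i + ∑ i, (Pi.single j 1 : Fin (n + 1) → ℕ) i := by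
      rw [← Finset.sum_add_distrib]
      conv_lhs => rw [e]
      rfl
    rw [Finset.sum_pi_single'] at h2
    simp only [Finset.mem_univ, if_true] at h2
    omega

theorem sum_add_single (β : Fin (n + 1) → ℕ) (j : Fin (n + 1)) :
    ∑ i, (β + Pi.single j 1 : Fin (n + 1) → ℕ) i = ∑ i, β i + 1 := by
  simp [Finset.sum_add_distrib, Finset.sum_pi_single']

theorem D_comm_d (β : Fin (n + 1) → ℕ) (j : Fin (n + 1)) : Commute (D β) (d j) := by
  induction β using multiIndex_induction with
  | h0 => rw [D_zero]; exact Commute.one_left _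
  | hs β i ih => rw [D_add_single]; exact (d_comm i j).mul_left ih

/-- The commutator of a derivative with `θ` only sees the last coordinate. If the last entry of `β`
is zero, the truncated subtraction leaves `β` unchanged, which is harmless because the coefficient
vanishes. -/
theorem D_th (β : Fin (n + 1) → ℕ) (φ : Test n) :
    D β (th φ) = th (D β φ) +
      (β (Fin.last n) : ℝ) • D (β - Pi.single (Fin.last n) 1) φ := by
  induction β using multiIndex_induction with
  | h0 => simp [D_zero]
  | hs β j ih =>
    rw [D_add_single, Module.End.mul_apply, ih, map_add, map_smul, d_th,
      ← Module.End.mul_apply (d j) (D β), ← Module.End.mul_apply (d j) (D _), ← D_add_single,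
      ← D_add_single, add_assoc]
    congr 1
    by_cases hj : j = Fin.last n
    · subst hj
      rw [if_pos rfl]
      rcases Nat.eq_zero_or_pos (β (Fin.last n)) with h0 | h0
      · simp [h0]
      · have e : β - Pi.single (Fin.last n) 1 + Pi.single (Fin.last n) 1 = β := by
          funext i
          by_cases hi : i = Fin.last n
          · subst hi; simp; omega
          · simp [hi]
        rw [e]
        simp [add_smul, add_comm]
    · have e : β + Pi.single j 1 - Pi.single (Fin.last n) 1 =
          β - Pi.single (Fin.last n) 1 + Pi.single j 1 := by
        funext i
        by_cases hi : i = Fin.last n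
        · subst hi; simp [Ne.symm hj]
        · simp [hi]
      rw [if_neg hj, e]
      simp [Ne.symm hj]

theorem inner_D (β : Fin (n + 1) → ℕ) (φ ψ : Test n) :
    ∫ x, D β φ x * ψ x = (-1) ^ (∑ i, β i) * ∫ x, φ x * D β ψ x := by
  induction β using multiIndex_induction generalizing φ ψ with
  | h0 => simp [D_zero]
  | hs β j ih =>
    rw [sum_add_single, D_add_single, Module.End.mul_apply, integral_d_mul, ih,
      ← Module.End.mul_apply, ← (D_comm_d β j).eq, pow_succ]
    ring

theorem integral_pow_th_mul (α : ℕ) (φ ψ : Test n) :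
    ∫ x, (th ^ α : Module.End ℝ (Test n)) φ x * ψ x =
      ∫ x, φ x * (th ^ α : Module.End ℝ (Test n)) ψ x := by
  refine integral_congr_ae (Filter.Eventually.of_forall fun x => ?_)
  simp only [coe_pow_th, weight]; ring

end Test

/-- In terms of inner products both sides are continuous in `u` and `g`, so weighted derivatives
form a closed relation. -/
theorem isWeightedDeriv_iff {α : ℕ} {β : Fin (n + 1) → ℕ} {u g : L2 n} :
    IsWeightedDeriv α β u g ↔ ∀ φ : Test n, inner ℝ g (Test.toL2 φ) = (-1) ^ (∑ i, β i) *
      inner ℝ u (Test.toL2 (Test.D β ((Test.th ^ α : Module.End ℝ (Test n)) φ))) := by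
  have key : ∀ φ : Test n, (inner ℝ g (Test.toL2 φ) = (-1) ^ (∑ i, β i) *
      inner ℝ u (Test.toL2 (Test.D β ((Test.th ^ α : Module.End ℝ (Test n)) φ)))) ↔
      ∫ x, g x * φ x = (-1) ^ (∑ i, β i) * ∫ x, u x * multiDeriv β (weight α φ) x := by
    intro φ
    rw [Test.inner_toL2, Test.inner_toL2, Test.coe_D, Test.coe_pow_th]
  exact ⟨fun h φ => (key φ).2 (h φ φ.2), fun h φ hφ => (key ⟨φ, hφ⟩).1 (h ⟨φ, hφ⟩)⟩

theorem Test.isWeightedDeriv (α : ℕ) (β : Fin (n + 1) → ℕ) (φ : Test n) :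
    IsWeightedDeriv α β (toL2 φ) (toL2 ((th ^ α : Module.End ℝ (Test n)) (D β φ))) := by
  rw [isWeightedDeriv_iff]
  intro ψ
  rw [inner_toL2_toL2, inner_toL2_toL2, integral_pow_th_mul, inner_D]

/-- Test functions as elements of `Γ^k`. -/
def Test.toGamma (k : ℕ) : Test n →ₗ[ℝ] Gamma n k where
  toFun φ := ⟨toL2 φ, fun α β _ => ⟨_, φ.isWeightedDeriv α β⟩⟩
  map_add' φ ψ := Subtype.ext (map_add toL2 φ ψ)
  map_smul' c φ := Subtype.ext (map_smul toL2 c φ)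

@[simp]
theorem Test.toL2_toGamma (k : ℕ) (φ : Test n) : (toGamma k φ).toL2 = toL2 φ := rfl

theorem Test.weightedDeriv_eq (α : ℕ) (β : Fin (n + 1) → ℕ) (φ : Test n) :
    weightedDeriv α β (toL2 φ) = toL2 ((th ^ α : Module.End ℝ (Test n)) (D β φ)) :=
  MachStem.weightedDeriv_eq (φ.isWeightedDeriv α β)

theorem Test.norm_toGamma_sq (k : ℕ) (φ : Test n) : ‖toGamma k φ‖ ^ 2 =
    ∑ p ∈ gammaIndex n k, ‖toL2 ((th ^ p.1 : Module.End ℝ (Test n)) (D p.2 φ))‖ ^ 2 := by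
  rw [Gamma.norm_sq_eq]
  refine Finset.sum_congr rfl fun p _ => ?_
  rw [toL2_toGamma, weightedDeriv_eq]

instance (n k : ℕ) : InnerProductSpace ℝ (Gamma n k) where
  inner u v := inner ℝ (Gamma.jet n k u) (Gamma.jet n k v)
  norm_sq_eq_re_inner u := norm_sq_eq_re_inner (𝕜 := ℝ) (Gamma.jet n k u)
  conj_inner_symm u v := inner_conj_symm (𝕜 := ℝ) (Gamma.jet n k u) (Gamma.jet n k v)
  add_left u v w := by rw [map_add]; exact inner_add_left _ _ _
  smul_left u v r := by rw [map_smul]; exact inner_smul_left _ _ _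

theorem Gamma.inner_eq {k : ℕ} (u v : Gamma n k) : inner ℝ u v =
    ∑ p ∈ gammaIndex n k, inner ℝ (weightedDeriv p.1 p.2 u.toL2) (weightedDeriv p.1 p.2 v.toL2) := by
  have e : inner ℝ u v = inner ℝ (Gamma.jet n k u) (Gamma.jet n k v) := rfl
  rw [e, PiLp.inner_apply, ← Finset.sum_coe_sort (gammaIndex n k)
    (fun p => inner ℝ (weightedDeriv p.1 p.2 u.toL2) (weightedDeriv p.1 p.2 v.toL2))]
  rfl

theorem Gamma.norm_weightedDeriv_le {k : ℕ} (u : Gamma n k) {α : ℕ} {β : Fin (n + 1) → ℕ}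
    (h : α + ∑ i, β i ≤ k) : ‖weightedDeriv α β u.toL2‖ ≤ ‖u‖ := by
  rw [← sq_le_sq₀ (norm_nonneg _) (norm_nonneg _), Gamma.norm_sq_eq]
  have hp : (α, β) ∈ gammaIndex n k := mem_gammaIndex.2 h
  have h1 := Finset.single_le_sum (f := fun p : ℕ × (Fin (n + 1) → ℕ) =>
    ‖weightedDeriv p.1 p.2 u.toL2‖ ^ 2) (fun _ _ => sq_nonneg _) hp
  exact h1

theorem Gamma.norm_toL2_le {k : ℕ} (u : Gamma n k) : ‖u.toL2‖ ≤ ‖u‖ := by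
  have := u.norm_weightedDeriv_le (α := 0) (β := 0) (by simp)
  rwa [MachStem.weightedDeriv_eq (isWeightedDeriv_zero_zero _)] at this

/-- The inclusion of `Γ^k` in `L²` as a continuous map. -/
def Gamma.incl (n k : ℕ) : Gamma n k →L[ℝ] L2 n :=
  LinearMap.mkContinuous Gamma.toL2 1 fun u => by simpa using u.norm_toL2_le

@[simp] theorem Gamma.incl_apply {k : ℕ} (u : Gamma n k) : Gamma.incl n k u = u.toL2 := rfl

theorem Gamma.toL2_injective (n k : ℕ) : Function.Injective (Gamma.toL2 : Gamma n k →ₗ[ℝ] L2 n) :=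
  Subtype.val_injective

theorem Gamma.weightedDeriv_sub {k : ℕ} (u v : Gamma n k) {α : ℕ} {β : Fin (n + 1) → ℕ}
    (h : α + ∑ i, β i ≤ k) : weightedDeriv α β (u - v).toL2 =
      weightedDeriv α β u.toL2 - weightedDeriv α β v.toL2 := by
  have h1 := (u.isWeightedDeriv h).add ((v.isWeightedDeriv h).smul (-1))
  have h2 : (u - v).toL2 = u.toL2 + (-1 : ℝ) • v.toL2 := by
    rw [map_sub, neg_one_smul, sub_eq_add_neg]
  rw [h2, MachStem.weightedDeriv_eq h1, neg_one_smul, sub_eq_add_neg]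

theorem IsWeightedDeriv.of_tendsto {α : ℕ} {β : Fin (n + 1) → ℕ} {u g : ℕ → L2 n} {u' g' : L2 n}
    (h : ∀ j, IsWeightedDeriv α β (u j) (g j)) (hu : Filter.Tendsto u Filter.atTop (nhds u'))
    (hg : Filter.Tendsto g Filter.atTop (nhds g')) : IsWeightedDeriv α β u' g' := by
  rw [isWeightedDeriv_iff]
  intro φ
  refine tendsto_nhds_unique (hg.inner tendsto_const_nhds) ?_
  have := fun j => isWeightedDeriv_iff.1 (h j) φ
  simp only [this]
  exact (hu.inner tendsto_const_nhds).const_mul _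

/-- Each weighted derivative of a Cauchy sequence converges in `L²`, and closedness of the relation
identifies the limits as weighted derivatives of one function. -/
instance (n k : ℕ) : CompleteSpace (Gamma n k) := by
  refine Metric.complete_of_cauchySeq_tendsto fun u hu => ?_
  have hd : ∀ α β, α + ∑ i, β i ≤ k → ∃ g, Filter.Tendsto (fun j => weightedDeriv α β (u j).toL2)
      Filter.atTop (nhds g) := by
    intro α β h
    refine cauchySeq_tendsto_of_complete ?_
    rw [Metric.cauchySeq_iff] at hu ⊢
    intro ε hε
    obtain ⟨J, hJ⟩ := hu ε hε
    refine ⟨J, fun i hi j hj => ?_⟩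
    have := hJ i hi j hj
    rw [dist_eq_norm] at this ⊢
    rw [← Gamma.weightedDeriv_sub _ _ h]
    exact (Gamma.norm_weightedDeriv_le _ h).trans_lt this
  choose! g hg using hd
  have h0 : Filter.Tendsto (fun j => (u j).toL2) Filter.atTop (nhds (g 0 0)) := by
    have := hg 0 0 (by simp)
    simpa only [MachStem.weightedDeriv_eq (isWeightedDeriv_zero_zero _)] using this
  have hw : ∀ α β, α + ∑ i, β i ≤ k → IsWeightedDeriv α β (g 0 0) (g α β) := fun α β h =>
    IsWeightedDeriv.of_tendsto (fun j => (u j).isWeightedDeriv h) h0 (hg α β h)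
  let v : Gamma n k := ⟨g 0 0, fun α β h => ⟨_, hw α β h⟩⟩
  have hv : ∀ α β, α + ∑ i, β i ≤ k → weightedDeriv α β v.toL2 = g α β := fun α β h =>
    MachStem.weightedDeriv_eq (hw α β h)
  refine ⟨v, tendsto_iff_norm_sub_tendsto_zero.2 ?_⟩
  have h1 : Filter.Tendsto (fun j => ‖u j - v‖ ^ 2) Filter.atTop (nhds 0) := by
    simp only [Gamma.norm_sq_eq]
    have : (0 : ℝ) = ∑ p ∈ gammaIndex n k, 0 := by simp
    rw [this]
    refine tendsto_finsetSum _ fun p hp => ?_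
    have hp' := mem_gammaIndex.1 hp
    simp only [Gamma.weightedDeriv_sub _ _ hp', hv _ _ hp']
    have h3 := ((tendsto_iff_norm_sub_tendsto_zero.1 (hg _ _ hp')).pow 2)
    simpa using h3
  have := h1.sqrt
  simpa [Real.sqrt_sq (norm_nonneg _)] using this

end

end MachStem

/-! ### Comparison of the norm of `Γ^k` with words in first order operators. -/

namespace MachStem

noncomputable section

variable {n : ℕ}

namespace Test

/-- The first order operators: multiplication by `θ` and the partial derivatives. -/
def op : Option (Fin (n + 1)) → Test n →ₗ[ℝ] Test n
  | none => th
  | some i => d i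

@[simp] theorem op_none : (op none : Test n →ₗ[ℝ] Test n) = th := rfl

@[simp] theorem op_some (i : Fin (n + 1)) : op (some i) = d i := rfl

/-- The sum of the `L²` norms of all products of at most `m` first order operators. -/
def nrm : ℕ → Seminorm ℝ (Test n)
  | 0 => (normSeminorm ℝ (L2 n)).comp toL2
  | m + 1 => nrm m + ∑ l, (nrm m).comp (op l)

theorem nrm_zero (φ : Test n) : nrm 0 φ = ‖toL2 φ‖ := rfl

theorem nrm_succ (m : ℕ) (φ : Test n) : nrm (m + 1) φ = nrm m φ + ∑ l, nrm m (op l φ) := by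
  have e : ∀ s : Finset (Option (Fin (n + 1))), (∑ l ∈ s, (nrm m).comp (op l)) φ =
      ∑ l ∈ s, nrm m (op l φ) := by
    intro s
    induction s using Finset.induction_on with
    | empty => simp
    | insert a s ha ih => rw [Finset.sum_insert ha, Finset.sum_insert ha, ← ih]; rfl
  rw [← e]; rfl

theorem nrm_op_le_succ (m : ℕ) (l : Option (Fin (n + 1))) (φ : Test n) :
    nrm m (op l φ) ≤ nrm (m + 1) φ := by
  rw [nrm_succ]
  have := Finset.single_le_sum (f := fun l => nrm m (op l φ)) (fun _ _ => apply_nonneg _ _)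
    (Finset.mem_univ l)
  have h2 : 0 ≤ nrm m φ := apply_nonneg _ _
  linarith

theorem nrm_d_le (m : ℕ) (i : Fin (n + 1)) (φ : Test n) : nrm m (d i φ) ≤ nrm (m + 1) φ :=
  nrm_op_le_succ m (some i) φ

theorem nrm_th_le (m : ℕ) (φ : Test n) : nrm m (th φ) ≤ nrm (m + 1) φ :=
  nrm_op_le_succ m none φ

theorem nrm_mono {i j : ℕ} (h : i ≤ j) (φ : Test n) : nrm i φ ≤ nrm j φ := by
  induction h with
  | refl => exact le_rfl
  | step _ ih =>
    refine ih.trans ?_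
    rw [nrm_succ]
    exact le_add_of_nonneg_right (Finset.sum_nonneg fun _ _ => apply_nonneg _ _)

theorem nrm_pow_th_le (j α : ℕ) (φ : Test n) :
    nrm j ((th ^ α : Module.End ℝ (Test n)) φ) ≤ nrm (j + α) φ := by
  induction α generalizing φ with
  | zero => simp
  | succ α ih =>
    rw [pow_succ, Module.End.mul_apply]
    exact (ih _).trans (nrm_th_le _ _)

theorem nrm_D_le (j : ℕ) (β : Fin (n + 1) → ℕ) (φ : Test n) :
    nrm j (D β φ) ≤ nrm (j + ∑ i, β i) φ := by
  induction β using multiIndex_induction generalizing φ with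
  | h0 => simp [D_zero]
  | hs β i ih =>
    rw [D_add_single, ← (D_comm_d β i).eq, Module.End.mul_apply, sum_add_single]
    exact (ih _).trans (nrm_d_le _ _ _)

theorem nrm_pow_th_D_le {j m α : ℕ} {β : Fin (n + 1) → ℕ} (h : j + (α + ∑ i, β i) ≤ m)
    (φ : Test n) : nrm j ((th ^ α : Module.End ℝ (Test n)) (D β φ)) ≤ nrm m φ :=
  (nrm_pow_th_le _ _ _).trans ((nrm_D_le _ _ _).trans (nrm_mono (by omega) _))

theorem norm_toGamma_le_sum (m : ℕ) (φ : Test n) : ‖toGamma m φ‖ ≤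
    ∑ p ∈ gammaIndex n m, ‖toL2 ((th ^ p.1 : Module.End ℝ (Test n)) (D p.2 φ))‖ := by
  rw [← sq_le_sq₀ (norm_nonneg _) (Finset.sum_nonneg fun _ _ => norm_nonneg _), norm_toGamma_sq]
  exact Finset.sum_sq_le_sq_sum_of_nonneg fun _ _ => norm_nonneg _

theorem norm_toL2_pow_th_D_le {m α : ℕ} {β : Fin (n + 1) → ℕ} (h : α + ∑ i, β i ≤ m)
    (φ : Test n) : ‖toL2 ((th ^ α : Module.End ℝ (Test n)) (D β φ))‖ ≤ ‖toGamma m φ‖ := by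
  rw [← weightedDeriv_eq]
  exact (toGamma m φ).norm_weightedDeriv_le h

/-- The recursive seminorm suits inductions on the order, the norm of `Γ^k` suits the energy
identity. This bound and its converse `nrm_le_norm_toGamma` make them interchangeable. -/
theorem norm_toGamma_le_nrm (m : ℕ) :
    ∃ C, 0 ≤ C ∧ ∀ φ : Test n, ‖toGamma m φ‖ ≤ C * nrm m φ := by
  refine ⟨(gammaIndex n m).card, Nat.cast_nonneg _, fun φ => (norm_toGamma_le_sum m φ).trans ?_⟩
  rw [← nsmul_eq_mul]
  refine Finset.sum_le_card_nsmul _ _ _ fun p hp => ?_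
  exact nrm_pow_th_D_le (j := 0) (by simpa using mem_gammaIndex.1 hp) φ

theorem norm_toGamma_op_le (m : ℕ) : ∃ C, 0 ≤ C ∧ ∀ (l : Option (Fin (n + 1))) (φ : Test n),
    ‖toGamma m (op l φ)‖ ≤ C * ‖toGamma (m + 1) φ‖ := by
  -- For every index, one unit is the main term; `m` bounds the coefficient in the commutator of `θ`
  -- with the derivative.
  refine ⟨(gammaIndex n m).card * (m + 1), by positivity, fun l φ =>
    (norm_toGamma_le_sum m _).trans ?_⟩
  rw [mul_assoc, ← nsmul_eq_mul]
  refine Finset.sum_le_card_nsmul _ _ _ fun p hp => ?_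
  have hp := mem_gammaIndex.1 hp
  have h0 : 0 ≤ ‖toGamma (m + 1) φ‖ := norm_nonneg _
  cases l with
  | some i =>
    have e : D p.2 (op (some i) φ) = D (p.2 + Pi.single i 1) φ := by
      rw [D_add_single, ← (D_comm_d _ i).eq]; rfl
    rw [e]
    refine (norm_toL2_pow_th_D_le (m := m + 1) (by rw [sum_add_single]; omega) φ).trans ?_
    have : 0 ≤ (m : ℝ) * ‖toGamma (m + 1) φ‖ := by positivity
    linarith
  | none =>
    rw [op_none, D_th, map_add, map_smul, map_add, map_smul, ← Module.End.mul_apply, ← pow_succ]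
    refine (norm_add_le _ _).trans ?_
    rw [norm_smul, Real.norm_natCast]
    have h1 := norm_toL2_pow_th_D_le (m := m + 1) (α := p.1 + 1) (β := p.2) (by omega) φ
    rcases Nat.eq_zero_or_pos (p.2 (Fin.last n)) with hz | hz
    · rw [hz, Nat.cast_zero, zero_mul, add_zero]
      have : 0 ≤ (m : ℝ) * ‖toGamma (m + 1) φ‖ := by positivity
      linarith
    · have h3 : ∑ i, (p.2 - Pi.single (Fin.last n) 1 : Fin (n + 1) → ℕ) i ≤ ∑ i, p.2 i :=
        Finset.sum_le_sum fun i _ => Nat.sub_le _ _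
      have h2 := norm_toL2_pow_th_D_le (m := m + 1) (α := p.1)
        (β := p.2 - Pi.single (Fin.last n) 1) (by omega) φ
      have h4 : ((p.2 (Fin.last n) : ℕ) : ℝ) ≤ m := by
        have := Finset.single_le_sum (f := p.2) (fun _ _ => Nat.zero_le _)
          (Finset.mem_univ (Fin.last n))
        exact_mod_cast (by omega : p.2 (Fin.last n) ≤ m)
      have := mul_le_mul h4 h2 (norm_nonneg _) (by positivity)
      linarith

theorem nrm_le_norm_toGamma (m : ℕ) :
    ∃ C, 0 ≤ C ∧ ∀ φ : Test n, nrm m φ ≤ C * ‖toGamma m φ‖ := by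
  induction m with
  | zero =>
    refine ⟨1, zero_le_one, fun φ => ?_⟩
    rw [one_mul, nrm_zero]
    exact (toGamma 0 φ).norm_toL2_le
  | succ m ih =>
    obtain ⟨C, hC, h⟩ := ih
    obtain ⟨K, hK, h'⟩ := norm_toGamma_op_le (n := n) m
    refine ⟨C + Fintype.card (Option (Fin (n + 1))) * (C * K), by positivity, fun φ => ?_⟩
    rw [nrm_succ, add_mul]
    refine add_le_add ?_ ?_
    · refine (h φ).trans (mul_le_mul_of_nonneg_left ?_ hC)
      rw [← sq_le_sq₀ (norm_nonneg _) (norm_nonneg _), norm_toGamma_sq, norm_toGamma_sq]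
      refine Finset.sum_le_sum_of_subset_of_nonneg (fun p hp => ?_) fun _ _ _ => sq_nonneg _
      rw [mem_gammaIndex] at hp ⊢
      omega
    · rw [mul_assoc, ← nsmul_eq_mul]
      refine Finset.sum_le_card_nsmul _ _ _ fun l _ => (h _).trans ?_
      rw [mul_assoc]
      exact mul_le_mul_of_nonneg_left (h' l φ) hC

end Test

end

end MachStem

/-! ### Density of test functions in `Γ^k` by cutoff and mollification. -/

namespace MachStem

noncomputable section

variable {n : ℕ}

theorem lintegral_mul_sq_le {α : Type*} [MeasurableSpace α] {μ : Measure α} {f g : α → ENNReal}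
    (hf : AEMeasurable f μ) (hg : AEMeasurable g μ) :
    (∫⁻ x, f x * g x ∂μ) ^ 2 ≤ (∫⁻ x, f x ^ 2 ∂μ) * ∫⁻ x, g x ^ 2 ∂μ := by
  have h := ENNReal.lintegral_mul_le_Lp_mul_Lq μ (p := 2) (q := 2) .two_two hf hg
  have e : ∀ a : ENNReal, (a ^ (1 / (2 : ℝ))) ^ 2 = a := by
    intro a
    rw [← ENNReal.rpow_natCast, ← ENNReal.rpow_mul]
    norm_num
  have h2 := pow_le_pow_left₀ zero_le h 2
  rw [mul_pow, e, e] at h2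
  simpa using h2

theorem enorm_L2_sq (u : L2 n) : ‖u‖ₑ ^ 2 = ∫⁻ x, ‖u x‖ₑ ^ 2 := by
  rw [Lp.enorm_def, eLpNorm_eq_lintegral_rpow_enorm_toReal (by norm_num) (by norm_num),
    ← ENNReal.rpow_natCast, ← ENNReal.rpow_mul]
  norm_num

namespace Test

theorem enorm_toL2_sq (φ : Test n) : ‖toL2 φ‖ₑ ^ 2 = ∫⁻ x, ‖φ x‖ₑ ^ 2 := by
  rw [enorm_L2_sq]
  refine lintegral_congr_ae ?_
  filter_upwards [φ.coeFn_toL2] with x hx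
  rw [hx]

/-- A function orthogonal to all test functions is a weak derivative of order zero of the zero
function, hence zero by uniqueness of weak derivatives. -/
theorem denseRange_toL2 : DenseRange (toL2 : Test n →ₗ[ℝ] L2 n) := by
  have h3 : (LinearMap.range (toL2 : Test n →ₗ[ℝ] L2 n))ᗮ = ⊥ := by
    rw [Submodule.eq_bot_iff]
    intro u hu
    have h1 : IsWeightedDeriv 0 0 (0 : L2 n) u := by
      rw [isWeightedDeriv_iff]
      intro φ
      rw [real_inner_comm, hu _ ⟨φ, rfl⟩, inner_zero_left, mul_zero]
    exact h1.unique (isWeightedDeriv_zero_zero 0)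
  have h4 := Submodule.topologicalClosure_eq_top_iff.2 h3
  exact Submodule.dense_iff_topologicalClosure_eq_top.2 h4

/-- Dilation. -/
def sc (a : ℝˣ) (φ : Test n) : Test n :=
  ⟨fun x => φ ((a : ℝ) • x), φ.contDiff.comp (contDiff_const_smul (a : ℝ)),
    φ.hasCompactSupport.comp_smul a.ne_zero⟩

theorem sc_apply (a : ℝˣ) (φ : Test n) (x : Space n) : sc a φ x = φ ((a : ℝ) • x) := rfl

theorem d_sc (a : ℝˣ) (i : Fin (n + 1)) (φ : Test n) : d i (sc a φ) = (a : ℝ) • sc a (d i φ) := by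
  ext x
  have h1 : HasFDerivAt (fun y : Space n => φ ((a : ℝ) • y)) _ x :=
    (φ.hasFDerivAt ((a : ℝ) • x)).comp x ((hasFDerivAt_id x).const_smul (a : ℝ))
  have e : (sc a φ).1 = fun y : Space n => φ ((a : ℝ) • y) := rfl
  rw [d_apply, e, h1.fderiv]
  simp [sc_apply, d_apply]

theorem th_sc (a : ℝˣ) (φ : Test n) : th (sc a φ) = ((a⁻¹ : ℝˣ) : ℝ) • sc a (th φ) := by
  ext x
  simp only [th_apply, sc_apply, smul_apply, Units.val_inv_eq_inv_val, PiLp.smul_apply, smul_eq_mul]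
  rw [mul_assoc, inv_mul_cancel_left₀ a.ne_zero]

/-- The reflected translate `t ↦ ρ (x - t)`. -/
def refl (x : Space n) (ρ : Test n) : Test n :=
  ⟨fun t => ρ (x - t), ρ.contDiff.comp (contDiff_const.sub contDiff_id),
    ρ.hasCompactSupport.comp_homeomorph (Homeomorph.subLeft x)⟩

theorem refl_apply (x : Space n) (ρ : Test n) (t : Space n) : refl x ρ t = ρ (x - t) := rfl

theorem d_refl (i : Fin (n + 1)) (x : Space n) (ρ : Test n) :
    d i (refl x ρ) = - refl x (d i ρ) := by
  ext t
  have h1 : HasFDerivAt (fun y : Space n => ρ (x - y)) _ t :=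
    (ρ.hasFDerivAt (x - t)).comp t ((hasFDerivAt_id t).const_sub x)
  have e : (refl x ρ).1 = fun y : Space n => ρ (x - y) := rfl
  rw [d_apply, e, h1.fderiv]
  simp [refl_apply, d_apply]

theorem th_refl (x : Space n) (ρ : Test n) :
    refl x (th ρ) = x (Fin.last n) • refl x ρ - th (refl x ρ) := by
  ext t
  simp [refl_apply, th_apply]
  ring

theorem locallyIntegrable_mul (χ : Test n) (u : L2 n) :
    LocallyIntegrable (fun t => χ t * u t) := by
  have := χ.2.integrable_mul u
  simp only [mul_comm] at this
  exact this.locallyIntegrable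

/-- The mollification of `χ u` with kernel `ρ`. -/
def mollify (χ ρ : Test n) (u : L2 n) : Test n :=
  ⟨convolution (fun t => χ t * u t) ρ.1 (ContinuousLinearMap.mul ℝ ℝ) volume,
    ρ.hasCompactSupport.contDiff_convolution_right _ (χ.locallyIntegrable_mul u) ρ.contDiff,
    HasCompactSupport.convolution _ χ.hasCompactSupport.mul_right ρ.hasCompactSupport⟩

/-- The value at `x` is a pairing of `u` with a test function, to which the definition of weak
derivatives applies directly. -/
theorem mollify_apply (χ ρ : Test n) (u : L2 n) (x : Space n) :
    mollify χ ρ u x = inner ℝ u (toL2 (mul χ (refl x ρ))) := by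
  rw [inner_toL2]
  refine integral_congr_ae (Filter.Eventually.of_forall fun t => ?_)
  simp only [ContinuousLinearMap.mul_apply', mul_apply, refl_apply]
  ring

theorem mollify_apply_integral (χ ρ : Test n) (u : L2 n) (x : Space n) :
    mollify χ ρ u x = ∫ t, χ t * u t * ρ (x - t) := rfl

theorem mollify_d (i : Fin (n + 1)) (χ ρ : Test n) (u : L2 n) :
    d i (mollify χ ρ u) = mollify χ (d i ρ) u := by
  ext x
  have h := ρ.hasCompactSupport.hasFDerivAt_convolution_right (ContinuousLinearMap.mul ℝ ℝ)
    (χ.locallyIntegrable_mul u) (ρ.contDiff.of_le (by simp)) x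
  have e : (mollify χ ρ u).1 =
    convolution (fun t => χ t * u t) ρ.1 (ContinuousLinearMap.mul ℝ ℝ) volume := rfl
  rw [d_apply, e, h.fderiv,
    convolution_precompR_apply _ (χ.locallyIntegrable_mul u) (ρ.hasCompactSupport.fderiv ℝ)
      (ρ.contDiff.continuous_fderiv (by simp))]
  rfl

theorem D_single (i : Fin (n + 1)) : (D (Pi.single i 1) : Module.End ℝ (Test n)) = d i := by
  have := D_add_single (0 : Fin (n + 1) → ℕ) i
  rwa [zero_add, D_zero, mul_one] at this

theorem inner_of_deriv {i : Fin (n + 1)} {u g : L2 n}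
    (h : IsWeightedDeriv 0 (Pi.single i 1) u g) (φ : Test n) :
    inner ℝ g (toL2 φ) = - inner ℝ u (toL2 (d i φ)) := by
  have := isWeightedDeriv_iff.1 h φ
  rw [D_single] at this
  simpa [Finset.sum_pi_single'] using this

theorem inner_of_theta {u g : L2 n} (h : IsWeightedDeriv 1 0 u g) (φ : Test n) :
    inner ℝ g (toL2 φ) = inner ℝ u (toL2 (th φ)) := by
  have := isWeightedDeriv_iff.1 h φ
  rw [D_zero] at this
  simpa using this

/-- The derivative of the kernel is, up to sign, the derivative of the reflected kernel in the
integration variable; moved across the pairing it falls on `u` and on the cutoff. -/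
theorem d_mollify {i : Fin (n + 1)} {u g : L2 n} (h : IsWeightedDeriv 0 (Pi.single i 1) u g)
    (χ ρ : Test n) : d i (mollify χ ρ u) = mollify χ ρ g + mollify (d i χ) ρ u := by
  rw [mollify_d]
  ext x
  have hm : mul χ (-(refl x (d i ρ))) = - mul χ (refl x (d i ρ)) := by
    ext t; simp [mul_apply]
  rw [add_apply, mollify_apply, mollify_apply, mollify_apply, inner_of_deriv h, d_mul, d_refl, hm,
    map_add, map_neg, inner_add_right, inner_neg_right]
  ring

theorem th_mollify {u g : L2 n} (h : IsWeightedDeriv 1 0 u g) (χ ρ : Test n) :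
    th (mollify χ ρ u) = mollify χ ρ g + mollify χ (th ρ) u := by
  ext x
  have hm : mul χ (refl x (th ρ)) =
      x (Fin.last n) • mul χ (refl x ρ) - th (mul χ (refl x ρ)) := by
    rw [th_refl]
    ext t
    simp [mul_apply, th_apply]
    ring
  rw [add_apply, th_apply, mollify_apply, mollify_apply, mollify_apply, inner_of_theta h, hm,
    map_sub, map_smul, inner_sub_right, inner_smul_right]
  ring

theorem mollify_smul_left (c : ℝ) (χ ρ : Test n) (u : L2 n) :
    mollify (c • χ) ρ u = c • mollify χ ρ u := by
  ext x
  have : mul (c • χ) (refl x ρ) = c • mul χ (refl x ρ) := by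
    ext t; simp [mul_apply]; ring
  rw [smul_apply, mollify_apply, mollify_apply, this, map_smul, inner_smul_right]

theorem mollify_smul_right (c : ℝ) (χ ρ : Test n) (u : L2 n) :
    mollify χ (c • ρ) u = c • mollify χ ρ u := by
  ext x
  have : mul χ (refl x (c • ρ)) = c • mul χ (refl x ρ) := by
    ext t; simp [mul_apply, refl_apply]; ring
  rw [smul_apply, mollify_apply, mollify_apply, this, map_smul, inner_smul_right]

/-- Cutoff at scale `1 / a` and mollification at scale `a`. -/
def approx (a : ℝˣ) (χ ρ : Test n) (u : L2 n) : Test n :=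
  |((a : ℝ) ^ (n + 1))⁻¹| • mollify (sc a χ) (sc a⁻¹ ρ) u

/-- The dilated cutoff pays a factor `a` for its derivative. The same factor appears in `th_approx`,
from the narrow kernel, so both commutators vanish as `a` tends to zero. -/
theorem d_approx {i : Fin (n + 1)} {u g : L2 n} (h : IsWeightedDeriv 0 (Pi.single i 1) u g)
    (a : ℝˣ) (χ ρ : Test n) :
    d i (approx a χ ρ u) = approx a χ ρ g + (a : ℝ) • approx a (d i χ) ρ u := by
  unfold approx
  rw [map_smul, d_mollify h, d_sc, mollify_smul_left, smul_add, smul_comm]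

theorem th_approx {u g : L2 n} (h : IsWeightedDeriv 1 0 u g) (a : ℝˣ) (χ ρ : Test n) :
    th (approx a χ ρ u) = approx a χ ρ g + (a : ℝ) • approx a χ (th ρ) u := by
  unfold approx
  rw [map_smul, th_mollify h, th_sc, mollify_smul_right, smul_add, smul_comm, inv_inv]

theorem integral_dilation (a : ℝˣ) (χ ρ : Test n) (f : Space n → ℝ) (x : Space n) :
    |((a : ℝ) ^ (n + 1))⁻¹| * ∫ t, sc a χ t * f t * sc a⁻¹ ρ (x - t) =
    ∫ s, ρ s * (χ ((a : ℝ) • (x - (a : ℝ) • s)) * f (x - (a : ℝ) • s)) := by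
  have h := Measure.integral_comp_smul (volume : Measure (Space n))
    (fun z => ρ ((a : ℝ)⁻¹ • z) * (χ ((a : ℝ) • (x - z)) * f (x - z))) (a : ℝ)
  simp only [smul_smul, inv_mul_cancel₀ a.ne_zero, one_smul] at h
  rw [show (∫ s, ρ s * (χ ((a : ℝ) • (x - (a : ℝ) • s)) * f (x - (a : ℝ) • s))) = _ from h]
  rw [smul_eq_mul]
  simp only [finrank_euclideanSpace, Fintype.card_fin]
  congr 1
  rw [← integral_sub_left_eq_self _ volume x]
  refine integral_congr_ae (Filter.Eventually.of_forall fun t => ?_)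
  simp only [sc_apply, Units.val_inv_eq_inv_val, sub_sub_cancel]
  ring

theorem approx_apply (a : ℝˣ) (χ ρ : Test n) (u : L2 n) (x : Space n) : approx a χ ρ u x =
    ∫ s, ρ s * (χ ((a : ℝ) • (x - (a : ℝ) • s)) * u (x - (a : ℝ) • s)) := by
  rw [← integral_dilation, approx, smul_apply, mollify_apply_integral]

theorem approx_toL2_apply (a : ℝˣ) (χ ρ ψ : Test n) (x : Space n) : approx a χ ρ (toL2 ψ) x =
    ∫ s, ρ s * (χ ((a : ℝ) • (x - (a : ℝ) • s)) * ψ (x - (a : ℝ) • s)) := by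
  rw [← integral_dilation, approx, smul_apply, mollify_apply, inner_toL2_toL2]
  congr 1
  refine integral_congr_ae (Filter.Eventually.of_forall fun t => ?_)
  simp only [mul_apply, refl_apply]
  ring

theorem approx_sub (a : ℝˣ) (χ ρ : Test n) (u v : L2 n) :
    approx a χ ρ (u - v) = approx a χ ρ u - approx a χ ρ v := by
  have e : mollify (sc a χ) (sc a⁻¹ ρ) (u - v) =
      mollify (sc a χ) (sc a⁻¹ ρ) u - mollify (sc a χ) (sc a⁻¹ ρ) v := by
    ext x
    rw [sub_apply, mollify_apply, mollify_apply, mollify_apply, inner_sub_left]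
  unfold approx
  rw [e]
  exact smul_sub _ _ _

theorem exists_bound (φ : Test n) : ∃ C, 0 < C ∧ ∀ x, ‖φ x‖ ≤ C := by
  obtain ⟨C, hC⟩ := φ.continuous.bounded_above_of_compact_support φ.hasCompactSupport
  exact ⟨|C| + 1, by positivity, fun x => (hC x).trans (by linarith [le_abs_self C])⟩

/-- Cauchy–Schwarz on the support of `ρ`, then Tonelli and translation invariance. After the
substitution `t = x - a s` the scale only enters through a translation, so the bound is uniform in
`a`. -/
theorem norm_approx_le (χ ρ : Test n) :
    ∃ K, 0 ≤ K ∧ ∀ (a : ℝˣ) (u : L2 n), ‖toL2 (approx a χ ρ u)‖ ≤ K * ‖u‖ := by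
  obtain ⟨C, hC, hχ⟩ := χ.exists_bound
  set S := tsupport ρ.1
  have hS : volume S ≠ ⊤ := ρ.hasCompactSupport.isCompact.measure_lt_top.ne
  have hρ : ∫⁻ s, ‖ρ s‖ₑ ^ 2 ≠ ⊤ := by
    rw [← enorm_toL2_sq]; exact ENNReal.pow_ne_top enorm_ne_top
  set Q : ENNReal := ENNReal.ofReal C ^ 2 * (volume S * ∫⁻ s, ‖ρ s‖ₑ ^ 2)
  have hQ : Q ≠ ⊤ := ENNReal.mul_ne_top (by finiteness) (ENNReal.mul_ne_top hS hρ)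
  have key : ∀ (a : ℝˣ) (u : L2 n), ‖toL2 (approx a χ ρ u)‖ₑ ^ 2 ≤ Q * ‖u‖ₑ ^ 2 := by
    intro a u
    have hu : Measurable (fun x => u x) := (Lp.stronglyMeasurable u).measurable
    have hρm : Measurable (fun x => ρ x) := ρ.continuous.measurable
    have h1 : ∀ x, ‖approx a χ ρ u x‖ₑ ^ 2 ≤ ENNReal.ofReal C ^ 2 * (volume S *
        ∫⁻ s, ‖ρ s‖ₑ ^ 2 * ‖u (x - (a : ℝ) • s)‖ₑ ^ 2) := by
      intro x
      have h2 : ‖approx a χ ρ u x‖ₑ ≤ ENNReal.ofReal C *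
          ∫⁻ s, S.indicator (fun _ => (1 : ENNReal)) s * (‖ρ s‖ₑ * ‖u (x - (a : ℝ) • s)‖ₑ) := by
        rw [approx_apply]
        refine (enorm_integral_le_lintegral_enorm _).trans ?_
        rw [← lintegral_const_mul' _ _ ENNReal.ofReal_ne_top]
        refine lintegral_mono fun s => ?_
        by_cases hs : s ∈ S
        · rw [Set.indicator_of_mem hs, one_mul, enorm_mul, enorm_mul]
          have : ‖χ ((a : ℝ) • (x - (a : ℝ) • s))‖ₑ ≤ ENNReal.ofReal C := by
            rw [← ofReal_norm]; exact ENNReal.ofReal_le_ofReal (hχ _)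
          calc _ ≤ ‖ρ s‖ₑ * (ENNReal.ofReal C * ‖u (x - (a : ℝ) • s)‖ₑ) := by gcongr
            _ = _ := by ring
        · rw [image_eq_zero_of_notMem_tsupport hs]
          simp
      refine (pow_le_pow_left₀ zero_le h2 2).trans ?_
      rw [mul_pow]
      gcongr
      refine (lintegral_mul_sq_le ?_ ?_).trans ?_
      · exact (measurable_const.indicator (isClosed_tsupport _).measurableSet).aemeasurable
      · exact (by fun_prop : Measurable fun s =>
          ‖ρ s‖ₑ * ‖u (x - (a : ℝ) • s)‖ₑ).aemeasurable
      · have e1 : ∀ s, S.indicator (fun _ => (1 : ENNReal)) s ^ 2 =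
            S.indicator (fun _ => (1 : ENNReal)) s := by
          intro s
          by_cases hs : s ∈ S <;> simp [hs]
        simp only [e1, mul_pow]
        rw [lintegral_indicator (isClosed_tsupport _).measurableSet]
        simp
        rfl
    rw [enorm_toL2_sq]
    refine (lintegral_mono h1).trans ?_
    rw [lintegral_const_mul' _ _ (by finiteness), lintegral_const_mul' _ _ hS,
      lintegral_lintegral_swap]
    · have e2 : ∀ s, ∫⁻ x, ‖ρ s‖ₑ ^ 2 * ‖u (x - (a : ℝ) • s)‖ₑ ^ 2 = ‖ρ s‖ₑ ^ 2 * ‖u‖ₑ ^ 2 := by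
        intro s
        rw [lintegral_const_mul' _ _ (by finiteness),
          lintegral_sub_right_eq_self (fun x => ‖u x‖ₑ ^ 2), enorm_L2_sq]
      simp only [e2]
      rw [lintegral_mul_const' _ _ (by finiteness)]
      simp only [Q]
      rw [mul_assoc, mul_assoc]
    · exact (by fun_prop : Measurable fun p : Space n × Space n =>
        ‖ρ p.2‖ₑ ^ 2 * ‖u (p.1 - (a : ℝ) • p.2)‖ₑ ^ 2).aemeasurable
  refine ⟨√Q.toReal, Real.sqrt_nonneg _, fun a u => ?_⟩
  rw [← sq_le_sq₀ (norm_nonneg _) (by positivity), mul_pow, Real.sq_sqrt ENNReal.toReal_nonneg]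
  have h3 := ENNReal.toReal_mono (ENNReal.mul_ne_top hQ (by finiteness)) (key a u)
  simpa using h3

/-- The scales `1 / (j + 1)`. -/
def scale (j : ℕ) : ℝˣ := Units.mk0 (1 / ((j : ℝ) + 1)) (by positivity)

theorem scale_pos (j : ℕ) : (0 : ℝ) < scale j := by
  rw [scale, Units.val_mk0]; positivity

theorem scale_le_one (j : ℕ) : (scale j : ℝ) ≤ 1 := by
  rw [scale, Units.val_mk0, div_le_one (by positivity)]
  linarith [j.cast_nonneg (α := ℝ)]

theorem tendsto_scale : Filter.Tendsto (fun j => (scale j : ℝ)) Filter.atTop (nhds 0) :=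
  tendsto_one_div_add_atTop_nhds_zero_nat

theorem exists_closedBall (φ : Test n) : ∃ r, 0 ≤ r ∧ ∀ x, r < ‖x‖ → φ x = 0 := by
  obtain ⟨r, hr⟩ := φ.hasCompactSupport.isCompact.isBounded.subset_closedBall 0
  refine ⟨max r 0, le_max_right _ _, fun x hx => image_eq_zero_of_notMem_tsupport fun h => ?_⟩
  have := hr h
  rw [mem_closedBall_zero_iff] at this
  exact absurd hx (not_lt.2 (this.trans (le_max_left _ _)))

theorem tendsto_approx_toL2 (χ ρ ψ : Test n) :
    Filter.Tendsto (fun j => toL2 (approx (scale j) χ ρ (toL2 ψ))) Filter.atTop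
      (nhds (((∫ s, ρ s) * χ 0) • toL2 ψ)) := by
  obtain ⟨C, hC, hχ⟩ := χ.exists_bound
  obtain ⟨C', hC', hψ⟩ := ψ.exists_bound
  obtain ⟨r, hr, hr'⟩ := ψ.exists_closedBall
  obtain ⟨q, hq, hq'⟩ := ρ.exists_closedBall
  have hρi : Integrable ρ.1 := ρ.continuous.integrable_of_hasCompactSupport ρ.hasCompactSupport
  set c := (∫ s, ρ s) * χ 0
  have hb : ∀ (j : ℕ) (x s : Space n), ‖ρ s * (χ ((scale j : ℝ) • (x - (scale j : ℝ) • s)) *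
      ψ (x - (scale j : ℝ) • s))‖ ≤ ‖ρ s‖ * (C * C') := by
    intro j x s
    rw [norm_mul, norm_mul]
    gcongr
    · exact hχ _
    · exact hψ _
  have hptw : ∀ x, Filter.Tendsto (fun j => approx (scale j) χ ρ (toL2 ψ) x) Filter.atTop
      (nhds (c * ψ x)) := by
    intro x
    simp only [approx_toL2_apply]
    have e : c * ψ x = ∫ s, ρ s * (χ 0 * ψ x) := by
      rw [integral_mul_const]; ring
    rw [e]
    refine tendsto_integral_of_dominated_convergence (fun s => ‖ρ s‖ * (C * C')) (fun j => ?_)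
      (hρi.norm.mul_const _) (fun j => Filter.Eventually.of_forall fun s => hb j x s)
      (Filter.Eventually.of_forall fun s => ?_)
    · have h1 := ρ.continuous
      have h2 := χ.continuous
      have h3 := ψ.continuous
      exact (by fun_prop : Continuous fun s => ρ s *
        (χ ((scale j : ℝ) • (x - (scale j : ℝ) • s)) *
          ψ (x - (scale j : ℝ) • s))).aestronglyMeasurable
    · have h1 : Filter.Tendsto (fun j => x - (scale j : ℝ) • s) Filter.atTop (nhds x) := by
        have := (tendsto_const_nhds (x := x)).sub (tendsto_scale.smul_const s)
        simpa using this
      have h2 : Filter.Tendsto (fun j => (scale j : ℝ) • (x - (scale j : ℝ) • s)) Filter.atTop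
          (nhds 0) := by
        have := tendsto_scale.smul h1
        simpa using this
      exact ((χ.continuous.tendsto 0).comp h2 |>.mul ((ψ.continuous.tendsto x).comp h1)).const_mul _
  have hzero : ∀ j x, r + q < ‖x‖ → approx (scale j) χ ρ (toL2 ψ) x = 0 := by
    intro j x hx
    rw [approx_toL2_apply]
    refine integral_eq_zero_of_ae (Filter.Eventually.of_forall fun s => ?_)
    simp only [Pi.zero_apply]
    by_cases hs : q < ‖s‖
    · rw [hq' s hs, zero_mul]
    · rw [hr', mul_zero, mul_zero]
      have h1 : ‖(scale j : ℝ) • s‖ ≤ q := by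
        rw [norm_smul, Real.norm_of_nonneg (scale_pos j).le]
        exact (mul_le_of_le_one_left (norm_nonneg _) (scale_le_one j)).trans (not_lt.1 hs)
      have h2 := norm_sub_norm_le x ((scale j : ℝ) • s)
      linarith
  have hbd : ∀ j x, ‖approx (scale j) χ ρ (toL2 ψ) x‖ ≤ (∫ s, ‖ρ s‖) * (C * C') := by
    intro j x
    rw [approx_toL2_apply, ← integral_mul_const]
    exact norm_integral_le_of_norm_le (hρi.norm.mul_const _)
      (Filter.Eventually.of_forall fun s => hb j x s)
  rw [tendsto_iff_norm_sub_tendsto_zero]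
  have h1 : Filter.Tendsto (fun j => ‖toL2 (approx (scale j) χ ρ (toL2 ψ)) - c • toL2 ψ‖ ^ 2)
      Filter.atTop (nhds 0) := by
    simp only [← map_smul, ← map_sub, norm_toL2_sq]
    have e : (0 : ℝ) = ∫ _ : Space n, (0 : ℝ) := by simp
    rw [e]
    refine tendsto_integral_of_dominated_convergence
      ((Metric.closedBall (0 : Space n) (r + q)).indicator
        fun _ => ((∫ s, ‖ρ s‖) * (C * C') + |c| * C') ^ 2)
      (fun j => ?_) ?_ (fun j => Filter.Eventually.of_forall fun x => ?_)
      (Filter.Eventually.of_forall fun x => ?_)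
    · exact ((approx (scale j) χ ρ (toL2 ψ) - c • ψ).continuous.pow 2).aestronglyMeasurable
    · exact (integrable_indicator_iff measurableSet_closedBall).2
        (integrableOn_const measure_closedBall_lt_top.ne)
    · by_cases hx : r + q < ‖x‖
      · rw [sub_apply, smul_apply, hzero j x hx, hr' x (by linarith)]
        simp only [mul_zero, sub_zero, ne_eq, OfNat.ofNat_ne_zero, not_false_eq_true, zero_pow,
          norm_zero]
        exact Set.indicator_nonneg (fun _ _ => sq_nonneg _) _
      · rw [Set.indicator_of_mem (mem_closedBall_zero_iff.2 (not_lt.1 hx)), norm_pow]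
        refine pow_le_pow_left₀ (norm_nonneg _) ?_ 2
        rw [sub_apply, smul_apply]
        refine (norm_sub_le _ _).trans (add_le_add (hbd j x) ?_)
        rw [norm_mul, Real.norm_eq_abs c]
        exact mul_le_mul_of_nonneg_left (hψ x) (abs_nonneg _)
    · have := ((hptw x).sub (tendsto_const_nhds (x := c * ψ x))).pow 2
      simpa using this
  have := h1.sqrt
  simpa [Real.sqrt_sq (norm_nonneg _)] using this

theorem tendsto_approx (χ ρ : Test n) (u : L2 n) :
    Filter.Tendsto (fun j => toL2 (approx (scale j) χ ρ u)) Filter.atTop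
      (nhds (((∫ s, ρ s) * χ 0) • u)) := by
  obtain ⟨K, hK, hb⟩ := norm_approx_le χ ρ
  set c := (∫ s, ρ s) * χ 0
  rw [Metric.tendsto_nhds]
  intro δ hδ
  obtain ⟨ψ, hψ⟩ := denseRange_toL2.exists_dist_lt u (by positivity : 0 < δ / (2 * (K + |c| + 1)))
  rw [dist_eq_norm] at hψ
  filter_upwards [Metric.tendsto_nhds.1 (tendsto_approx_toL2 χ ρ ψ) (δ / 2) (by positivity)]
    with j hj
  rw [dist_eq_norm] at hj ⊢
  have e : toL2 (approx (scale j) χ ρ u) - c • u = toL2 (approx (scale j) χ ρ (u - toL2 ψ)) +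
      (toL2 (approx (scale j) χ ρ (toL2 ψ)) - c • toL2 ψ) - c • (u - toL2 ψ) := by
    rw [approx_sub, map_sub, smul_sub]; abel
  rw [e]
  have h1 := hb (scale j) (u - toL2 ψ)
  have h2 : ‖c • (u - toL2 ψ)‖ = |c| * ‖u - toL2 ψ‖ := by rw [norm_smul, Real.norm_eq_abs]
  have h3 := norm_sub_le (toL2 (approx (scale j) χ ρ (u - toL2 ψ)) +
    (toL2 (approx (scale j) χ ρ (toL2 ψ)) - c • toL2 ψ)) (c • (u - toL2 ψ))
  have h4 := norm_add_le (toL2 (approx (scale j) χ ρ (u - toL2 ψ)))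
    (toL2 (approx (scale j) χ ρ (toL2 ψ)) - c • toL2 ψ)
  have h5 : (K + |c|) * ‖u - toL2 ψ‖ ≤ (K + |c| + 1) * (δ / (2 * (K + |c| + 1))) :=
    mul_le_mul (by linarith) hψ.le (norm_nonneg _) (by positivity)
  have h6 : (K + |c| + 1) * (δ / (2 * (K + |c| + 1))) = δ / 2 := by field_simp
  linarith

end Test

theorem exists_deriv_mem {m : ℕ} {u : L2 n} (hu : u ∈ gammaSubmodule n (m + 1))
    (i : Fin (n + 1)) :
    ∃ g ∈ gammaSubmodule n m, IsWeightedDeriv 0 (Pi.single i 1) u g := by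
  obtain ⟨g, hg⟩ := hu 0 (Pi.single i 1) (by simp [Finset.sum_pi_single'])
  refine ⟨g, fun α β h => ?_, hg⟩
  obtain ⟨G, hG⟩ := hu α (β + Pi.single i 1) (by rw [Test.sum_add_single]; omega)
  refine ⟨G, isWeightedDeriv_iff.2 fun φ => ?_⟩
  rw [isWeightedDeriv_iff.1 hG φ, Test.inner_of_deriv hg, Test.sum_add_single, Test.D_add_single,
    Module.End.mul_apply, pow_succ]
  ring

/-- Commuting the derivative with `θ`, the derivative of `θ u` is the sum of `θ` times the
derivative of `u` and a lower order term, which is the claimed `G₁ + β_θ G₂`. -/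
theorem exists_theta_mem {m : ℕ} {u : L2 n} (hu : u ∈ gammaSubmodule n (m + 1)) :
    ∃ g ∈ gammaSubmodule n m, IsWeightedDeriv 1 0 u g := by
  obtain ⟨g, hg⟩ := hu 1 0 (by simp)
  refine ⟨g, fun α β h => ?_, hg⟩
  obtain ⟨G₁, hG₁⟩ := hu (α + 1) β (by omega)
  have h3 : ∑ i, (β - Pi.single (Fin.last n) 1 : Fin (n + 1) → ℕ) i ≤ ∑ i, β i :=
    Finset.sum_le_sum fun i _ => Nat.sub_le _ _
  obtain ⟨G₂, hG₂⟩ := hu α (β - Pi.single (Fin.last n) 1) (by omega)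
  refine ⟨G₁ + (β (Fin.last n) : ℝ) • G₂, isWeightedDeriv_iff.2 fun φ => ?_⟩
  have e : Test.th (Test.D β ((Test.th ^ α : Module.End ℝ (Test n)) φ)) =
      Test.D β ((Test.th ^ (α + 1) : Module.End ℝ (Test n)) φ) - (β (Fin.last n) : ℝ) •
        Test.D (β - Pi.single (Fin.last n) 1) ((Test.th ^ α : Module.End ℝ (Test n)) φ) := by
    rw [pow_succ', Module.End.mul_apply, Test.D_th, add_sub_cancel_right]
  rw [Test.inner_of_theta hg, e, map_sub, map_smul, inner_sub_right, inner_smul_right,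
    inner_add_left, inner_smul_left, isWeightedDeriv_iff.1 hG₁ φ, isWeightedDeriv_iff.1 hG₂ φ]
  simp only [conj_trivial]
  -- The subtraction lowers `|β|`, and so flips the sign, only if the last entry is positive;
  -- otherwise the term has coefficient zero.
  rcases Nat.eq_zero_or_pos (β (Fin.last n)) with hz | hz
  · simp [hz]
  · have h5 : ∑ i, β i = ∑ i, (β - Pi.single (Fin.last n) 1 : Fin (n + 1) → ℕ) i + 1 := by
      rw [← Test.sum_add_single _ (Fin.last n)]
      refine Finset.sum_congr rfl fun i _ => ?_
      by_cases hi : i = Fin.last n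
      · subst hi; simp; omega
      · simp [hi]
    rw [h5, pow_succ]
    ring

namespace Test

/-- The induction runs over all `u`, `χ` and `ρ` at once, because the commutators replace the cutoff
by its derivative and the kernel by `θ` times itself. -/
theorem nrm_approx_bounded (m : ℕ) : ∀ u ∈ gammaSubmodule n m, ∀ χ ρ : Test n,
    ∃ K, ∀ j, nrm m (approx (scale j) χ ρ u) ≤ K := by
  induction m with
  | zero =>
    intro u _ χ ρ
    obtain ⟨K, -, hK⟩ := norm_approx_le χ ρ
    exact ⟨K * ‖u‖, fun j => hK _ u⟩
  | succ m ih =>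
    intro u hu χ ρ
    have hu' : u ∈ gammaSubmodule n m := fun α β h => hu α β (by omega)
    have hl : ∀ l : Option (Fin (n + 1)), ∃ K, ∀ j, nrm m (op l (approx (scale j) χ ρ u)) ≤ K := by
      rintro (_ | i)
      · obtain ⟨g, hg, hug⟩ := exists_theta_mem hu
        obtain ⟨K₁, h₁⟩ := ih g hg χ ρ
        obtain ⟨K₂, h₂⟩ := ih u hu' χ (th ρ)
        refine ⟨K₁ + K₂, fun j => ?_⟩
        rw [op_none, th_approx hug]
        refine (map_add_le_add _ _ _).trans (add_le_add (h₁ j) ?_)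
        rw [map_smul_eq_mul, Real.norm_of_nonneg (scale_pos j).le]
        exact (mul_le_of_le_one_left (apply_nonneg _ _) (scale_le_one j)).trans (h₂ j)
      · obtain ⟨g, hg, hug⟩ := exists_deriv_mem hu i
        obtain ⟨K₁, h₁⟩ := ih g hg χ ρ
        obtain ⟨K₂, h₂⟩ := ih u hu' (d i χ) ρ
        refine ⟨K₁ + K₂, fun j => ?_⟩
        rw [op_some, d_approx hug]
        refine (map_add_le_add _ _ _).trans (add_le_add (h₁ j) ?_)
        rw [map_smul_eq_mul, Real.norm_of_nonneg (scale_pos j).le]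
        exact (mul_le_of_le_one_left (apply_nonneg _ _) (scale_le_one j)).trans (h₂ j)
    choose K hK using hl
    obtain ⟨K₀, h₀⟩ := ih u hu' χ ρ
    refine ⟨K₀ + ∑ l, K l, fun j => ?_⟩
    rw [nrm_succ]
    exact add_le_add (h₀ j) (Finset.sum_le_sum fun l _ => hK l j)

/-- A first order operator applied to the approximation is the approximation of the corresponding
weak derivative plus `scale j` times a bounded term; the latter tends to zero. -/
theorem nrm_approx_cauchy (m : ℕ) : ∀ u ∈ gammaSubmodule n m, ∀ χ ρ : Test n,
    Filter.Tendsto (fun p : ℕ × ℕ =>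
      nrm m (approx (scale p.1) χ ρ u - approx (scale p.2) χ ρ u)) Filter.atTop (nhds 0) := by
  have hs : ∀ (m : ℕ) (f g h : ℕ → Test n), (∀ j, h j = f j + (scale j : ℝ) • g j) →
      Filter.Tendsto (fun p : ℕ × ℕ => nrm m (f p.1 - f p.2)) Filter.atTop (nhds 0) →
      (∃ K, ∀ j, nrm m (g j) ≤ K) →
      Filter.Tendsto (fun p : ℕ × ℕ => nrm m (h p.1 - h p.2)) Filter.atTop (nhds 0) := by
    rintro m f g h e hf ⟨K, hK⟩
    have h1 : Filter.Tendsto (fun p : ℕ × ℕ => nrm m (f p.1 - f p.2) +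
        ((scale p.1 : ℝ) * K + (scale p.2 : ℝ) * K)) Filter.atTop (nhds 0) := by
      have h2 : Filter.Tendsto (fun p : ℕ × ℕ => (scale p.1 : ℝ)) Filter.atTop (nhds 0) :=
        tendsto_scale.comp (by rw [← Filter.prod_atTop_atTop_eq]; exact Filter.tendsto_fst)
      have h3 : Filter.Tendsto (fun p : ℕ × ℕ => (scale p.2 : ℝ)) Filter.atTop (nhds 0) :=
        tendsto_scale.comp (by rw [← Filter.prod_atTop_atTop_eq]; exact Filter.tendsto_snd)
      simpa using hf.add ((h2.mul_const K).add (h3.mul_const K))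
    refine squeeze_zero (fun _ => apply_nonneg _ _) (fun p => ?_) h1
    have e2 : h p.1 - h p.2 = (f p.1 - f p.2) +
        ((scale p.1 : ℝ) • g p.1 - (scale p.2 : ℝ) • g p.2) := by
      rw [e, e]; abel
    rw [e2]
    refine (map_add_le_add _ _ _).trans (add_le_add le_rfl
      ((map_sub_le_add _ _ _).trans (add_le_add ?_ ?_)))
    · rw [map_smul_eq_mul, Real.norm_of_nonneg (scale_pos _).le]
      exact mul_le_mul_of_nonneg_left (hK _) (scale_pos _).le
    · rw [map_smul_eq_mul, Real.norm_of_nonneg (scale_pos _).le]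
      exact mul_le_mul_of_nonneg_left (hK _) (scale_pos _).le
  induction m with
  | zero =>
    intro u _ χ ρ
    have h1 := cauchySeq_iff_tendsto_dist_atTop_0.1 (tendsto_approx χ ρ u).cauchySeq
    simpa only [dist_eq_norm, ← map_sub, ← nrm_zero] using h1
  | succ m ih =>
    intro u hu χ ρ
    have hu' : u ∈ gammaSubmodule n m := fun α β h => hu α β (by omega)
    simp only [nrm_succ, map_sub]
    have e : (0 : ℝ) = 0 + ∑ l : Option (Fin (n + 1)), 0 := by simp
    rw [e]
    refine (ih u hu' χ ρ).add (tendsto_finsetSum _ fun l _ => ?_)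
    rcases l with _ | i
    · obtain ⟨g, hg, hug⟩ := exists_theta_mem hu
      exact hs m _ _ _ (fun j => th_approx hug (scale j) χ ρ) (ih g hg χ ρ)
        (nrm_approx_bounded m u hu' χ (th ρ))
    · obtain ⟨g, hg, hug⟩ := exists_deriv_mem hu i
      exact hs m _ _ _ (fun j => d_approx hug (scale j) χ ρ) (ih g hg χ ρ)
        (nrm_approx_bounded m u hu' (d i χ) ρ)

theorem exists_cutoff (n : ℕ) : ∃ χ ρ : Test n, χ 0 = 1 ∧ ∫ s, ρ s = 1 := by
  let b : ContDiffBump (0 : Space n) := ⟨1, 2, one_pos, one_lt_two⟩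
  refine ⟨⟨b, b.contDiff, b.hasCompactSupport⟩, ⟨b.normed volume, b.contDiff_normed,
    b.hasCompactSupport_normed⟩, ?_, b.integral_normed⟩
  exact b.one_of_mem_closedBall (Metric.mem_closedBall_self zero_le_one)

/-- Test functions are dense in `Γ^k`. -/
theorem denseRange_toGamma (k : ℕ) : DenseRange (toGamma k : Test n →ₗ[ℝ] Gamma n k) := by
  intro u
  obtain ⟨χ, ρ, hχ, hρ⟩ := exists_cutoff n
  obtain ⟨C, hC, hCn⟩ := norm_toGamma_le_nrm (n := n) k
  have h1 := nrm_approx_cauchy k u.toL2 u.2 χ ρ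
  have h2 : CauchySeq fun j => toGamma k (approx (scale j) χ ρ u.toL2) := by
    rw [cauchySeq_iff_tendsto_dist_atTop_0]
    have h3 := h1.const_mul C
    rw [mul_zero] at h3
    refine squeeze_zero (fun _ => dist_nonneg) (fun p => ?_) h3
    rw [dist_eq_norm, ← map_sub]
    exact hCn _
  obtain ⟨v, hv⟩ := cauchySeq_tendsto_of_complete h2
  -- The limit in `Γ^k` exists by completeness and is identified in `L²`, where the approximations
  -- converge to `u`.
  have h4 : v = u := by
    refine Gamma.toL2_injective n k ?_
    have h5 := ((Gamma.incl n k).continuous.tendsto v).comp hv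
    have h6 := tendsto_approx χ ρ u.toL2
    rw [hχ, hρ, one_mul, one_smul] at h6
    exact tendsto_nhds_unique h5 h6
  rw [h4] at hv
  exact mem_closure_of_tendsto hv (Filter.Eventually.of_forall fun j => ⟨_, rfl⟩)

end Test

end

end MachStem

/-! ### The product estimate by splitting the coordinates. -/

namespace MachStem

noncomputable section

variable {n : ℕ}

theorem lmarginal_add {S : Finset (Fin n)} {f g : (Fin n → ℝ) → ENNReal} (hf : Measurable f) :
    lmarginal (fun _ => volume) S (f + g) =
      lmarginal (fun _ => volume) S f + lmarginal (fun _ => volume) S g := by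
  funext x
  exact lintegral_add_left (hf.comp measurable_updateFinset) _

/-- A marginal over `S` depends only on the coordinates outside `S`, so the two factors depend on
complementary sets of variables and Fubini separates them. -/
theorem lintegral_lmarginal_mul_lmarginal {S : Finset (Fin n)} {f g : (Fin n → ℝ) → ENNReal}
    (hf : Measurable f) (hg : Measurable g) :
    ∫⁻ x, lmarginal (fun _ => volume) S f x * lmarginal (fun _ => volume) Sᶜ g x =
      (∫⁻ x, f x) * ∫⁻ x, g x := by
  have hA := hf.lmarginal (fun _ : Fin n => (volume : Measure ℝ)) (s := S)
  have hB := hg.lmarginal (fun _ : Fin n => (volume : Measure ℝ)) (s := Sᶜ)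
  have hd : Disjoint S Sᶜ := disjoint_compl_right
  have hu : S ∪ Sᶜ = Finset.univ := Finset.union_compl S
  have e1 : lmarginal (fun _ => volume) Sᶜ (fun x =>
      lmarginal (fun _ => volume) S f x * lmarginal (fun _ => volume) Sᶜ g x) =
      fun x => (∫⁻ x, f x) * lmarginal (fun _ => volume) Sᶜ g x := by
    funext x
    have e2 : ∀ y, lmarginal (fun _ => volume) Sᶜ g (Function.updateFinset x Sᶜ y) =
        lmarginal (fun _ => volume) Sᶜ g x := fun y =>
      lmarginal_congr _ _ fun i hi => by simp [Function.updateFinset, hi]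
    rw [lmarginal]
    simp only [e2]
    have hA' : Measurable fun y : (↥Sᶜ → ℝ) =>
        lmarginal (fun _ => volume) S f (Function.updateFinset x Sᶜ y) :=
      hA.comp measurable_updateFinset
    rw [lintegral_mul_const _ hA']
    congr 1
    have e3 := congrFun (lmarginal_union' (fun _ : Fin n => (volume : Measure ℝ)) f hf hd) x
    rw [hu, lmarginal_univ] at e3
    exact e3.symm
  have e4 : ∀ F : (Fin n → ℝ) → ENNReal, ∫⁻ x, F x = lmarginal (fun _ => volume) Finset.univ F 0 :=
    fun F => lintegral_eq_lmarginal_univ (μ := fun _ : Fin n => (volume : Measure ℝ)) 0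
  have hB' : Measurable fun y : (↥S → ℝ) =>
      lmarginal (fun _ => volume) Sᶜ g (Function.updateFinset 0 S y) :=
    hB.comp measurable_updateFinset
  rw [e4 (fun x => lmarginal (fun _ => volume) S f x * lmarginal (fun _ => volume) Sᶜ g x),
    ← hu, lmarginal_union _ (fun x => lmarginal (fun _ => volume) S f x *
      lmarginal (fun _ => volume) Sᶜ g x) (hA.mul hB) hd, e1, lmarginal,
    lintegral_const_mul _ hB']
  congr 1
  rw [e4 g, ← hu, lmarginal_union _ _ hg hd]
  rfl

namespace Test

/-- The square of a test function, in coordinates. -/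
def sq2 (φ : Test n) : (Fin (n + 1) → ℝ) → ENNReal := fun y => ‖φ (WithLp.toLp 2 y)‖ₑ ^ 2

theorem measurable_enorm (φ : Test n) : Measurable fun x => ‖φ x‖ₑ :=
  φ.continuous.measurable.enorm

theorem measurable_sq2 (φ : Test n) : Measurable φ.sq2 :=
  (φ.measurable_enorm.comp (PiLp.volume_preserving_toLp (Fin (n + 1))).measurable).pow_const 2

theorem lintegral_toLp (f : Space n → ENNReal) (hf : Measurable f) :
    ∫⁻ y, f (WithLp.toLp 2 y) = ∫⁻ x, f x :=
  (PiLp.volume_preserving_toLp (Fin (n + 1))).lintegral_comp hf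

theorem lintegral_sq2 (φ : Test n) : ∫⁻ y, φ.sq2 y = ‖toL2 φ‖ₑ ^ 2 := by
  rw [enorm_toL2_sq]
  exact lintegral_toLp _ (φ.measurable_enorm.pow_const 2)

theorem toLp_update (y : Fin (n + 1) → ℝ) (i : Fin (n + 1)) (s : ℝ) :
    (WithLp.toLp 2 (Function.update y i s) : Space n) =
      WithLp.toLp 2 y + (s - y i) • EuclideanSpace.single i 1 := by
  ext j
  by_cases hj : j = i
  · subst hj; simp
  · simp [hj]

theorem hasDerivAt_line (φ : Test n) (x v : Space n) (t : ℝ) :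
    HasDerivAt (fun s : ℝ => φ (x + s • v)) (fderiv ℝ φ (x + t • v) v) t := by
  have h1 : HasDerivAt (fun s : ℝ => x + s • v) v t := by
    simpa using ((hasDerivAt_id t).smul_const v).const_add x
  exact (φ.hasFDerivAt (x + t • v)).comp_hasDerivAt t h1

/-- On the line in direction `i`, the square of a compactly supported function is bounded by the
integral of `|∂_i (φ²)|`, hence by that of `φ² + (∂_i φ)²`. -/
theorem sq2_le_lmarginal (i : Fin (n + 1)) (φ : Test n) :
    φ.sq2 ≤ lmarginal (fun _ => volume) {i} (φ.sq2 + (d i φ).sq2) := by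
  intro y
  rw [lmarginal_singleton]
  set g : ℝ → ℝ := fun s => φ (WithLp.toLp 2 (Function.update y i s)) with hg
  set g' : ℝ → ℝ := fun s => d i φ (WithLp.toLp 2 (Function.update y i s)) with hg'
  have hder : ∀ s, HasDerivAt g (g' s) s := by
    intro s
    have h1 := φ.hasDerivAt_line (WithLp.toLp 2 y) (EuclideanSpace.single i 1) (s - y i)
    have h2 := h1.comp_sub_const s (y i)
    simp only [hg, hg', toLp_update, d_apply]
    exact h2
  have hc : HasCompactSupport g :=
    (φ.hasCompactSupport.comp_isClosedEmbedding
      (PiLp.homeomorph 2 (fun _ : Fin (n + 1) => ℝ)).symm.isClosedEmbedding).comp_isClosedEmbedding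
      (isClosedEmbedding_update y i)
  have hcont' : Continuous g' := by
    have h1 : Continuous fun s : ℝ => (WithLp.toLp 2 (Function.update y i s) : Space n) := by
      simp only [toLp_update]; fun_prop
    exact (d i φ).continuous.comp h1
  have hsm : ContDiff ℝ 1 (fun s => g s * g s) := by
    have : ContDiff ℝ 1 g := by
      rw [contDiff_one_iff_deriv]
      refine ⟨fun s => (hder s).differentiableAt, ?_⟩
      have : deriv g = g' := funext fun s => (hder s).deriv
      rwa [this]
    exact this.mul this
  have h3 := hc.mul_right (f' := g) |>.enorm_le_lintegral_Ici_deriv hsm (y i)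
  have h4 : φ.sq2 y = ‖g (y i) * g (y i)‖ₑ := by
    rw [enorm_mul, ← sq]
    simp [hg, sq2]
  rw [h4]
  refine h3.trans ((lintegral_mono' Measure.restrict_le_self le_rfl).trans (lintegral_mono ?_))
  intro s
  have h6 : HasDerivAt (fun s => g s * g s) (g' s * g s + g s * g' s) s := (hder s).mul (hder s)
  simp only [h6.deriv]
  have h5 : ‖g' s * g s + g s * g' s‖ₑ ≤ ‖g s‖ₑ ^ 2 + ‖g' s‖ₑ ^ 2 := by
    rw [← ofReal_norm, ← ofReal_norm, ← ofReal_norm, ← ENNReal.ofReal_pow (norm_nonneg _),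
      ← ENNReal.ofReal_pow (norm_nonneg _), ← ENNReal.ofReal_add (sq_nonneg _) (sq_nonneg _)]
    refine ENNReal.ofReal_le_ofReal ?_
    rw [Real.norm_eq_abs, Real.norm_eq_abs, Real.norm_eq_abs, sq_abs, sq_abs, abs_le]
    constructor <;> nlinarith [sq_nonneg (g s + g' s), sq_nonneg (g s - g' s)]
  exact h5

theorem ofReal_nrm_sq_add_le (m : ℕ) (l : Option (Fin (n + 1))) (φ : Test n) :
    ENNReal.ofReal (nrm m φ) ^ 2 + ENNReal.ofReal (nrm m (op l φ)) ^ 2 ≤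
      ENNReal.ofReal (nrm (m + 1) φ) ^ 2 := by
  have h0 : 0 ≤ nrm m φ := apply_nonneg _ _
  have h1 : 0 ≤ nrm m (op l φ) := apply_nonneg _ _
  rw [← ENNReal.ofReal_pow h0, ← ENNReal.ofReal_pow h1, ← ENNReal.ofReal_pow (apply_nonneg _ _),
    ← ENNReal.ofReal_add (sq_nonneg _) (sq_nonneg _)]
  refine ENNReal.ofReal_le_ofReal ?_
  have h2 : nrm m φ + nrm m (op l φ) ≤ nrm (m + 1) φ := by
    rw [nrm_succ]
    have := Finset.single_le_sum (f := fun l => nrm m (op l φ)) (fun _ _ => apply_nonneg _ _)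
      (Finset.mem_univ l)
    linarith
  nlinarith

/-- Iteration of the one-dimensional bound: taking the supremum in the coordinates of `S` costs one
derivative for each of them, while the other coordinates keep their `L²` character. -/
theorem exists_slice (S : Finset (Fin (n + 1))) : ∀ φ : Test n,
    ∃ F : (Fin (n + 1) → ℝ) → ENNReal, Measurable F ∧
      φ.sq2 ≤ lmarginal (fun _ => volume) S F ∧
      ∫⁻ y, F y ≤ ENNReal.ofReal (nrm S.card φ) ^ 2 := by
  induction S using Finset.induction_on with
  | empty =>
    intro φ
    refine ⟨φ.sq2, φ.measurable_sq2, by rw [lmarginal_empty], ?_⟩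
    rw [lintegral_sq2, Finset.card_empty, nrm_zero, ofReal_norm]
  | insert i S hi ih =>
    intro φ
    obtain ⟨F₁, hm₁, hs₁, hn₁⟩ := ih φ
    obtain ⟨F₂, hm₂, hs₂, hn₂⟩ := ih (d i φ)
    refine ⟨F₁ + F₂, hm₁.add hm₂, ?_, ?_⟩
    · refine (sq2_le_lmarginal i φ).trans ?_
      rw [Finset.insert_eq, lmarginal_union _ _ (hm₁.add hm₂) (by simpa using hi),
        lmarginal_add hm₁]
      exact lmarginal_mono (add_le_add hs₁ hs₂)
    · rw [Finset.card_insert_of_notMem hi]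
      refine le_trans ?_ (ofReal_nrm_sq_add_le S.card (some i) φ)
      simp only [Pi.add_apply]
      rw [lintegral_add_left hm₁]
      exact add_le_add hn₁ hn₂

theorem ofReal_nrm_mono {i j : ℕ} (h : i ≤ j) (φ : Test n) :
    ENNReal.ofReal (nrm i φ) ^ 2 ≤ ENNReal.ofReal (nrm j φ) ^ 2 :=
  pow_le_pow_left₀ zero_le (ENNReal.ofReal_le_ofReal (nrm_mono h φ)) 2

theorem norm_le_of_enorm_sq_le {x : L2 n} {C a b : ℝ} (hC : 0 ≤ C) (ha : 0 ≤ a) (hb : 0 ≤ b)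
    (h : ‖x‖ₑ ^ 2 ≤ ENNReal.ofReal C ^ 2 * (ENNReal.ofReal a ^ 2 * ENNReal.ofReal b ^ 2)) :
    ‖x‖ ≤ C * (a * b) := by
  rw [← mul_pow, ← mul_pow, ← ENNReal.ofReal_mul ha, ← ENNReal.ofReal_mul hC,
    ← ofReal_norm, ← ENNReal.ofReal_pow (norm_nonneg _),
    ← ENNReal.ofReal_pow (by positivity), ENNReal.ofReal_le_ofReal_iff (by positivity)] at h
  exact (sq_le_sq₀ (norm_nonneg _) (by positivity)).1 h

/-- The product estimate. -/
theorem norm_mul_le {i j : ℕ} (h : n + 1 ≤ i + j) (φ ψ : Test n) :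
    ‖toL2 (mul φ ψ)‖ ≤ nrm i φ * nrm j ψ := by
  -- The first factor takes the supremum in as many coordinates as `i` allows, the second in all the
  -- remaining ones; `n + 1 ≤ i + j` is exactly enough.
  obtain ⟨S, -, hS⟩ := Finset.exists_subset_card_eq
    (s := (Finset.univ : Finset (Fin (n + 1)))) (n := min i (n + 1)) (by simp)
  obtain ⟨F, hF, hφ, hFn⟩ := exists_slice S φ
  obtain ⟨G, hG, hψ, hGn⟩ := exists_slice Sᶜ ψ
  have hSc : Sᶜ.card = n + 1 - min i (n + 1) := by rw [Finset.card_compl, hS, Fintype.card_fin]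
  rw [← one_mul (nrm i φ * nrm j ψ)]
  refine norm_le_of_enorm_sq_le zero_le_one (apply_nonneg _ _) (apply_nonneg _ _) ?_
  rw [← lintegral_sq2, ENNReal.ofReal_one, one_pow, one_mul]
  calc ∫⁻ y, (mul φ ψ).sq2 y
      ≤ ∫⁻ y, lmarginal (fun _ => volume) S F y * lmarginal (fun _ => volume) Sᶜ G y := by
        refine lintegral_mono fun y => ?_
        have : (mul φ ψ).sq2 y = φ.sq2 y * ψ.sq2 y := by
          simp only [sq2, mul_apply, enorm_mul, mul_pow]
        rw [this]
        exact mul_le_mul' (hφ y) (hψ y)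
    _ = (∫⁻ y, F y) * ∫⁻ y, G y := lintegral_lmarginal_mul_lmarginal hF hG
    _ ≤ _ := mul_le_mul' (hFn.trans (ofReal_nrm_mono (by omega) φ))
        (hGn.trans (ofReal_nrm_mono (by omega) ψ))

end Test

end

end MachStem

/-! ### The pulse operator on test functions and its algebraic identities. -/

namespace MachStem

noncomputable section

variable {n : ℕ}

theorem norm_thetaDir : ‖thetaDir n‖ = 1 := by simp [thetaDir]

namespace Test

/-- The integrand of the bilinear operator `fp`. -/
def ray (δ₁ δ₃ : ℝ) (φ ψ : Test n) (x : Space n) (X : ℝ) : ℝ :=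
  φ (x + (δ₁ * X) • thetaDir n) * ψ (x + (δ₃ * X) • thetaDir n)

theorem contDiff_ray (δ₁ δ₃ : ℝ) (φ ψ : Test n) :
    ContDiff ℝ ∞ fun p : Space n × ℝ => ray δ₁ δ₃ φ ψ p.1 p.2 := by
  have h1 := φ.contDiff
  have h2 := ψ.contDiff
  unfold ray
  exact (h1.comp (by fun_prop)).mul (h2.comp (by fun_prop))

/-- The two arguments differ by `(δ₃ - δ₁) X` in the direction of `θ`. If both lie in bounded
supports then `X` is bounded, and hence so is `x`. -/
theorem exists_ray_bound {δ₁ δ₃ : ℝ} (h : δ₁ ≠ δ₃) (φ ψ : Test n) :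
    ∃ r, 0 ≤ r ∧ ∀ x X, ray δ₁ δ₃ φ ψ x X ≠ 0 → |X| ≤ r ∧ ‖x‖ ≤ r := by
  obtain ⟨r₁, hr₁, h₁⟩ := exists_closedBall φ
  obtain ⟨r₂, hr₂, h₂⟩ := exists_closedBall ψ
  have hd : 0 < |δ₃ - δ₁| := abs_pos.2 (sub_ne_zero.2 h.symm)
  refine ⟨(r₁ + r₂) / |δ₃ - δ₁| + (r₁ + |δ₁| * ((r₁ + r₂) / |δ₃ - δ₁|)), by positivity,
    fun x X hX => ?_⟩
  have a₁ : ‖x + (δ₁ * X) • thetaDir n‖ ≤ r₁ := by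
    by_contra hc
    exact hX (by rw [ray, h₁ _ (not_le.1 hc), zero_mul])
  have a₂ : ‖x + (δ₃ * X) • thetaDir n‖ ≤ r₂ := by
    by_contra hc
    exact hX (by rw [ray, h₂ _ (not_le.1 hc), mul_zero])
  have a₃ : |X| ≤ (r₁ + r₂) / |δ₃ - δ₁| := by
    rw [le_div_iff₀ hd, mul_comm, ← abs_mul]
    have e : ((δ₃ - δ₁) * X) • thetaDir n =
        (x + (δ₃ * X) • thetaDir n) - (x + (δ₁ * X) • thetaDir n) := by
      rw [sub_mul, sub_smul]; abel
    have := norm_sub_le (x + (δ₃ * X) • thetaDir n) (x + (δ₁ * X) • thetaDir n)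
    rw [← e, norm_smul, norm_thetaDir, mul_one, Real.norm_eq_abs] at this
    linarith
  have a₄ : ‖x‖ ≤ r₁ + |δ₁| * ((r₁ + r₂) / |δ₃ - δ₁|) := by
    have e : x = (x + (δ₁ * X) • thetaDir n) - (δ₁ * X) • thetaDir n := by abel
    have := norm_sub_le (x + (δ₁ * X) • thetaDir n) ((δ₁ * X) • thetaDir n)
    rw [← e, norm_smul, norm_thetaDir, mul_one, Real.norm_eq_abs, abs_mul] at this
    have := mul_le_mul_of_nonneg_left a₃ (abs_nonneg δ₁)
    linarith
  have : 0 ≤ |δ₁| * ((r₁ + r₂) / |δ₃ - δ₁|) := by positivity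
  have : 0 ≤ (r₁ + r₂) / |δ₃ - δ₁| := by positivity
  constructor <;> linarith

theorem continuous_ray (δ₁ δ₃ : ℝ) (φ ψ : Test n) (x : Space n) :
    Continuous (ray δ₁ δ₃ φ ψ x) :=
  (contDiff_ray δ₁ δ₃ φ ψ).continuous.comp (by fun_prop : Continuous fun X : ℝ => (x, X))

theorem hasCompactSupport_ray {δ₁ δ₃ : ℝ} (h : δ₁ ≠ δ₃) (φ ψ : Test n) (x : Space n) :
    HasCompactSupport (ray δ₁ δ₃ φ ψ x) := by
  obtain ⟨r, -, hr⟩ := exists_ray_bound h φ ψ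
  refine HasCompactSupport.of_support_subset_isCompact (isCompact_closedBall (0 : ℝ) r) ?_
  intro X hX
  rw [mem_closedBall_zero_iff]
  exact (hr x X hX).1

theorem integrable_ray {δ₁ δ₃ : ℝ} (h : δ₁ ≠ δ₃) (φ ψ : Test n) (x : Space n) :
    Integrable (ray δ₁ δ₃ φ ψ x) :=
  (continuous_ray δ₁ δ₃ φ ψ x).integrable_of_hasCompactSupport (hasCompactSupport_ray h φ ψ x)

/-- The integral over the half line is a convolution, evaluated at zero, of its indicator with a
smooth kernel of compact support that depends smoothly on `x`. -/
theorem isTest_integral_ray {δ₁ δ₃ : ℝ} (h : δ₁ ≠ δ₃) (φ ψ : Test n) :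
    IsTest fun x => ∫ X in Set.Ioi (0 : ℝ), ray δ₁ δ₃ φ ψ x X := by
  obtain ⟨r, hr0, hr⟩ := exists_ray_bound h φ ψ
  constructor
  · have hf : LocallyIntegrable (Set.indicator (Set.Ioi (0 : ℝ)) (fun _ => (1 : ℝ))) volume :=
      (locallyIntegrable_const (1 : ℝ)).indicator measurableSet_Ioi
    have key := contDiffOn_convolution_right_with_param (μ := (volume : Measure ℝ)) (𝕜 := ℝ)
      (n := (⊤ : ℕ∞))
      (ContinuousLinearMap.mul ℝ ℝ) (f := Set.indicator (Set.Ioi (0 : ℝ)) (fun _ => (1 : ℝ)))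
      (g := fun (p : Space n) (s : ℝ) => ray δ₁ δ₃ φ ψ p (-s)) (s := Set.univ)
      (k := Metric.closedBall 0 r) isOpen_univ (isCompact_closedBall _ _)
      (by
        intro p x _ hx
        by_contra hc
        refine hx ?_
        rw [mem_closedBall_zero_iff]
        simpa using (hr _ _ hc).1) hf
      (((contDiff_ray δ₁ δ₃ φ ψ).comp
        (by fun_prop : ContDiff ℝ ∞ fun p : Space n × ℝ => (p.1, -p.2))).contDiffOn)
    rw [Set.univ_prod_univ, contDiffOn_univ] at key
    have k2 := key.comp (by fun_prop : ContDiff ℝ ∞ fun x : Space n => (x, (0 : ℝ)))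
    convert k2 using 1
    funext x
    simp only [Function.comp_apply, convolution_def, ContinuousLinearMap.mul_apply']
    rw [← integral_indicator measurableSet_Ioi]
    congr 1
    funext X
    by_cases hX : X ∈ Set.Ioi (0 : ℝ) <;> simp [hX]
  · refine HasCompactSupport.of_support_subset_isCompact (isCompact_closedBall (0 : Space n) r) ?_
    intro x hx
    rw [mem_closedBall_zero_iff]
    by_contra hc
    refine hx ?_
    have : ∀ X, ray δ₁ δ₃ φ ψ x X = 0 := fun X => by
      by_contra h'
      exact hc (hr _ _ h').2
    simp [this]

/-- The bilinear operator of the pulse equation on test functions. -/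
def fp {δ₁ δ₃ : ℝ} (h : δ₁ ≠ δ₃) : Test n →ₗ[ℝ] Test n →ₗ[ℝ] Test n :=
  LinearMap.mk₂ ℝ
    (fun φ ψ => ⟨fun x => ∫ X in Set.Ioi (0 : ℝ), ray δ₁ δ₃ φ ψ x X, isTest_integral_ray h φ ψ⟩)
    (fun φ φ' ψ => ext' fun x => by
      change (∫ X in Set.Ioi (0 : ℝ), ray δ₁ δ₃ (φ + φ') ψ x X) =
        (∫ X in Set.Ioi (0 : ℝ), ray δ₁ δ₃ φ ψ x X) + (∫ X in Set.Ioi (0 : ℝ), ray δ₁ δ₃ φ' ψ x X)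
      rw [← integral_add (integrable_ray h _ _ _).integrableOn
        (integrable_ray h _ _ _).integrableOn]
      simp [ray, add_mul])
    (fun c φ ψ => ext' fun x => by
      change (∫ X in Set.Ioi (0 : ℝ), ray δ₁ δ₃ (c • φ) ψ x X) = c * (∫ X in Set.Ioi (0 : ℝ), ray δ₁ δ₃ φ ψ x X)
      rw [← integral_const_mul]
      simp [ray, mul_assoc])
    (fun φ ψ ψ' => ext' fun x => by
      change (∫ X in Set.Ioi (0 : ℝ), ray δ₁ δ₃ φ (ψ + ψ') x X) =
        (∫ X in Set.Ioi (0 : ℝ), ray δ₁ δ₃ φ ψ x X) + (∫ X in Set.Ioi (0 : ℝ), ray δ₁ δ₃ φ ψ' x X)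
      rw [← integral_add (integrable_ray h _ _ _).integrableOn
        (integrable_ray h _ _ _).integrableOn]
      simp [ray, mul_add])
    (fun c φ ψ => ext' fun x => by
      change (∫ X in Set.Ioi (0 : ℝ), ray δ₁ δ₃ φ (c • ψ) x X) = c * (∫ X in Set.Ioi (0 : ℝ), ray δ₁ δ₃ φ ψ x X)
      rw [← integral_const_mul]
      simp [ray, mul_left_comm])

theorem fp_apply {δ₁ δ₃ : ℝ} (h : δ₁ ≠ δ₃) (φ ψ : Test n) (x : Space n) :
    fp h φ ψ x = ∫ X in Set.Ioi (0 : ℝ), ray δ₁ δ₃ φ ψ x X := rfl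

theorem fp_swap {δ₁ δ₃ : ℝ} (h : δ₁ ≠ δ₃) (φ ψ : Test n) : fp h φ ψ = fp h.symm ψ φ :=
  ext' fun x => by simp only [fp_apply, ray, mul_comm]

/-- On the ray, `(δ₃ - δ₁) θ = δ₃ (θ + δ₁ X) - δ₁ (θ + δ₃ X)`, which distributes the weight over the
two arguments with constant coefficients. -/
theorem th_fp {δ₁ δ₃ : ℝ} (h : δ₁ ≠ δ₃) (φ ψ : Test n) :
    (δ₃ - δ₁) • th (fp h φ ψ) = δ₃ • fp h (th φ) ψ - δ₁ • fp h φ (th ψ) := by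
  refine ext' fun x => ?_
  simp only [smul_apply, sub_apply, th_apply, fp_apply]
  rw [← integral_const_mul, ← integral_const_mul, ← integral_const_mul, ← integral_const_mul,
    ← integral_sub ((integrable_ray h _ _ _).const_mul _).integrableOn
      ((integrable_ray h _ _ _).const_mul _).integrableOn]
  congr 1
  funext X
  simp only [ray, th_apply, thetaDir, PiLp.add_apply, PiLp.smul_apply,
    PiLp.single_apply, smul_eq_mul, if_true]
  ring

theorem d_fp {δ₁ δ₃ : ℝ} (h : δ₁ ≠ δ₃) (i : Fin (n + 1)) (φ ψ : Test n) :
    d i (fp h φ ψ) = fp h (d i φ) ψ + fp h φ (d i ψ) := by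
  refine ext' fun x => ?_
  obtain ⟨r₂, -, h₂⟩ := exists_ray_bound h (d i φ) ψ
  obtain ⟨r₃, -, h₃⟩ := exists_ray_bound h φ (d i ψ)
  set v : Space n := EuclideanSpace.single i 1 with hv
  have hd : ∀ (χ : Test n) (X c s : ℝ), HasDerivAt (fun s : ℝ => χ (x + s • v + (c * X) • thetaDir n))
      (d i χ (x + s • v + (c * X) • thetaDir n)) s := by
    intro χ X c s
    have := χ.hasDerivAt_line (x + (c * X) • thetaDir n) v s
    simp only [add_right_comm x] at this ⊢
    exact this
  obtain ⟨A, hA0, hA⟩ := exists_bound (d i φ)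
  obtain ⟨A', hA'0, hA'⟩ := exists_bound φ
  obtain ⟨B, hB0, hB⟩ := exists_bound (d i ψ)
  obtain ⟨B', hB'0, hB'⟩ := exists_bound ψ
  have h3 := hasDerivAt_integral_of_dominated_loc_of_deriv_le (𝕜 := ℝ)
    (μ := volume.restrict (Set.Ioi (0 : ℝ)))
    (F := fun s X => ray δ₁ δ₃ φ ψ (x + s • v) X)
    (F' := fun s X => ray δ₁ δ₃ (d i φ) ψ (x + s • v) X + ray δ₁ δ₃ φ (d i ψ) (x + s • v) X)
    (x₀ := 0) (s := Set.univ) (bound := Set.indicator (Metric.closedBall 0 (max r₂ r₃)) fun _ => A * B' + A' * B)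
    Filter.univ_mem
    (Filter.Eventually.of_forall fun s => (integrable_ray h φ ψ _).aestronglyMeasurable.restrict)
    (integrable_ray h φ ψ _).restrict
    ((integrable_ray h _ _ _).add (integrable_ray h _ _ _)).aestronglyMeasurable.restrict
    (ae_of_all _ fun X s _ => ?_) ?_ ?_
  · have h4 := (fp h φ ψ).hasDerivAt_line x v 0
    have h5 := h4.unique h3.2
    rw [zero_smul, add_zero] at h5
    rw [d_apply, h5]
    exact integral_add (integrable_ray h _ _ _).restrict (integrable_ray h _ _ _).restrict
  · have hX : ray δ₁ δ₃ (d i φ) ψ (x + s • v) X + ray δ₁ δ₃ φ (d i ψ) (x + s • v) X ≠ 0 →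
        X ∈ Metric.closedBall 0 (max r₂ r₃) := fun hne => by
      rw [mem_closedBall_zero_iff]
      by_cases h4 : ray δ₁ δ₃ (d i φ) ψ (x + s • v) X = 0
      · rw [h4, zero_add] at hne
        exact (h₃ _ _ hne).1.trans (le_max_right _ _)
      · exact (h₂ _ _ h4).1.trans (le_max_left _ _)
    by_cases h4 : ray δ₁ δ₃ (d i φ) ψ (x + s • v) X + ray δ₁ δ₃ φ (d i ψ) (x + s • v) X = 0
    · rw [h4, norm_zero]
      exact Set.indicator_nonneg (fun _ _ => by positivity) _
    · rw [Set.indicator_of_mem (hX h4)]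
      refine (norm_add_le _ _).trans (add_le_add ?_ ?_) <;>
      · rw [ray, norm_mul]
        exact mul_le_mul (by first | exact hA _ | exact hA' _) (by first | exact hB _ | exact hB' _)
          (norm_nonneg _) (by positivity)
  · exact ((integrable_indicator_iff measurableSet_closedBall).2
      (integrableOn_const (measure_closedBall_lt_top).ne)).restrict
  · refine ae_of_all _ fun X s _ => ?_
    exact (hd φ X δ₁ s).mul (hd ψ X δ₃ s)

/-- The left side is the integral over `X` of the total derivative of the integrand; only the
boundary term at `X = 0` remains. This identity trades a `θ`-derivative of one factor for one of the
other. -/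
theorem fp_d_last {δ₁ δ₃ : ℝ} (h : δ₁ ≠ δ₃) (φ ψ : Test n) :
    δ₁ • fp h (d (Fin.last n) φ) ψ + δ₃ • fp h φ (d (Fin.last n) ψ) = -mul φ ψ := by
  refine ext' fun x => ?_
  have hd : ∀ (χ : Test n) (c X : ℝ), HasDerivAt (fun X => χ (x + (c * X) • thetaDir n))
      (c * d (Fin.last n) χ (x + (c * X) • thetaDir n)) X := by
    intro χ c X
    have h1 := χ.hasDerivAt_line x (thetaDir n) (c * X)
    have h2 := h1.scomp X ((hasDerivAt_id X).const_mul c)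
    have h3 : HasDerivAt (fun X => χ (x + (c * X) • thetaDir n))
        (c * fderiv ℝ χ (x + (c * X) • thetaDir n) (thetaDir n)) X := by
      simpa [Function.comp_def] using h2
    exact h3
  have hray : ∀ X, HasDerivAt (ray δ₁ δ₃ φ ψ x) (δ₁ * ray δ₁ δ₃ (d (Fin.last n) φ) ψ x X +
      δ₃ * ray δ₁ δ₃ φ (d (Fin.last n) ψ) x X) X := by
    intro X
    refine ((hd φ δ₁ X).mul (hd ψ δ₃ X)).congr_deriv ?_
    simp only [ray]
    ring
  have hc : ContDiff ℝ 1 (ray δ₁ δ₃ φ ψ x) :=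
    ((contDiff_ray δ₁ δ₃ φ ψ).comp
      (by fun_prop : ContDiff ℝ ∞ fun X : ℝ => (x, X))).of_le (by simp)
  have key := (hasCompactSupport_ray h φ ψ x).integral_Ioi_deriv_eq hc 0
  simp only [add_apply, smul_apply, neg_apply, mul_apply, fp_apply]
  rw [← integral_const_mul, ← integral_const_mul,
    ← integral_add ((integrable_ray h _ _ _).const_mul _).integrableOn
      ((integrable_ray h _ _ _).const_mul _).integrableOn]
  simp only [fun X => (hray X).deriv] at key
  rw [key]
  simp [ray]

end Test

end

end MachStem

/-! ### The `L²` estimate of the pulse operator. -/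

namespace MachStem

noncomputable section

variable {n : ℕ}

theorem lintegral_comp_mul_left {f : ℝ → ENNReal} (hf : Measurable f) {c : ℝ} (hc : c ≠ 0) :
    ∫⁻ X, f (c * X) = ENNReal.ofReal |c⁻¹| * ∫⁻ s, f s := by
  have h := lintegral_map (μ := volume) hf (measurable_const_mul c)
  rw [← h, Real.map_volume_mul_left hc, lintegral_smul_measure, smul_eq_mul]

/-- For fixed `X`, a translation of `x` by `δ₁ X v` removes `X` from the first factor; the rest is a
rescaling of the line. -/
theorem lintegral_lintegral_line {δ₁ δ₃ : ℝ} (h : δ₁ ≠ δ₃) {f g : Space n → ENNReal}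
    (hf : Measurable f) (hg : Measurable g) (v : Space n) :
    ∫⁻ x, ∫⁻ X : ℝ, f (x + (δ₁ * X) • v) * g (x + (δ₃ * X) • v) =
      ENNReal.ofReal |(δ₃ - δ₁)⁻¹| * ∫⁻ x, f x * ∫⁻ s : ℝ, g (x + s • v) := by
  have m1 : Measurable fun p : Space n × ℝ => f (p.1 + (δ₁ * p.2) • v) * g (p.1 + (δ₃ * p.2) • v) :=
    (hf.comp (by fun_prop)).mul (hg.comp (by fun_prop))
  have m2 : Measurable fun p : Space n × ℝ => f p.1 * g (p.1 + ((δ₃ - δ₁) * p.2) • v) :=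
    (hf.comp (by fun_prop)).mul (hg.comp (by fun_prop))
  have m3 : Measurable fun p : Space n × ℝ => g (p.1 + p.2 • v) := hg.comp (by fun_prop)
  rw [lintegral_lintegral_swap m1.aemeasurable]
  have e1 : ∀ X : ℝ, ∫⁻ x, f (x + (δ₁ * X) • v) * g (x + (δ₃ * X) • v) =
      ∫⁻ x, f x * g (x + ((δ₃ - δ₁) * X) • v) := by
    intro X
    rw [← lintegral_add_right_eq_self (μ := volume)
      (fun x => f x * g (x + ((δ₃ - δ₁) * X) • v)) ((δ₁ * X) • v)]
    refine lintegral_congr fun x => ?_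
    have : x + (δ₁ * X) • v + ((δ₃ - δ₁) * X) • v = x + (δ₃ * X) • v := by
      rw [add_assoc, ← add_smul]; ring_nf
    rw [this]
  simp only [e1]
  rw [← lintegral_lintegral_swap m2.aemeasurable, ← lintegral_const_mul]
  · refine lintegral_congr fun x => ?_
    have m4 : Measurable fun s : ℝ => g (x + s • v) := m3.comp measurable_prodMk_left
    have m5 : Measurable fun s : ℝ => g (x + ((δ₃ - δ₁) * s) • v) :=
      m4.comp (measurable_const_mul (δ₃ - δ₁))
    rw [lintegral_const_mul _ m5, lintegral_comp_mul_left m4 (sub_ne_zero.2 h.symm), mul_left_comm]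
  · exact hf.mul m3.lintegral_prod_right'

namespace Test

theorem lintegral_line_eq_lmarginal {g : Space n → ENNReal} (y : Fin (n + 1) → ℝ) :
    ∫⁻ s : ℝ, g (WithLp.toLp 2 y + s • thetaDir n) =
      lmarginal (fun _ => volume) {Fin.last n} (fun y => g (WithLp.toLp 2 y)) y := by
  rw [lmarginal_singleton]
  simp only [toLp_update]
  exact (lintegral_sub_right_eq_self (fun s : ℝ => g (WithLp.toLp 2 y + s • thetaDir n)) _).symm

/-- Cauchy–Schwarz along the ray, with the weight `1 + (θ + δ₃ X)²` on the second factor. The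
inverse weight has integral `π / |δ₃|`, and the weight becomes one multiplication by `θ`. -/
theorem enorm_sq_fp_le {δ₁ δ₃ : ℝ} (h : δ₁ ≠ δ₃) (h₃ : δ₃ ≠ 0) (φ ψ : Test n) (x : Space n) :
    ‖fp h φ ψ x‖ₑ ^ 2 ≤ ENNReal.ofReal (|δ₃⁻¹| * Real.pi) *
      ∫⁻ X : ℝ, ‖φ (x + (δ₁ * X) • thetaDir n)‖ₑ ^ 2 *
        (‖ψ (x + (δ₃ * X) • thetaDir n)‖ₑ ^ 2 + ‖th ψ (x + (δ₃ * X) • thetaDir n)‖ₑ ^ 2) := by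
  set θ : ℝ := x (Fin.last n)
  have cw : Continuous fun X : ℝ => √(1 + (θ + δ₃ * X) ^ 2) := by fun_prop
  have pw : ∀ X : ℝ, 0 < √(1 + (θ + δ₃ * X) ^ 2) := fun X => Real.sqrt_pos.2 (by positivity)
  have h1 : ‖fp h φ ψ x‖ₑ ≤ ∫⁻ X : ℝ, ENNReal.ofReal (√(1 + (θ + δ₃ * X) ^ 2))⁻¹ *
      (ENNReal.ofReal (√(1 + (θ + δ₃ * X) ^ 2)) * ‖ray δ₁ δ₃ φ ψ x X‖ₑ) := by
    rw [fp_apply]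
    refine (enorm_integral_le_lintegral_enorm _).trans
      ((lintegral_mono' Measure.restrict_le_self le_rfl).trans (lintegral_mono fun X => ?_))
    rw [← mul_assoc, ← ENNReal.ofReal_mul (inv_nonneg.2 (pw X).le), inv_mul_cancel₀ (pw X).ne',
      ENNReal.ofReal_one, one_mul]
  refine (pow_le_pow_left₀ zero_le h1 2).trans ((lintegral_mul_sq_le ?_ ?_).trans
    (mul_le_mul' (le_of_eq ?_) (le_of_eq ?_)))
  · exact ((cw.inv₀ fun X => (pw X).ne').measurable.ennreal_ofReal).aemeasurable
  · exact (cw.measurable.ennreal_ofReal.mul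
      (continuous_ray δ₁ δ₃ φ ψ x).measurable.enorm).aemeasurable
  · have e1 : ∀ X : ℝ, ENNReal.ofReal (√(1 + (θ + δ₃ * X) ^ 2))⁻¹ ^ 2 =
        ENNReal.ofReal (1 + (θ + δ₃ * X) ^ 2)⁻¹ := fun X => by
      rw [← ENNReal.ofReal_pow (inv_nonneg.2 (pw X).le), inv_pow, Real.sq_sqrt (by positivity)]
    have m1 : Measurable fun s : ℝ => ENNReal.ofReal (1 + s ^ 2)⁻¹ := by fun_prop
    simp only [e1]
    rw [lintegral_comp_mul_left (f := fun s => ENNReal.ofReal (1 + (θ + s) ^ 2)⁻¹) (by fun_prop) h₃,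
      lintegral_add_left_eq_self (fun s => ENNReal.ofReal (1 + s ^ 2)⁻¹) θ,
      ← ofReal_integral_eq_lintegral_ofReal integrable_inv_one_add_sq
        (ae_of_all _ fun s => by positivity), integral_univ_inv_one_add_sq,
      ENNReal.ofReal_mul (abs_nonneg _)]
  · refine lintegral_congr fun X => ?_
    have e2 : (x + (δ₃ * X) • thetaDir n) (Fin.last n) = θ + δ₃ * X := by
      simp [thetaDir, θ]
    rw [ray, th_apply, e2, mul_pow, enorm_mul, enorm_mul, mul_pow, mul_pow,
      ← ENNReal.ofReal_pow (pw X).le, Real.sq_sqrt (by positivity),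
      ENNReal.ofReal_add zero_le_one (sq_nonneg _), ENNReal.ofReal_one,
      Real.enorm_eq_ofReal_abs (θ + δ₃ * X), ← ENNReal.ofReal_pow (abs_nonneg _), sq_abs]
    ring

/-- After integration over `X`, the second factor enters through its squared `L²` norm along the
`θ`-line, so no supremum in `θ` is taken. Multiplication by `θ` uses one unit of `j`, whence `1 ≤
j`. -/
theorem exists_norm_fp_le_of_pos {δ₁ δ₃ : ℝ} (h : δ₁ ≠ δ₃) (h₃ : δ₃ ≠ 0) : ∃ C, 0 ≤ C ∧
    ∀ (i j : ℕ), 1 ≤ j → n + 1 ≤ i + j → ∀ φ ψ : Test n,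
      ‖toL2 (fp h φ ψ)‖ ≤ C * (nrm i φ * nrm j ψ) := by
  refine ⟨√(|δ₃⁻¹| * Real.pi * |(δ₃ - δ₁)⁻¹|), Real.sqrt_nonneg _, fun i j hj hij φ ψ => ?_⟩
  -- Only the `n` coordinates of `y` are shared between the factors; `θ` is reserved for the line
  -- integral of the second one.
  obtain ⟨S, hSl, hS⟩ := Finset.exists_subset_card_eq
    (s := (Finset.univ : Finset (Fin (n + 1))).erase (Fin.last n)) (n := min i n) (by simp)
  have hl : Fin.last n ∈ Sᶜ := by
    rw [Finset.mem_compl]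
    exact fun hc => Finset.notMem_erase _ _ (hSl hc)
  obtain ⟨F, hF, hφ, hFn⟩ := exists_slice S φ
  obtain ⟨G₁, hG₁, hψ₁, hGn₁⟩ := exists_slice (Sᶜ.erase (Fin.last n)) ψ
  obtain ⟨G₂, hG₂, hψ₂, hGn₂⟩ := exists_slice (Sᶜ.erase (Fin.last n)) (th ψ)
  have hcard : (Sᶜ.erase (Fin.last n)).card = n - min i n := by
    rw [Finset.card_erase_of_mem hl, Finset.card_compl, hS, Fintype.card_fin]; omega
  have hG := hG₁.add hG₂
  have hP : lmarginal (fun _ => volume) {Fin.last n} (ψ.sq2 + (th ψ).sq2) ≤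
      lmarginal (fun _ => volume) Sᶜ (G₁ + G₂) := by
    conv_rhs => rw [← Finset.insert_erase hl, Finset.insert_eq,
      lmarginal_union _ _ hG (by simp), lmarginal_add hG₁]
    exact lmarginal_mono (add_le_add hψ₁ hψ₂)
  have hGn : ∫⁻ y, (G₁ + G₂) y ≤ ENNReal.ofReal (nrm j ψ) ^ 2 := by
    simp only [Pi.add_apply]
    rw [lintegral_add_left hG₁]
    refine (add_le_add hGn₁ hGn₂).trans ((ofReal_nrm_sq_add_le _ none ψ).trans
      (ofReal_nrm_mono ?_ ψ))
    omega
  refine norm_le_of_enorm_sq_le (Real.sqrt_nonneg _) (apply_nonneg _ _) (apply_nonneg _ _) ?_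
  rw [← ENNReal.ofReal_pow (Real.sqrt_nonneg _), Real.sq_sqrt (by positivity), enorm_toL2_sq]
  have m1 := φ.measurable_enorm.pow_const 2
  have m2 : Measurable fun x => ‖ψ x‖ₑ ^ 2 + ‖th ψ x‖ₑ ^ 2 := (ψ.measurable_enorm.pow_const 2).add ((th ψ).measurable_enorm.pow_const 2)
  have m3 : Measurable fun p : Space n × ℝ => (fun x => ‖ψ x‖ₑ ^ 2 + ‖th ψ x‖ₑ ^ 2)
      (p.1 + p.2 • thetaDir n) := m2.comp (by fun_prop)
  have m4 : Measurable fun x => (fun x => ‖φ x‖ₑ ^ 2) x *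
      ∫⁻ s : ℝ, (fun x => ‖ψ x‖ₑ ^ 2 + ‖th ψ x‖ₑ ^ 2) (x + s • thetaDir n) :=
    m1.mul m3.lintegral_prod_right'
  calc ∫⁻ x, ‖fp h φ ψ x‖ₑ ^ 2
      ≤ ENNReal.ofReal (|δ₃⁻¹| * Real.pi) *
        ∫⁻ x, ∫⁻ X : ℝ, (fun x => ‖φ x‖ₑ ^ 2) (x + (δ₁ * X) • thetaDir n) *
        (fun x => ‖ψ x‖ₑ ^ 2 + ‖th ψ x‖ₑ ^ 2) (x + (δ₃ * X) • thetaDir n) := by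
        rw [← lintegral_const_mul' _ _ ENNReal.ofReal_ne_top]
        exact lintegral_mono fun x => enorm_sq_fp_le h h₃ φ ψ x
    _ = ENNReal.ofReal (|δ₃⁻¹| * Real.pi) * (ENNReal.ofReal |(δ₃ - δ₁)⁻¹| *
          ∫⁻ y, φ.sq2 y *
            lmarginal (fun _ => volume) {Fin.last n} (ψ.sq2 + (th ψ).sq2) y) := by
        rw [lintegral_lintegral_line h m1 m2, ← lintegral_toLp _ m4]
        exact congrArg _ (congrArg _ (lintegral_congr fun y => congrArg _
          (lintegral_line_eq_lmarginal (g := fun x => ‖ψ x‖ₑ ^ 2 + ‖th ψ x‖ₑ ^ 2) y)))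
    _ ≤ ENNReal.ofReal (|δ₃⁻¹| * Real.pi) * (ENNReal.ofReal |(δ₃ - δ₁)⁻¹| *
          (ENNReal.ofReal (nrm i φ) ^ 2 * ENNReal.ofReal (nrm j ψ) ^ 2)) := by
        gcongr
        refine (lintegral_mono fun y => mul_le_mul' (hφ y) (hP y)).trans ?_
        rw [lintegral_lmarginal_mul_lmarginal hF hG]
        exact mul_le_mul' (hFn.trans (ofReal_nrm_mono (by omega) φ)) hGn
    _ = _ := by rw [← mul_assoc, ← ENNReal.ofReal_mul (by positivity)]

/-- If nothing is available on the second factor, the roles are exchanged together with `δ₁` and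
`δ₃`, and the weight is put on the first. -/
theorem exists_norm_fp_le {δ₁ δ₃ : ℝ} (h : δ₁ ≠ δ₃) (h₁ : δ₁ ≠ 0) (h₃ : δ₃ ≠ 0) : ∃ C, 0 ≤ C ∧
    ∀ (i j : ℕ), n + 1 ≤ i + j → ∀ φ ψ : Test n,
      ‖toL2 (fp h φ ψ)‖ ≤ C * (nrm i φ * nrm j ψ) := by
  obtain ⟨C, hC, H⟩ := exists_norm_fp_le_of_pos (n := n) h h₃
  obtain ⟨C', hC', H'⟩ := exists_norm_fp_le_of_pos (n := n) h.symm h₁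
  refine ⟨max C C', le_max_of_le_left hC, fun i j hij φ ψ => ?_⟩
  have hp : 0 ≤ nrm i φ * nrm j ψ := mul_nonneg (apply_nonneg _ _) (apply_nonneg _ _)
  rcases Nat.eq_zero_or_pos j with hj | hj
  · rw [fp_swap]
    refine (H' j i (by omega) (by omega) ψ φ).trans ?_
    rw [mul_comm (nrm j ψ)]
    exact mul_le_mul_of_nonneg_right (le_max_right _ _) hp
  · exact (H i j hj hij φ ψ).trans (mul_le_mul_of_nonneg_right (le_max_left _ _) hp)

end Test

end

end MachStem

/-! ### Higher order bilinear estimates from Leibniz rules. -/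

namespace MachStem

noncomputable section

variable {n : ℕ}

namespace Test

/-- `nrm m` of a bilinear operator is bounded by `nrm i` and `nrm j` of its arguments. -/
def BilinBound (m i j : ℕ) (B : Test n →ₗ[ℝ] Test n →ₗ[ℝ] Test n) : Prop :=
  ∃ C, 0 ≤ C ∧ ∀ φ ψ, nrm m (B φ ψ) ≤ C * (nrm i φ * nrm j ψ)

/-- The operators obtained from those in `𝓕` by at most one first order operator in an argument. -/
def prolongation (𝓕 : Set (Test n →ₗ[ℝ] Test n →ₗ[ℝ] Test n)) :
    Set (Test n →ₗ[ℝ] Test n →ₗ[ℝ] Test n) :=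
  {A | A ∈ 𝓕 ∨ (∃ B ∈ 𝓕, ∃ l, A = B.comp (op l)) ∨ ∃ B ∈ 𝓕, ∃ l, A = B.compl₂ (op l)}

theorem bilinBound_of_mem_span {m i j : ℕ} {𝓕 : Set (Test n →ₗ[ℝ] Test n →ₗ[ℝ] Test n)}
    (h : ∀ B ∈ 𝓕, BilinBound m i j B) {A : Test n →ₗ[ℝ] Test n →ₗ[ℝ] Test n}
    (hA : A ∈ Submodule.span ℝ 𝓕) : BilinBound m i j A := by
  induction hA using Submodule.span_induction with
  | mem B hB => exact h B hB
  | zero => exact ⟨0, le_rfl, fun φ ψ => by simp⟩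
  | add A B _ _ hA hB =>
    obtain ⟨C, hC, H⟩ := hA
    obtain ⟨C', hC', H'⟩ := hB
    refine ⟨C + C', add_nonneg hC hC', fun φ ψ => ?_⟩
    rw [LinearMap.add_apply, LinearMap.add_apply, add_mul]
    exact (map_add_le_add _ _ _).trans (add_le_add (H φ ψ) (H' φ ψ))
  | smul c A _ hA =>
    obtain ⟨C, hC, H⟩ := hA
    refine ⟨|c| * C, by positivity, fun φ ψ => ?_⟩
    rw [LinearMap.smul_apply, LinearMap.smul_apply, map_smul_eq_mul, mul_assoc]
    exact mul_le_mul_of_nonneg_left (H φ ψ) (abs_nonneg _)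

/-- An abstract Leibniz induction. A first order operator applied to the output is distributed over
the arguments within the family, so each unit of `m` consumes at most one unit of `i` or of `j`. The
conditions `m ≤ i` and `m ≤ j` cover the case where everything falls on one argument. -/
theorem bilinBound_of_closed {𝓕 : Set (Test n →ₗ[ℝ] Test n →ₗ[ℝ] Test n)} {p : ℕ}
    (hcl : ∀ B ∈ 𝓕, ∀ l, B.compr₂ (op l) ∈ Submodule.span ℝ (prolongation 𝓕))
    (h0 : ∀ B ∈ 𝓕, ∀ i j, p ≤ i + j → BilinBound 0 i j B) (m : ℕ) :
    ∀ B ∈ 𝓕, ∀ i j, m ≤ i → m ≤ j → m + p ≤ i + j → BilinBound m i j B := by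
  induction m with
  | zero => exact fun B hB i j _ _ h => h0 B hB i j (by omega)
  | succ m ih =>
    intro B hB i j hi hj hij
    have key : ∀ l, BilinBound m i j (B.compr₂ (op l)) := by
      intro l
      refine bilinBound_of_mem_span ?_ (hcl B hB l)
      rintro A (hA | ⟨B', hB', l', rfl⟩ | ⟨B', hB', l', rfl⟩)
      · exact ih A hA i j (by omega) (by omega) (by omega)
      · obtain ⟨C, hC, H⟩ := ih B' hB' (i - 1) j (by omega) (by omega) (by omega)
        refine ⟨C, hC, fun φ ψ => (H (op l' φ) ψ).trans ?_⟩
        have := nrm_op_le_succ (i - 1) l' φ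
        rw [Nat.sub_add_cancel (by omega)] at this
        exact mul_le_mul_of_nonneg_left
          (mul_le_mul_of_nonneg_right this (apply_nonneg _ _)) hC
      · obtain ⟨C, hC, H⟩ := ih B' hB' i (j - 1) (by omega) (by omega) (by omega)
        refine ⟨C, hC, fun φ ψ => (H φ (op l' ψ)).trans ?_⟩
        have := nrm_op_le_succ (j - 1) l' ψ
        rw [Nat.sub_add_cancel (by omega)] at this
        exact mul_le_mul_of_nonneg_left
          (mul_le_mul_of_nonneg_left this (apply_nonneg _ _)) hC
    choose C hC H using key
    obtain ⟨C', hC', H'⟩ := ih B hB i j (by omega) (by omega) (by omega)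
    refine ⟨C' + ∑ l, C l, add_nonneg hC' (Finset.sum_nonneg fun l _ => hC l), fun φ ψ => ?_⟩
    rw [nrm_succ, add_mul, Finset.sum_mul]
    exact add_le_add (H' φ ψ) (Finset.sum_le_sum fun l _ => H l φ ψ)

/-- The pointwise product as a bilinear map. -/
def mulₗ : Test n →ₗ[ℝ] Test n →ₗ[ℝ] Test n :=
  LinearMap.mk₂ ℝ mul (fun _ _ _ => ext' fun _ => add_mul _ _ _)
    (fun _ _ _ => ext' fun _ => mul_assoc _ _ _) (fun _ _ _ => ext' fun _ => mul_add _ _ _)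
    (fun _ _ _ => ext' fun _ => mul_left_comm _ _ _)

@[simp] theorem mulₗ_apply (φ ψ : Test n) : mulₗ φ ψ = mul φ ψ := rfl

/-- The algebra estimate. -/
theorem exists_nrm_mul_le {m i j : ℕ} (hi : m ≤ i) (hj : m ≤ j) (h : m + (n + 1) ≤ i + j) :
    BilinBound m i j (mulₗ : Test n →ₗ[ℝ] _) := by
  refine bilinBound_of_closed (𝓕 := {mulₗ}) (p := n + 1) ?_ ?_ m mulₗ rfl i j hi hj h
  · rintro B rfl l
    have h1 : ∀ l, (mulₗ : Test n →ₗ[ℝ] _).comp (op l) ∈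
        Submodule.span ℝ (prolongation {mulₗ}) := fun l =>
      Submodule.subset_span (Or.inr (Or.inl ⟨_, rfl, l, rfl⟩))
    have h2 : ∀ l, (mulₗ : Test n →ₗ[ℝ] _).compl₂ (op l) ∈
        Submodule.span ℝ (prolongation {mulₗ}) := fun l =>
      Submodule.subset_span (Or.inr (Or.inr ⟨_, rfl, l, rfl⟩))
    cases l with
    | none =>
      convert h1 none using 1
      exact LinearMap.ext₂ fun φ ψ => th_mul φ ψ
    | some i =>
      convert Submodule.add_mem _ (h1 (some i)) (h2 (some i)) using 1
      exact LinearMap.ext₂ fun φ ψ => d_mul i φ ψ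
  · rintro B rfl i j hij
    refine ⟨1, zero_le_one, fun φ ψ => ?_⟩
    rw [one_mul]
    exact norm_mul_le hij φ ψ

theorem th_d (i : Fin (n + 1)) (φ : Test n) :
    th (d i φ) = d i (th φ) - (if i = Fin.last n then (1 : ℝ) else 0) • φ := by
  rw [d_th]
  split_ifs <;> simp

theorem nrm_pow_d_le (i j a : ℕ) (l : Fin (n + 1)) (h : i + a ≤ j) (φ : Test n) :
    nrm i ((d l ^ a : Module.End ℝ (Test n)) φ) ≤ nrm j φ := by
  induction a generalizing i with
  | zero => exact nrm_mono h φ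
  | succ a ih =>
    rw [pow_succ', Module.End.mul_apply]
    exact (nrm_d_le _ _ _).trans (ih (i + 1) (by omega))

/-- The bilinear operator `fp`, with its arguments differentiated in the direction of `θ`. -/
def fpd {δ₁ δ₃ : ℝ} (h : δ₁ ≠ δ₃) (a b : ℕ) : Test n →ₗ[ℝ] Test n →ₗ[ℝ] Test n :=
  (fp h).compl₁₂ (d (Fin.last n) ^ a : Module.End ℝ (Test n))
    (d (Fin.last n) ^ b : Module.End ℝ (Test n))

theorem fpd_apply {δ₁ δ₃ : ℝ} (h : δ₁ ≠ δ₃) (a b : ℕ) (φ ψ : Test n) :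
    fpd h a b φ ψ = fp h ((d (Fin.last n) ^ a : Module.End ℝ (Test n)) φ)
      ((d (Fin.last n) ^ b : Module.End ℝ (Test n)) ψ) := rfl

theorem fpd_swap {δ₁ δ₃ : ℝ} (h : δ₁ ≠ δ₃) (a b : ℕ) (φ ψ : Test n) :
    fpd h a b φ ψ = fpd h.symm b a ψ φ := fp_swap h _ _

/-- The critical case: `φ` is only measured in `L²` although it is differentiated. The derivative is
moved to the other factor by `fp_d_last`. There it may meet a second one, so `n + 1` plus two
operators are needed. -/
theorem exists_norm_fpd_le_left {δ₁ δ₃ : ℝ} (h : δ₁ ≠ δ₃) (h₁ : δ₁ ≠ 0) (h₃ : δ₃ ≠ 0)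
    {b j : ℕ} (hb : b ≤ 1) (hj : n + 3 ≤ j) :
    BilinBound 0 0 j (fpd h 1 b : Test n →ₗ[ℝ] _) := by
  obtain ⟨C, hC, H⟩ := exists_norm_fp_le (n := n) h h₁ h₃
  refine ⟨|δ₁|⁻¹ * (1 + |δ₃| * C), by positivity, fun φ ψ => ?_⟩
  set χ := (d (Fin.last n) ^ b : Module.End ℝ (Test n)) ψ with hχ
  have e : fpd h 1 b φ ψ = δ₁⁻¹ • (-mul φ χ - δ₃ • fp h φ (d (Fin.last n) χ)) := by
    rw [← fp_d_last h, add_sub_cancel_right, inv_smul_smul₀ h₁, fpd_apply, pow_one]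
  have h2 : nrm (n + 1) χ ≤ nrm j ψ := nrm_pow_d_le _ _ _ _ (by omega) ψ
  have h3 : nrm (n + 1) (d (Fin.last n) χ) ≤ nrm j ψ :=
    (nrm_d_le _ _ _).trans (nrm_pow_d_le _ _ _ _ (by omega) ψ)
  have hφ : 0 ≤ nrm 0 φ := apply_nonneg _ _
  have h4 : ‖toL2 (mul φ χ)‖ ≤ nrm 0 φ * nrm j ψ :=
    (norm_mul_le (by omega) φ χ).trans (mul_le_mul_of_nonneg_left h2 hφ)
  have h5 : ‖toL2 (fp h φ (d (Fin.last n) χ))‖ ≤ C * (nrm 0 φ * nrm j ψ) :=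
    (H 0 (n + 1) (by omega) φ _).trans
      (mul_le_mul_of_nonneg_left (mul_le_mul_of_nonneg_left h3 hφ) hC)
  rw [e, nrm_zero, map_smul, map_sub, map_neg, map_smul, norm_smul, norm_inv, mul_assoc,
    Real.norm_eq_abs]
  refine mul_le_mul_of_nonneg_left ((norm_sub_le _ _).trans ?_) (by positivity)
  rw [norm_neg, norm_smul, Real.norm_eq_abs, add_mul, one_mul, mul_assoc]
  exact add_le_add h4 (mul_le_mul_of_nonneg_left h5 (abs_nonneg _))

/-- If both arguments have room for their own derivative, the bound for `fp` applies directly.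
Otherwise one argument is in the critical case, possibly after exchanging them. -/
theorem exists_norm_fpd_le {δ₁ δ₃ : ℝ} (h : δ₁ ≠ δ₃) (h₁ : δ₁ ≠ 0) (h₃ : δ₃ ≠ 0)
    {a b i j : ℕ} (ha : a ≤ 1) (hb : b ≤ 1) (hij : n + 3 ≤ i + j) :
    BilinBound 0 i j (fpd h a b : Test n →ₗ[ℝ] _) := by
  rcases lt_or_ge i a with hi | hi
  · obtain ⟨rfl, rfl⟩ : i = 0 ∧ a = 1 := by omega
    exact exists_norm_fpd_le_left h h₁ h₃ hb (by omega)
  rcases lt_or_ge j b with hj | hj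
  · obtain ⟨rfl, rfl⟩ : j = 0 ∧ b = 1 := by omega
    obtain ⟨C, hC, H⟩ := exists_norm_fpd_le_left (n := n) h.symm h₃ h₁ ha (j := i) (by omega)
    refine ⟨C, hC, fun φ ψ => ?_⟩
    rw [fpd_swap, mul_comm (nrm i φ)]
    exact H ψ φ
  obtain ⟨C, hC, H⟩ := exists_norm_fp_le (n := n) h h₁ h₃
  refine ⟨C, hC, fun φ ψ => (H (i - a) (j - b) (by omega) _ _).trans ?_⟩
  exact mul_le_mul_of_nonneg_left (mul_le_mul (nrm_pow_d_le _ _ _ _ (by omega) φ)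
    (nrm_pow_d_le _ _ _ _ (by omega) ψ) (apply_nonneg _ _) (apply_nonneg _ _)) hC

theorem d_fpd {δ₁ δ₃ : ℝ} (h : δ₁ ≠ δ₃) (a b : ℕ) (i : Fin (n + 1)) (φ ψ : Test n) :
    d i (fpd h a b φ ψ) = fpd h a b (d i φ) ψ + fpd h a b φ (d i ψ) := by
  have hc : ∀ (c : ℕ) (χ : Test n), d i ((d (Fin.last n) ^ c : Module.End ℝ (Test n)) χ) =
      (d (Fin.last n) ^ c : Module.End ℝ (Test n)) (d i χ) := fun c χ =>
    LinearMap.congr_fun ((d_comm i (Fin.last n)).pow_right c).eq χ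
  simp only [fpd_apply]
  rw [d_fp, hc, hc]

theorem th_pow_d {c : ℕ} (hc : c ≤ 1) (χ : Test n) :
    th ((d (Fin.last n) ^ c : Module.End ℝ (Test n)) χ) =
      (d (Fin.last n) ^ c : Module.End ℝ (Test n)) (th χ) - (c : ℝ) • χ := by
  interval_cases c
  · simp
  · simp [th_d]

theorem th_fpd {δ₁ δ₃ : ℝ} (h : δ₁ ≠ δ₃) {a b : ℕ} (ha : a ≤ 1) (hb : b ≤ 1) (φ ψ : Test n) :
    th (fpd h a b φ ψ) =
      ((δ₃ - δ₁)⁻¹ * δ₃) • fpd h a b (th φ) ψ + (-((δ₃ - δ₁)⁻¹ * δ₃ * a)) • fpd h 0 b φ ψ +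
      ((-((δ₃ - δ₁)⁻¹ * δ₁)) • fpd h a b φ (th ψ) +
        ((δ₃ - δ₁)⁻¹ * δ₁ * b) • fpd h a 0 φ ψ) := by
  have hs : δ₃ - δ₁ ≠ 0 := sub_ne_zero.2 h.symm
  have e : th (fpd h a b φ ψ) = (δ₃ - δ₁)⁻¹ •
      (δ₃ • (fpd h a b (th φ) ψ - (a : ℝ) • fpd h 0 b φ ψ) -
        δ₁ • (fpd h a b φ (th ψ) - (b : ℝ) • fpd h a 0 φ ψ)) := by
    rw [eq_inv_smul_iff₀ hs, fpd_apply, th_fp, th_pow_d ha, th_pow_d hb, map_sub, map_sub,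
      LinearMap.sub_apply, map_smul, map_smul, LinearMap.smul_apply]
    rfl
  rw [e]
  module

/-- The estimate of the nonlocal term. -/
theorem exists_nrm_fpd_le {δ₁ δ₃ : ℝ} (h : δ₁ ≠ δ₃) (h₁ : δ₁ ≠ 0) (h₃ : δ₃ ≠ 0)
    {m i j : ℕ} (hi : m ≤ i) (hj : m ≤ j) (hij : m + (n + 3) ≤ i + j) :
    BilinBound m i j (fpd h 1 1 : Test n →ₗ[ℝ] _) := by
  -- The operators with fewer `θ`-derivatives must be included: commuting `θ` with such a derivative
  -- removes it, and the family has to be closed under this.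
  set 𝓕 : Set (Test n →ₗ[ℝ] Test n →ₗ[ℝ] Test n) :=
    {A | ∃ a b, a ≤ 1 ∧ b ≤ 1 ∧ A = fpd h a b} with h𝓕
  refine bilinBound_of_closed (𝓕 := 𝓕) (p := n + 3) ?_ ?_ m _ ⟨1, 1, le_rfl, le_rfl, rfl⟩ i j
    hi hj hij
  · rintro _ ⟨a, b, ha, hb, rfl⟩ l
    have m0 : ∀ a b, a ≤ 1 → b ≤ 1 → fpd h a b ∈ Submodule.span ℝ (prolongation 𝓕) :=
      fun a b ha hb => Submodule.subset_span (Or.inl ⟨a, b, ha, hb, rfl⟩)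
    have m1 : ∀ l, (fpd h a b).comp (op l) ∈ Submodule.span ℝ (prolongation 𝓕) := fun l =>
      Submodule.subset_span (Or.inr (Or.inl ⟨_, ⟨a, b, ha, hb, rfl⟩, l, rfl⟩))
    have m2 : ∀ l, (fpd h a b).compl₂ (op l) ∈ Submodule.span ℝ (prolongation 𝓕) := fun l =>
      Submodule.subset_span (Or.inr (Or.inr ⟨_, ⟨a, b, ha, hb, rfl⟩, l, rfl⟩))
    cases l with
    | some i =>
      have e : (fpd h a b).compr₂ (op (some i)) =
          (fpd h a b).comp (op (some i)) + (fpd h a b).compl₂ (op (some i)) :=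
        LinearMap.ext₂ fun φ ψ => d_fpd h a b i φ ψ
      rw [e]
      exact Submodule.add_mem _ (m1 (some i)) (m2 (some i))
    | none =>
      have e : (fpd (n := n) h a b).compr₂ (op none) =
          ((δ₃ - δ₁)⁻¹ * δ₃) • (fpd (n := n) h a b).comp (op none) +
            (-((δ₃ - δ₁)⁻¹ * δ₃ * a)) • fpd (n := n) h 0 b +
          ((-((δ₃ - δ₁)⁻¹ * δ₁)) • (fpd (n := n) h a b).compl₂ (op none) +
            ((δ₃ - δ₁)⁻¹ * δ₁ * b) • fpd (n := n) h a 0) :=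
        LinearMap.ext₂ fun φ ψ => th_fpd h ha hb φ ψ
      rw [e]
      exact Submodule.add_mem _
        (Submodule.add_mem _ (Submodule.smul_mem _ _ (m1 none))
          (Submodule.smul_mem _ _ (m0 0 b zero_le_one hb)))
        (Submodule.add_mem _ (Submodule.smul_mem _ _ (m2 none))
          (Submodule.smul_mem _ _ (m0 a 0 ha zero_le_one)))
  · rintro _ ⟨a, b, ha, hb, rfl⟩ i j hij
    exact exists_norm_fpd_le h h₁ h₃ ha hb hij

end Test

end

end MachStem

/-! ### Translations and symmetric difference quotients. -/

namespace MachStem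

noncomputable section

variable {n : ℕ}

namespace Test

/-- The translation `φ ↦ φ(· + v)`. -/
def tr (v : Space n) : Test n →ₗ[ℝ] Test n where
  toFun φ := ⟨fun x => φ (x + v), φ.contDiff.comp (by fun_prop),
    φ.hasCompactSupport.comp_homeomorph (Homeomorph.addRight v)⟩
  map_add' _ _ := rfl
  map_smul' _ _ := rfl

theorem tr_apply (v : Space n) (φ : Test n) (x : Space n) : tr v φ x = φ (x + v) := rfl

theorem d_tr (i : Fin (n + 1)) (v : Space n) (φ : Test n) : d i (tr v φ) = tr v (d i φ) := by
  refine ext' fun x => ?_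
  rw [d_apply, tr_apply, d_apply, ← fderiv_comp_add_right]
  rfl

theorem th_tr (v : Space n) (φ : Test n) :
    th (tr v φ) = tr v (th φ) - v (Fin.last n) • tr v φ := by
  refine ext' fun x => ?_
  simp only [sub_apply, smul_apply, th_apply, tr_apply, PiLp.add_apply]
  ring

theorem tr_tr (v w : Space n) (φ : Test n) : tr v (tr w φ) = tr (v + w) φ :=
  ext' fun x => by simp only [tr_apply, add_assoc]

theorem tr_zero (φ : Test n) : tr 0 φ = φ := ext' fun x => by rw [tr_apply, add_zero]

theorem inner_tr_tr (v : Space n) (φ ψ : Test n) :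
    inner ℝ (toL2 (tr v φ)) (toL2 (tr v ψ)) = inner ℝ (toL2 φ) (toL2 ψ) := by
  rw [inner_toL2_toL2, inner_toL2_toL2]
  exact integral_add_right_eq_self (fun x => φ x * ψ x) v

theorem inner_tr (v : Space n) (φ ψ : Test n) :
    inner ℝ (toL2 (tr v φ)) (toL2 ψ) = inner ℝ (toL2 φ) (toL2 (tr (-v) ψ)) := by
  rw [← inner_tr_tr (-v) (tr v φ), tr_tr, neg_add_cancel, tr_zero]

theorem norm_toL2_tr (v : Space n) (φ : Test n) : ‖toL2 (tr v φ)‖ = ‖toL2 φ‖ := by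
  rw [norm_eq_sqrt_real_inner, inner_tr_tr, ← norm_eq_sqrt_real_inner]

/-- The derivative in the direction `v`. -/
def dv (v : Space n) : Test n →ₗ[ℝ] Test n := ∑ i, v i • d i

theorem dv_eq_sum (v : Space n) (φ : Test n) : dv v φ = ∑ i, v i • d i φ := by
  simp [dv]

theorem dv_apply (v : Space n) (φ : Test n) (x : Space n) : dv v φ x = fderiv ℝ φ x v := by
  have e : ∀ s : Finset (Fin (n + 1)), (∑ i ∈ s, v i • d i φ : Test n) x =
      ∑ i ∈ s, v i * d i φ x := by
    intro s
    induction s using Finset.induction_on with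
    | empty => simp
    | insert a s ha ih => rw [Finset.sum_insert ha, Finset.sum_insert ha, ← ih]; rfl
  have h := (EuclideanSpace.basisFun (Fin (n + 1)) ℝ).sum_repr v
  conv_rhs => rw [← h]
  rw [dv_eq_sum, e, map_sum]
  simp [d_apply]

theorem dv_smul (r : ℝ) (v : Space n) (φ : Test n) : dv (r • v) φ = r • dv v φ := by
  refine ext' fun x => ?_
  simp [dv_apply]

/-- The `ℓ¹` norm of a vector. -/
def oneNorm (v : Space n) : ℝ := ∑ i, |v i|

theorem oneNorm_nonneg (v : Space n) : 0 ≤ oneNorm v := Finset.sum_nonneg fun _ _ => abs_nonneg _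

theorem abs_last_le_oneNorm (v : Space n) : |v (Fin.last n)| ≤ oneNorm v :=
  Finset.single_le_sum (f := fun i => |v i|) (fun _ _ => abs_nonneg _) (Finset.mem_univ _)

theorem oneNorm_smul (r : ℝ) (v : Space n) : oneNorm (r • v) = |r| * oneNorm v := by
  simp [oneNorm, abs_mul, Finset.mul_sum]

theorem nrm_dv_le (j : ℕ) (v : Space n) (φ : Test n) :
    nrm j (dv v φ) ≤ oneNorm v * nrm (j + 1) φ := by
  have h : ∀ s : Finset (Fin (n + 1)), nrm j (∑ i ∈ s, v i • d i φ) ≤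
      (∑ i ∈ s, |v i|) * nrm (j + 1) φ := by
    intro s
    induction s using Finset.induction_on with
    | empty => simp
    | insert a s ha ih =>
      rw [Finset.sum_insert ha, Finset.sum_insert ha, add_mul]
      refine (map_add_le_add _ _ _).trans (add_le_add ?_ ih)
      rw [map_smul_eq_mul]
      exact mul_le_mul_of_nonneg_left (nrm_d_le _ _ _) (abs_nonneg _)
  rw [dv_eq_sum]
  exact h _

/-- Minkowski's inequality for a mean over the unit interval, by Cauchy–Schwarz and Tonelli; it
turns Taylor's formula into `L²` bounds. -/
theorem norm_toL2_le_of_le_lintegral {f : Test n} {Φ : ℝ → Test n} {M : ℝ} (hM : 0 ≤ M)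
    (hΦ : Continuous fun p : Space n × ℝ => Φ p.2 p.1)
    (hf : ∀ x, ‖f x‖ₑ ≤ ∫⁻ s in Set.Icc (0 : ℝ) 1, ‖Φ s x‖ₑ)
    (h : ∀ s ∈ Set.Icc (0 : ℝ) 1, ‖toL2 (Φ s)‖ ≤ M) : ‖toL2 f‖ ≤ M := by
  have hs : ∀ s ∈ Set.Icc (0 : ℝ) 1, ∫⁻ x, ‖Φ s x‖ₑ ^ 2 ≤ ENNReal.ofReal M ^ 2 := by
    intro s hs
    rw [← enorm_toL2_sq, ← ofReal_norm]
    exact pow_le_pow_left₀ zero_le (ENNReal.ofReal_le_ofReal (h s hs)) 2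
  have hm : Measurable fun p : Space n × ℝ => ‖Φ p.2 p.1‖ₑ ^ 2 :=
    hΦ.measurable.enorm.pow_const 2
  have key : ‖toL2 f‖ₑ ^ 2 ≤ ENNReal.ofReal M ^ 2 := by
    rw [enorm_toL2_sq]
    calc ∫⁻ x, ‖f x‖ₑ ^ 2 ≤ ∫⁻ x, ∫⁻ s in Set.Icc (0 : ℝ) 1, ‖Φ s x‖ₑ ^ 2 := by
          refine lintegral_mono fun x => (pow_le_pow_left₀ zero_le (hf x) 2).trans ?_
          have h1 := lintegral_mul_sq_le (μ := volume.restrict (Set.Icc (0 : ℝ) 1))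
            (f := fun _ => 1) (g := fun s => ‖Φ s x‖ₑ) aemeasurable_const
            (hΦ.measurable.enorm.comp measurable_prodMk_left).aemeasurable
          simpa using h1
      _ = ∫⁻ s in Set.Icc (0 : ℝ) 1, ∫⁻ x, ‖Φ s x‖ₑ ^ 2 :=
          lintegral_lintegral_swap hm.aemeasurable
      _ ≤ ∫⁻ s in Set.Icc (0 : ℝ) 1, ENNReal.ofReal M ^ 2 :=
          setLIntegral_mono measurable_const hs
      _ = ENNReal.ofReal M ^ 2 := by simp
  rw [← ofReal_norm, ← ENNReal.ofReal_pow (norm_nonneg _), ← ENNReal.ofReal_pow hM,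
    ENNReal.ofReal_le_ofReal_iff (by positivity)] at key
  exact (sq_le_sq₀ (norm_nonneg _) hM).1 key

theorem continuous_tr (v : Space n) (φ : Test n) :
    Continuous fun p : Space n × ℝ => tr (p.2 • v) φ p.1 :=
  φ.continuous.comp (by fun_prop : Continuous fun p : Space n × ℝ => p.1 + p.2 • v)

theorem enorm_le_lintegral_of_hasDerivAt {g g' : ℝ → ℝ} (hg : ∀ s, HasDerivAt g (g' s) s)
    (hg' : Continuous g') : ‖g 1 - g 0‖ₑ ≤ ∫⁻ s in Set.Icc (0 : ℝ) 1, ‖g' s‖ₑ := by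
  rw [← intervalIntegral.integral_eq_sub_of_hasDerivAt (fun s _ => hg s)
    (hg'.intervalIntegrable _ _), intervalIntegral.integral_of_le zero_le_one]
  refine (enorm_integral_le_lintegral_enorm _).trans ?_
  exact lintegral_mono' (Measure.restrict_mono Set.Ioc_subset_Icc_self le_rfl) le_rfl

theorem norm_tr_sub_le (v : Space n) (φ : Test n) :
    ‖toL2 (tr v φ - φ)‖ ≤ ‖toL2 (dv v φ)‖ := by
  refine norm_toL2_le_of_le_lintegral (Φ := fun s => tr (s • v) (dv v φ)) (norm_nonneg _)
    (continuous_tr v _) (fun x => ?_) fun s _ => (norm_toL2_tr _ _).le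
  have h := enorm_le_lintegral_of_hasDerivAt (fun s => φ.hasDerivAt_line x v s)
    (g' := fun s => fderiv ℝ φ (x + s • v) v) (by
      simp only [← dv_apply]
      exact (dv v φ).continuous.comp (by fun_prop))
  simp only [one_smul, zero_smul, add_zero] at h
  simp only [tr_apply, dv_apply, sub_apply]
  exact h

theorem norm_tr_sub_sub_le (v : Space n) (φ : Test n) :
    ‖toL2 (tr v φ - φ - dv v φ)‖ ≤ ‖toL2 (dv v (dv v φ))‖ := by
  refine norm_toL2_le_of_le_lintegral (Φ := fun s => tr (s • v) (dv v φ) - dv v φ)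
    (norm_nonneg _) ?_ (fun x => ?_) fun s hs => ?_
  · exact (continuous_tr v _).sub ((dv v φ).continuous.comp continuous_fst)
  · have h := enorm_le_lintegral_of_hasDerivAt (g := fun s => φ (x + s • v) - s * dv v φ x)
      (g' := fun s => fderiv ℝ φ (x + s • v) v - dv v φ x)
      (fun s => (φ.hasDerivAt_line x v s).sub (hasDerivAt_mul_const _)) (by
      simp only [← dv_apply]
      exact ((dv v φ).continuous.comp (by fun_prop)).sub continuous_const)
    simp only [one_smul, zero_smul, add_zero, one_mul, zero_mul, sub_zero] at h
    simp only [tr_apply, dv_apply, sub_apply] at h ⊢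
    rwa [sub_right_comm]
  · refine (norm_tr_sub_le _ _).trans ?_
    rw [dv_smul, map_smul, norm_smul, Real.norm_eq_abs, abs_of_nonneg hs.1]
    exact mul_le_of_le_one_left (norm_nonneg _) hs.2

/-- Translations are isometries of `L²` but do not commute with `θ`: the commutator is `v_θ` times a
translation. Each order may therefore double the constant. -/
theorem nrm_tr_le {v : Space n} (hv : |v (Fin.last n)| ≤ 1) (j : ℕ) (φ : Test n) :
    nrm j (tr v φ) ≤ 2 ^ j * nrm j φ := by
  induction j generalizing φ with
  | zero => rw [nrm_zero, nrm_zero, norm_toL2_tr, pow_zero, one_mul]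
  | succ j ih =>
    have h1 : nrm j (th (tr v φ)) ≤ 2 ^ j * nrm j (th φ) + 2 ^ j * nrm j φ := by
      rw [th_tr]
      refine (map_sub_le_add _ _ _).trans (add_le_add (ih _) ?_)
      rw [map_smul_eq_mul]
      exact (mul_le_of_le_one_left (apply_nonneg _ _) hv).trans (ih _)
    have h2 : ∑ i, nrm j (d i (tr v φ)) ≤ 2 ^ j * ∑ i, nrm j (d i φ) := by
      rw [Finset.mul_sum]
      refine Finset.sum_le_sum fun i _ => ?_
      rw [d_tr]
      exact ih _
    have h3 := ih φ
    have h4 : 0 ≤ nrm j (th φ) := apply_nonneg _ _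
    have h5 : 0 ≤ ∑ i, nrm j (d i φ) := Finset.sum_nonneg fun _ _ => apply_nonneg _ _
    have h6 : (0 : ℝ) < 2 ^ j := by positivity
    rw [nrm_succ, nrm_succ, Fintype.sum_option, Fintype.sum_option, pow_succ]
    simp only [op_none, op_some]
    nlinarith

theorem nrm_tr_sub_le {v : Space n} (hv : |v (Fin.last n)| ≤ 1) (j : ℕ) (φ : Test n) :
    nrm j (tr v φ - φ) ≤ 2 ^ j * oneNorm v * nrm (j + 1) φ := by
  induction j generalizing φ with
  | zero =>
    rw [nrm_zero, pow_zero, one_mul]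
    exact (norm_tr_sub_le v φ).trans (nrm_dv_le 0 v φ)
  | succ j ih =>
    have h0 := oneNorm_nonneg v
    have h1 : nrm j (th (tr v φ - φ)) ≤ 2 ^ j * oneNorm v * nrm (j + 1) (th φ) +
        oneNorm v * (2 ^ j * nrm (j + 1) φ) := by
      rw [map_sub, th_tr, sub_right_comm]
      refine (map_sub_le_add _ _ _).trans (add_le_add (ih _) ?_)
      rw [map_smul_eq_mul]
      exact mul_le_mul (abs_last_le_oneNorm v) ((nrm_tr_le hv j φ).trans
        (mul_le_mul_of_nonneg_left (nrm_mono (Nat.le_succ j) φ) (by positivity)))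
        (apply_nonneg _ _) h0
    have h2 : ∑ i, nrm j (d i (tr v φ - φ)) ≤
        2 ^ j * oneNorm v * ∑ i, nrm (j + 1) (d i φ) := by
      rw [Finset.mul_sum]
      refine Finset.sum_le_sum fun i _ => ?_
      rw [map_sub, d_tr]
      exact ih _
    have h3 := ih φ
    have h4 : 0 ≤ 2 ^ j * oneNorm v * nrm (j + 1) (th φ) :=
      mul_nonneg (by positivity) (apply_nonneg _ _)
    have h5 : 0 ≤ 2 ^ j * oneNorm v * ∑ i, nrm (j + 1) (d i φ) :=
      mul_nonneg (by positivity) (Finset.sum_nonneg fun _ _ => apply_nonneg _ _)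
    rw [nrm_succ, nrm_succ (j + 1), Fintype.sum_option, Fintype.sum_option, pow_succ]
    simp only [op_none, op_some]
    nlinarith

/-- The symmetric difference quotient in the direction `v`. -/
def cdq (v : Space n) (h : ℝ) : Test n →ₗ[ℝ] Test n :=
  (2 * h)⁻¹ • (tr (h • v) - tr (-(h • v)))

/-- The mean of the two translations by `± h v`. -/
def avg (v : Space n) (h : ℝ) : Test n →ₗ[ℝ] Test n :=
  (2 : ℝ)⁻¹ • (tr (h • v) + tr (-(h • v)))

theorem cdq_eq (v : Space n) (h : ℝ) (φ : Test n) :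
    cdq v h φ = (2 * h)⁻¹ • (tr (h • v) φ - tr (-(h • v)) φ) := rfl

theorem avg_eq (v : Space n) (h : ℝ) (φ : Test n) :
    avg v h φ = (2 : ℝ)⁻¹ • (tr (h • v) φ + tr (-(h • v)) φ) := rfl

theorem d_cdq (i : Fin (n + 1)) (v : Space n) (h : ℝ) (φ : Test n) :
    d i (cdq v h φ) = cdq v h (d i φ) := by
  rw [cdq_eq, map_smul, map_sub, d_tr, d_tr]; rfl

theorem th_cdq (v : Space n) {h : ℝ} (hh : h ≠ 0) (φ : Test n) :
    th (cdq v h φ) = cdq v h (th φ) - v (Fin.last n) • avg v h φ := by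
  refine ext' fun x => ?_
  simp only [cdq_eq, avg_eq, map_smul, map_sub, th_tr, sub_apply, smul_apply, add_apply,
    PiLp.neg_apply, PiLp.smul_apply, smul_eq_mul]
  field_simp
  ring

theorem inner_cdq (v : Space n) (h : ℝ) (φ ψ : Test n) :
    inner ℝ (toL2 (cdq v h φ)) (toL2 ψ) = -inner ℝ (toL2 φ) (toL2 (cdq v h ψ)) := by
  simp only [cdq_eq, map_smul, map_sub, inner_smul_left, inner_smul_right, inner_sub_left,
    inner_sub_right, inner_tr, neg_neg, conj_trivial]
  ring

theorem abs_smul_last_le {v : Space n} (hv : |v (Fin.last n)| ≤ 1) {h : ℝ} (h0 : 0 < h)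
    (h1 : h ≤ 1) : |(h • v) (Fin.last n)| ≤ 1 ∧ |(-(h • v)) (Fin.last n)| ≤ 1 := by
  have : |(h • v) (Fin.last n)| ≤ 1 := by
    rw [PiLp.smul_apply, smul_eq_mul, abs_mul, abs_of_pos h0]
    exact mul_le_one₀ h1 (abs_nonneg _) hv
  exact ⟨this, by rwa [PiLp.neg_apply, abs_neg]⟩

theorem oneNorm_neg (v : Space n) : oneNorm (-v) = oneNorm v := by simp [oneNorm]

/-- Uniform in the step, at the price of one derivative; used for commutators. The companion
`nrm_cdq_le_inv` loses no derivative but a factor `h⁻¹`, and makes the regularised fields bounded on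
`Γ^k`. -/
theorem nrm_cdq_le {v : Space n} (hv : |v (Fin.last n)| ≤ 1) {h : ℝ} (h0 : 0 < h) (h1 : h ≤ 1)
    (j : ℕ) (φ : Test n) : nrm j (cdq v h φ) ≤ 2 ^ j * oneNorm v * nrm (j + 1) φ := by
  obtain ⟨a, b⟩ := abs_smul_last_le hv h0 h1
  have e1 := nrm_tr_sub_le a j φ
  have e2 := nrm_tr_sub_le b j φ
  rw [oneNorm_neg] at e2
  rw [oneNorm_smul, abs_of_pos h0] at e1 e2
  have e3 : cdq v h φ = (2 * h)⁻¹ • ((tr (h • v) φ - φ) - (tr (-(h • v)) φ - φ)) := by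
    rw [cdq_eq, sub_sub_sub_cancel_right]
  rw [e3, map_smul_eq_mul, Real.norm_eq_abs, abs_of_pos (by positivity),
    inv_mul_le_iff₀ (by positivity)]
  refine (map_sub_le_add _ _ _).trans ((add_le_add e1 e2).trans (le_of_eq ?_))
  ring

theorem nrm_cdq_le_inv {v : Space n} (hv : |v (Fin.last n)| ≤ 1) {h : ℝ} (h0 : 0 < h)
    (h1 : h ≤ 1) (j : ℕ) (φ : Test n) : nrm j (cdq v h φ) ≤ h⁻¹ * 2 ^ j * nrm j φ := by
  obtain ⟨a, b⟩ := abs_smul_last_le hv h0 h1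
  rw [cdq_eq, map_smul_eq_mul, Real.norm_eq_abs, abs_of_pos (by positivity),
    inv_mul_le_iff₀ (by positivity)]
  refine (map_sub_le_add _ _ _).trans ((add_le_add (nrm_tr_le a j φ) (nrm_tr_le b j φ)).trans
    (le_of_eq ?_))
  field_simp
  ring

theorem nrm_avg_le {v : Space n} (hv : |v (Fin.last n)| ≤ 1) {h : ℝ} (h0 : 0 < h) (h1 : h ≤ 1)
    (j : ℕ) (φ : Test n) : nrm j (avg v h φ) ≤ 2 ^ j * nrm j φ := by
  obtain ⟨a, b⟩ := abs_smul_last_le hv h0 h1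
  rw [avg_eq, map_smul_eq_mul, Real.norm_eq_abs, abs_of_pos (by positivity),
    inv_mul_le_iff₀ (by positivity), two_mul]
  exact (map_add_le_add _ _ _).trans (add_le_add (nrm_tr_le a j φ) (nrm_tr_le b j φ))

theorem norm_cdq_sub_dv_le (v : Space n) {h : ℝ} (h0 : 0 < h) (φ : Test n) :
    ‖toL2 (cdq v h φ - dv v φ)‖ ≤ h * (oneNorm v * (oneNorm v * nrm 2 φ)) := by
  have e1 : ‖toL2 (dv v (dv v φ))‖ ≤ oneNorm v * (oneNorm v * nrm 2 φ) :=
    (nrm_dv_le 0 v (dv v φ)).trans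
      (mul_le_mul_of_nonneg_left (nrm_dv_le 1 v φ) (oneNorm_nonneg v))
  have e2 : ∀ r : ℝ, |r| = h → ‖toL2 (tr (r • v) φ - φ - dv (r • v) φ)‖ ≤
      h * (h * (oneNorm v * (oneNorm v * nrm 2 φ))) := by
    intro r hr
    refine (norm_tr_sub_sub_le _ φ).trans ?_
    simp only [dv_smul, map_smul, norm_smul, Real.norm_eq_abs, hr]
    gcongr
  have e3 : cdq v h φ - dv v φ = (2 * h)⁻¹ •
      ((tr (h • v) φ - φ - dv (h • v) φ) - (tr ((-h) • v) φ - φ - dv ((-h) • v) φ)) := by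
    refine ext' fun x => ?_
    simp only [cdq_eq, dv_smul, sub_apply, smul_apply]
    rw [neg_smul]
    field_simp
    ring
  rw [e3, map_smul, map_sub, norm_smul, Real.norm_eq_abs, abs_of_pos (by positivity),
    inv_mul_le_iff₀ (by positivity)]
  refine (norm_sub_le _ _).trans ((add_le_add (e2 h (abs_of_pos h0))
    (e2 (-h) (by rw [abs_neg, abs_of_pos h0]))).trans (le_of_eq ?_))
  ring

theorem inner_mul_left (a φ ψ : Test n) :
    inner ℝ (toL2 (mul a φ)) (toL2 ψ) = inner ℝ (toL2 φ) (toL2 (mul a ψ)) := by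
  simp only [inner_toL2_toL2, mul_apply]
  congr 1
  funext x
  ring

/-- The difference quotient along `a` is antisymmetric up to a bounded operator. -/
theorem abs_inner_mul_cdq_le {v : Space n} (hv : |v (Fin.last n)| ≤ 1) {h : ℝ} (h0 : 0 < h)
    (h1 : h ≤ 1) (a e : Test n) :
    |inner ℝ (toL2 (mul a (cdq v h e))) (toL2 e)| ≤
      2 ^ (n + 1) * oneNorm v * nrm (n + 2) a * ‖toL2 e‖ ^ 2 := by
  obtain ⟨hp, hm⟩ := abs_smul_last_le hv h0 h1
  set x := inner ℝ (toL2 (mul a (cdq v h e))) (toL2 e) with hx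
  have e1 : mul a (cdq v h e) - cdq v h (mul a e) = -((2 * h)⁻¹ •
      (mul (tr (h • v) a - a) (tr (h • v) e) - mul (tr (-(h • v)) a - a) (tr (-(h • v)) e))) := by
    refine ext' fun y => ?_
    simp only [cdq_eq, neg_apply, sub_apply, smul_apply, mul_apply, tr_apply]
    ring
  -- Multiplication by `a` is symmetric and the quotient antisymmetric, so twice the quadratic form
  -- is that of their commutator.
  have e2 : 2 * x = inner ℝ (toL2 (mul a (cdq v h e) - cdq v h (mul a e))) (toL2 e) := by
    have e : inner ℝ (toL2 (mul a e)) (toL2 (cdq v h e)) = x := by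
      rw [inner_mul_left, real_inner_comm]
    rw [map_sub, inner_sub_left, inner_cdq, e]
    ring
  have e3 : ∀ w : Space n, |w (Fin.last n)| ≤ 1 → oneNorm w = h * oneNorm v →
      ‖toL2 (mul (tr w a - a) (tr w e))‖ ≤
        h * (2 ^ (n + 1) * oneNorm v * nrm (n + 2) a * ‖toL2 e‖) := by
    intro w hw hwv
    -- No derivative may fall on `e`; the increment of `a` then takes `n + 1` operators, and its
    -- smallness in `h` one more, hence `n + 2`.
    refine (norm_mul_le (i := n + 1) (j := 0) (by omega) _ _).trans ?_
    rw [nrm_zero, norm_toL2_tr]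
    refine (mul_le_mul_of_nonneg_right (nrm_tr_sub_le hw (n + 1) a) (norm_nonneg _)).trans
      (le_of_eq ?_)
    rw [hwv]
    ring
  have e4 : oneNorm (h • v) = h * oneNorm v := by rw [oneNorm_smul, abs_of_pos h0]
  have e5 : ‖toL2 (mul a (cdq v h e) - cdq v h (mul a e))‖ ≤
      2 ^ (n + 1) * oneNorm v * nrm (n + 2) a * ‖toL2 e‖ := by
    rw [e1, map_neg, norm_neg, map_smul, map_sub, norm_smul, Real.norm_eq_abs,
      abs_of_pos (by positivity), inv_mul_le_iff₀ (by positivity)]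
    refine (norm_sub_le _ _).trans ((add_le_add (e3 _ hp e4)
      (e3 _ hm (by rw [oneNorm_neg, e4]))).trans (le_of_eq ?_))
    ring
  have e6 : |2 * x| ≤ 2 ^ (n + 1) * oneNorm v * nrm (n + 2) a * ‖toL2 e‖ ^ 2 := by
    rw [e2]
    refine (abs_real_inner_le_norm _ _).trans
      ((mul_le_mul_of_nonneg_right e5 (norm_nonneg _)).trans (le_of_eq ?_))
    ring
  rw [abs_mul, abs_two] at e6
  linarith [abs_nonneg x]

end Test

end

end MachStem

/-! ### Commutators and energy estimates in `Γ^k`. -/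

namespace MachStem

noncomputable section

variable {n : ℕ}

namespace Test

/-- Products of `m` first order operators. -/
inductive IsWord : ℕ → Module.End ℝ (Test n) → Prop
  | one : IsWord 0 1
  | cons {m : ℕ} {W : Module.End ℝ (Test n)} (l : Option (Fin (n + 1))) :
      IsWord m W → IsWord (m + 1) (op l * W)

theorem isWord_D (β : Fin (n + 1) → ℕ) : IsWord (∑ i, β i) (D β) := by
  induction β using multiIndex_induction with
  | h0 => simpa [D_zero] using IsWord.one
  | hs β i ih =>
    rw [D_add_single, sum_add_single]
    exact ih.cons (some i)

theorem isWord_pow_th_mul {m : ℕ} {W : Module.End ℝ (Test n)} (h : IsWord m W) (α : ℕ) :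
    IsWord (α + m) ((th ^ α : Module.End ℝ (Test n)) * W) := by
  induction α with
  | zero => simpa using h
  | succ α ih =>
    rw [pow_succ', mul_assoc, Nat.succ_add]
    exact ih.cons none

theorem IsWord.nrm_le {m : ℕ} {W : Module.End ℝ (Test n)} (h : IsWord m W) {i j : ℕ}
    (hij : i + m ≤ j) (φ : Test n) : nrm i (W φ) ≤ nrm j φ := by
  induction h generalizing i with
  | one => exact nrm_mono hij φ
  | cons l _ ih => exact (nrm_op_le_succ _ _ _).trans (ih (by omega))

theorem op_mul_cdq (v : Space n) {h : ℝ} (hh : h ≠ 0) (l : Option (Fin (n + 1))) (a b : Test n) :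
    op l (mul a (cdq v h b)) - mul a (cdq v h (op l b)) =
      match l with
      | none => -(v (Fin.last n) • mul a (avg v h b))
      | some i => mul (d i a) (cdq v h b) := by
  cases l with
  | none =>
    simp only [op_none]
    rw [mul_comm' a, th_mul, th_cdq v hh]
    refine ext' fun x => ?_
    simp only [sub_apply, smul_apply, neg_apply, mul_apply]
    ring
  | some i =>
    simp only [op_some]
    rw [d_mul, d_cdq, add_sub_cancel_right]

/-- Bound of one commutator with a first order operator. -/
theorem exists_nrm_op_mul_cdq_le {v : Space n} (hv : |v (Fin.last n)| ≤ 1) {j i₁ i₂ : ℕ}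
    (h₁ : j ≤ i₁) (h₂ : j ≤ i₂) (h₃ : j + (n + 1) ≤ i₁ + i₂) (l : Option (Fin (n + 1))) :
    ∃ C, 0 ≤ C ∧ ∀ h : ℝ, 0 < h → h ≤ 1 → ∀ a b : Test n,
      nrm j (op l (mul a (cdq v h b)) - mul a (cdq v h (op l b))) ≤
        C * (nrm (i₁ + 1) a * nrm (i₂ + 1) b) := by
  obtain ⟨C, hC, H⟩ := exists_nrm_mul_le (n := n) h₁ h₂ h₃
  simp only [mulₗ_apply] at H
  have hn := oneNorm_nonneg v
  refine ⟨C * (2 ^ i₂ * (1 + oneNorm v)), by positivity, fun h h0 h1 a b => ?_⟩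
  rw [op_mul_cdq v h0.ne', mul_assoc]
  have key : ∀ a' b' : Test n, nrm i₁ a' ≤ nrm (i₁ + 1) a →
      nrm i₂ b' ≤ 2 ^ i₂ * (1 + oneNorm v) * nrm (i₂ + 1) b →
      nrm j (mul a' b') ≤
        C * (2 ^ i₂ * (1 + oneNorm v) * (nrm (i₁ + 1) a * nrm (i₂ + 1) b)) := by
    intro a' b' ha hb
    refine (H a' b').trans (mul_le_mul_of_nonneg_left
      ((mul_le_mul ha hb (apply_nonneg _ _) (apply_nonneg _ _)).trans (le_of_eq ?_)) hC)
    ring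
  have hb0 : 0 ≤ nrm (i₂ + 1) b := apply_nonneg _ _
  have hb1 : nrm i₂ b ≤ nrm (i₂ + 1) b := nrm_mono (Nat.le_succ _) b
  cases l with
  | none =>
    simp only
    rw [map_neg_eq_map, map_smul_eq_mul]
    refine (mul_le_of_le_one_left (apply_nonneg _ _) hv).trans
      (key a _ (nrm_mono (Nat.le_succ _) a) ((nrm_avg_le hv h0 h1 i₂ b).trans ?_))
    rw [mul_assoc]
    refine mul_le_mul_of_nonneg_left ?_ (by positivity)
    nlinarith
  | some i =>
    refine key _ _ (nrm_d_le _ _ _) ((nrm_cdq_le hv h0 h1 i₂ b).trans ?_)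
    rw [mul_assoc, mul_assoc]
    refine mul_le_mul_of_nonneg_left ?_ (by positivity)
    nlinarith

/-- The commutator of a word telescopes into commutators of single operators, and each of these
loses nothing: it either differentiates `a` or replaces the quotient by an average. -/
theorem exists_nrm_word_comm_le {v : Space n} (hv : |v (Fin.last n)| ≤ 1) {k : ℕ}
    (hk : n + 2 ≤ k) {m : ℕ} {W : Module.End ℝ (Test n)} (hW : IsWord m W) :
    ∀ j, j + m ≤ k → ∃ C, 0 ≤ C ∧ ∀ h : ℝ, 0 < h → h ≤ 1 → ∀ a b : Test n,
      nrm j (W (mul a (cdq v h b)) - mul a (cdq v h (W b))) ≤ C * (nrm k a * nrm k b) := by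
  induction hW with
  | one => exact fun j _ => ⟨0, le_rfl, fun h _ _ a b => by simp⟩
  | @cons m W l hW ih =>
    intro j hj
    obtain ⟨C, hC, H⟩ := ih (j + 1) (by omega)
    -- The word `W` of length `m` has already used `m` orders of `b`, and the estimate adds one to
    -- both indices: this leaves `k - 1` for `a` and `k - 1 - m` for `W b`.
    obtain ⟨C', hC', H'⟩ := exists_nrm_op_mul_cdq_le hv (j := j) (i₁ := k - 1) (i₂ := k - 1 - m)
      (by omega) (by omega) (by omega) l
    refine ⟨C + C', add_nonneg hC hC', fun h h0 h1 a b => ?_⟩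
    have e : (op l * W : Module.End ℝ (Test n)) (mul a (cdq v h b)) -
        mul a (cdq v h ((op l * W : Module.End ℝ (Test n)) b)) =
        op l (W (mul a (cdq v h b)) - mul a (cdq v h (W b))) +
          (op l (mul a (cdq v h (W b))) - mul a (cdq v h (op l (W b)))) := by
      rw [map_sub, sub_add_sub_cancel]; rfl
    rw [e, add_mul]
    refine (map_add_le_add _ _ _).trans (add_le_add
      ((nrm_op_le_succ _ _ _).trans (H h h0 h1 a b)) ((H' h h0 h1 a (W b)).trans ?_))
    rw [Nat.sub_add_cancel (by omega)]
    exact mul_le_mul_of_nonneg_left (mul_le_mul_of_nonneg_left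
      (hW.nrm_le (by omega) b) (apply_nonneg _ _)) hC'

theorem inner_toGamma (k : ℕ) (φ ψ : Test n) : inner ℝ (toGamma k φ) (toGamma k ψ) =
    ∑ p ∈ gammaIndex n k,
      inner ℝ (toL2 (((th ^ p.1 : Module.End ℝ (Test n)) * D p.2) φ))
        (toL2 (((th ^ p.1 : Module.End ℝ (Test n)) * D p.2) ψ)) := by
  rw [Gamma.inner_eq]
  refine Finset.sum_congr rfl fun p _ => ?_
  rw [toL2_toGamma, toL2_toGamma, Test.weightedDeriv_eq, Test.weightedDeriv_eq]
  rfl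

theorem IsWord.toL2_le {m : ℕ} {W : Module.End ℝ (Test n)} (h : IsWord m W) {k : ℕ}
    (hk : m ≤ k) (φ : Test n) : ‖toL2 (W φ)‖ ≤ nrm k φ := by
  rw [← nrm_zero]
  exact h.nrm_le (by omega) φ

/-- The energy estimate of the transport term in `Γ^k`. -/
theorem exists_inner_mul_cdq_le {v : Space n} (hv : |v (Fin.last n)| ≤ 1) {k : ℕ}
    (hk : n + 2 ≤ k) : ∃ C, 0 ≤ C ∧ ∀ h : ℝ, 0 < h → h ≤ 1 → ∀ a : Test n,
      |inner ℝ (toGamma k (mul a (cdq v h a))) (toGamma k a)| ≤ C * ‖toGamma k a‖ ^ 3 := by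
  have key : ∀ p ∈ gammaIndex n k, ∃ C, 0 ≤ C ∧ ∀ h : ℝ, 0 < h → h ≤ 1 → ∀ a : Test n,
      |inner ℝ (toL2 (((th ^ p.1 : Module.End ℝ (Test n)) * D p.2) (mul a (cdq v h a))))
        (toL2 (((th ^ p.1 : Module.End ℝ (Test n)) * D p.2) a))| ≤ C * nrm k a ^ 3 := by
    intro p hp
    have hpk := mem_gammaIndex.1 hp
    have hW := isWord_pow_th_mul (isWord_D p.2) p.1
    set W := (th ^ p.1 : Module.End ℝ (Test n)) * D p.2
    obtain ⟨C, hC, H⟩ := exists_nrm_word_comm_le hv hk hW 0 (by omega)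
    have hn := oneNorm_nonneg v
    refine ⟨C + 2 ^ (n + 1) * oneNorm v, by positivity, fun h h0 h1 a => ?_⟩
    -- The commutator is bounded in `L²`; in the remaining term the quotient acts on `W a`, which is
    -- also the other argument of the inner product, so antisymmetry applies.
    have e : toL2 (W (mul a (cdq v h a))) =
        toL2 (W (mul a (cdq v h a)) - mul a (cdq v h (W a))) + toL2 (mul a (cdq v h (W a))) := by
      rw [← map_add, sub_add_cancel]
    have hWa := hW.toL2_le hpk a
    have ha : 0 ≤ nrm k a := apply_nonneg _ _
    have h2 := abs_inner_mul_cdq_le hv h0 h1 a (W a)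
    have h3 : ‖toL2 (W (mul a (cdq v h a)) - mul a (cdq v h (W a)))‖ ≤
        C * (nrm k a * nrm k a) := H h h0 h1 a a
    rw [e, inner_add_left, add_mul]
    refine (abs_add_le _ _).trans (add_le_add ?_ (h2.trans ?_))
    · refine (abs_real_inner_le_norm _ _).trans ((mul_le_mul h3 hWa (norm_nonneg _)
        (by positivity)).trans (le_of_eq ?_))
      ring
    · have h4 : nrm (n + 2) a * ‖toL2 (W a)‖ ^ 2 ≤ nrm k a * nrm k a ^ 2 :=
        mul_le_mul (nrm_mono hk a) (pow_le_pow_left₀ (norm_nonneg _) hWa 2) (by positivity) ha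
      rw [mul_assoc]
      refine (mul_le_mul_of_nonneg_left h4 (by positivity)).trans (le_of_eq ?_)
      ring
  choose! C hC H using key
  obtain ⟨K, hK, HK⟩ := nrm_le_norm_toGamma (n := n) k
  refine ⟨(∑ p ∈ gammaIndex n k, C p) * K ^ 3,
    mul_nonneg (Finset.sum_nonneg hC) (by positivity), fun h h0 h1 a => ?_⟩
  rw [inner_toGamma, mul_assoc, ← mul_pow, Finset.sum_mul]
  refine (Finset.abs_sum_le_sum_abs _ _).trans (Finset.sum_le_sum fun p hp => ?_)
  exact (H p hp h h0 h1 a).trans (mul_le_mul_of_nonneg_left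
    (pow_le_pow_left₀ (apply_nonneg _ _) (HK a) 3) (hC p hp))

theorem op_cdq {v : Space n} (hv : v (Fin.last n) = 0) {h : ℝ} (hh : h ≠ 0)
    (l : Option (Fin (n + 1))) (φ : Test n) : op l (cdq v h φ) = cdq v h (op l φ) := by
  cases l with
  | none => rw [op_none, th_cdq v hh, hv, zero_smul, sub_zero]
  | some i => exact d_cdq i v h φ

theorem IsWord.cdq_comm {v : Space n} (hv : v (Fin.last n) = 0) {h : ℝ} (hh : h ≠ 0) {m : ℕ}
    {W : Module.End ℝ (Test n)} (hW : IsWord m W) (φ : Test n) :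
    W (cdq v h φ) = cdq v h (W φ) := by
  induction hW with
  | one => rfl
  | cons l _ ih =>
    rw [Module.End.mul_apply, ih, op_cdq hv hh]; rfl

/-- Difference quotients transverse to `θ` are antisymmetric in `Γ^k`. -/
theorem inner_cdq_self_eq_zero {v : Space n} (hv : v (Fin.last n) = 0) {h : ℝ} (hh : h ≠ 0)
    (k : ℕ) (a : Test n) : inner ℝ (toGamma k (cdq v h a)) (toGamma k a) = 0 := by
  rw [inner_toGamma]
  refine Finset.sum_eq_zero fun p _ => ?_
  rw [(isWord_pow_th_mul (isWord_D p.2) p.1).cdq_comm hv hh]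
  have := inner_cdq v h (((th ^ p.1 : Module.End ℝ (Test n)) * D p.2) a)
    (((th ^ p.1 : Module.End ℝ (Test n)) * D p.2) a)
  rw [real_inner_comm (toL2 (cdq v h _))] at this
  linarith

end Test

end

end MachStem

/-! ### Criteria for approximations, and extension from test functions. -/

namespace MachStem

noncomputable section

section Abstract

open Filter Topology

variable {H X : Type*} [NormedAddCommGroup H] [InnerProductSpace ℝ H]
  [NormedAddCommGroup X] [InnerProductSpace ℝ X] {ι : H →L[ℝ] X}

theorem IsApproximation.add {F F' : ℕ → H → H} {N N' : H → X} (h : IsApproximation ι F N)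
    (h' : IsApproximation ι F' N') :
    IsApproximation ι (fun j a => F j a + F' j a) (fun a => N a + N' a) where
  lipschitz j M := by
    obtain ⟨K, hK⟩ := h.lipschitz j M
    obtain ⟨K', hK'⟩ := h'.lipschitz j M
    exact ⟨K + K', hK.add hK'⟩
  energy M := by
    obtain ⟨C, hC, h1⟩ := h.energy M
    obtain ⟨C', hC', h1'⟩ := h'.energy M
    refine ⟨C + C', add_nonneg hC hC', fun j a ha => ?_⟩
    rw [inner_add_left, add_mul]
    exact (abs_add_le _ _).trans (add_le_add (h1 j a ha) (h1' j a ha))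
  weak_energy M := by
    obtain ⟨C, hC, h1⟩ := h.weak_energy M
    obtain ⟨C', hC', h1'⟩ := h'.weak_energy M
    refine ⟨C + C', add_nonneg hC hC', fun j a b ha hb => ?_⟩
    rw [map_add, map_add, add_sub_add_comm, inner_add_left, add_mul]
    exact (abs_add_le _ _).trans (add_le_add (h1 j a b ha hb) (h1' j a b ha hb))
  consistent M := by
    obtain ⟨ε, hε, h1⟩ := h.consistent M
    obtain ⟨ε', hε', h1'⟩ := h'.consistent M
    refine ⟨fun j => ε j + ε' j, by simpa using hε.add hε', fun j a ha => ?_⟩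
    rw [map_add, add_sub_add_comm]
    exact (norm_add_le _ _).trans (add_le_add (h1 j a ha) (h1' j a ha))
  weak_lipschitz j M := by
    obtain ⟨C, h1⟩ := h.weak_lipschitz j M
    obtain ⟨C', h1'⟩ := h'.weak_lipschitz j M
    refine ⟨C + C', fun a b ha hb => ?_⟩
    rw [map_add, map_add, add_sub_add_comm, add_mul]
    exact (norm_add_le _ _).trans (add_le_add (h1 a b ha hb) (h1' a b ha hb))

theorem IsApproximation.const_smul {F : ℕ → H → H} {N : H → X} (h : IsApproximation ι F N)
    (c : ℝ) : IsApproximation ι (fun j a => c • F j a) (fun a => c • N a) where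
  lipschitz j M := by
    obtain ⟨K, hK⟩ := h.lipschitz j M
    refine ⟨‖c‖₊ * K, ?_⟩
    exact (lipschitzWith_smul c).comp_lipschitzOnWith hK
  energy M := by
    obtain ⟨C, hC, h1⟩ := h.energy M
    refine ⟨|c| * C, by positivity, fun j a ha => ?_⟩
    rw [inner_smul_left, abs_mul, conj_trivial, mul_assoc]
    exact mul_le_mul_of_nonneg_left (h1 j a ha) (abs_nonneg c)
  weak_energy M := by
    obtain ⟨C, hC, h1⟩ := h.weak_energy M
    refine ⟨|c| * C, by positivity, fun j a b ha hb => ?_⟩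
    rw [map_smul, map_smul, ← smul_sub, inner_smul_left, abs_mul, conj_trivial, mul_assoc]
    exact mul_le_mul_of_nonneg_left (h1 j a b ha hb) (abs_nonneg c)
  consistent M := by
    obtain ⟨ε, hε, h1⟩ := h.consistent M
    refine ⟨fun j => |c| * ε j, by simpa using hε.const_mul |c|, fun j a ha => ?_⟩
    rw [map_smul, ← smul_sub, norm_smul]
    exact mul_le_mul_of_nonneg_left (h1 j a ha) (abs_nonneg c)
  weak_lipschitz j M := by
    obtain ⟨C, h1⟩ := h.weak_lipschitz j M
    refine ⟨|c| * C, fun a b ha hb => ?_⟩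
    rw [map_smul, map_smul, ← smul_sub, norm_smul, mul_assoc]
    exact mul_le_mul_of_nonneg_left (h1 a b ha hb) (abs_nonneg c)

theorem isApproximation_of_linear {P : ℕ → H →L[ℝ] H} {N : H → X} {ε : ℕ → ℝ}
    (hε : Tendsto ε atTop (𝓝 0)) (hε0 : ∀ j, 0 ≤ ε j)
    (energy : ∀ j a, inner ℝ (P j a) a = 0)
    (weak_energy : ∀ j e, inner ℝ (ι (P j e)) (ι e) = 0)
    (consistent : ∀ j a, ‖ι (P j a) - N a‖ ≤ ε j * ‖a‖)
    (weak_bound : ∀ j, ∃ C, ∀ e, ‖ι (P j e)‖ ≤ C * ‖ι e‖) :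
    IsApproximation ι (fun j a => P j a) N where
  lipschitz j M := ⟨_, (P j).lipschitz.lipschitzOnWith⟩
  energy M := ⟨0, le_rfl, fun j a _ => by rw [energy, abs_zero, zero_mul]⟩
  weak_energy M := ⟨0, le_rfl, fun j a b _ _ => by
    rw [← map_sub, ← map_sub, ← map_sub, weak_energy, abs_zero, zero_mul]⟩
  consistent M := by
    refine ⟨fun j => ε j * M, by simpa using hε.mul_const M, fun j a ha => ?_⟩
    exact (consistent j a).trans (mul_le_mul_of_nonneg_left ha (hε0 j))
  weak_lipschitz j M := by
    obtain ⟨C, hC⟩ := weak_bound j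
    refine ⟨C, fun a b _ _ => ?_⟩
    rw [← map_sub, ← map_sub, ← map_sub]
    exact hC _

/-- Everything rests on `P a a - P b b = P a (a - b) + P (a - b) b`. In the first term the
derivative hits the difference and antisymmetry is needed; in the second it hits `b`, which is
bounded in the strong norm. Only `weak_right` may depend on the index. -/
theorem isApproximation_of_bilinear {P : ℕ → H →L[ℝ] H →L[ℝ] H} {N : H → X} {ε : ℕ → ℝ}
    (hε : Tendsto ε atTop (𝓝 0)) (hε0 : ∀ j, 0 ≤ ε j)
    (energy : ∃ C, 0 ≤ C ∧ ∀ j a, |inner ℝ (P j a a) a| ≤ C * ‖a‖ ^ 3)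
    (weak_energy : ∃ C, 0 ≤ C ∧ ∀ j a e, |inner ℝ (ι (P j a e)) (ι e)| ≤ C * ‖a‖ * ‖ι e‖ ^ 2)
    (weak_left : ∃ C, 0 ≤ C ∧ ∀ j e b, ‖ι (P j e b)‖ ≤ C * ‖ι e‖ * ‖b‖)
    (consistent : ∀ j a, ‖ι (P j a a) - N a‖ ≤ ε j * ‖a‖ ^ 2)
    (weak_right : ∀ j, ∃ C, 0 ≤ C ∧ ∀ a e, ‖ι (P j a e)‖ ≤ C * ‖a‖ * ‖ι e‖) :
    IsApproximation ι (fun j a => P j a a) N where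
  lipschitz j M := by
    refine ⟨⟨2 * ‖P j‖ * max M 0, by positivity⟩, LipschitzOnWith.of_dist_le_mul fun a ha b hb => ?_⟩
    rw [mem_closedBall_zero_iff] at ha hb
    have ha' := ha.trans (le_max_left M 0)
    have hb' := hb.trans (le_max_left M 0)
    have e : P j a a - P j b b = P j a (a - b) + P j (a - b) b := by
      rw [map_sub, map_sub, sub_apply]; abel
    rw [dist_eq_norm, dist_eq_norm, e]
    have h1 := (P j).le_opNorm₂ a (a - b)
    have h2 := (P j).le_opNorm₂ (a - b) b
    have h3 : ‖P j‖ * ‖a‖ * ‖a - b‖ ≤ ‖P j‖ * max M 0 * ‖a - b‖ := by gcongr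
    have h4 : ‖P j‖ * ‖a - b‖ * ‖b‖ ≤ ‖P j‖ * ‖a - b‖ * max M 0 := by gcongr
    refine (norm_add_le _ _).trans ?_
    change _ ≤ 2 * ‖P j‖ * max M 0 * ‖a - b‖
    linarith
  energy M := by
    obtain ⟨C, hC, h⟩ := energy
    refine ⟨C * max M 0, by positivity, fun j a ha => (h j a).trans ?_⟩
    have ha' := ha.trans (le_max_left M 0)
    rw [pow_succ' _ 2, mul_assoc]
    gcongr
  weak_energy M := by
    obtain ⟨C, hC, h⟩ := weak_energy
    obtain ⟨C', hC', h'⟩ := weak_left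
    refine ⟨C * max M 0 + C' * max M 0, by positivity, fun j a b ha hb => ?_⟩
    have ha' := ha.trans (le_max_left M 0)
    have hb' := hb.trans (le_max_left M 0)
    have e : ι (P j a a) - ι (P j b b) = ι (P j a (a - b)) + ι (P j (a - b) b) := by
      rw [← map_sub, ← map_add]
      congr 1
      rw [map_sub, map_sub, sub_apply]; abel
    rw [e, ← map_sub, inner_add_left, add_mul]
    refine (abs_add_le _ _).trans (add_le_add ((h j a (a - b)).trans (by gcongr)) ?_)
    refine (abs_real_inner_le_norm _ _).trans
      ((mul_le_mul_of_nonneg_right (h' j (a - b) b) (norm_nonneg _)).trans ?_)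
    have : C' * ‖ι (a - b)‖ * ‖b‖ * ‖ι (a - b)‖ ≤ C' * ‖ι (a - b)‖ * max M 0 * ‖ι (a - b)‖ := by
      gcongr
    linarith
  consistent M := by
    refine ⟨fun j => ε j * (max M 0) ^ 2, by simpa using hε.mul_const ((max M 0) ^ 2),
      fun j a ha => (consistent j a).trans ?_⟩
    exact mul_le_mul_of_nonneg_left (pow_le_pow_left₀ (norm_nonneg _)
      (ha.trans (le_max_left M 0)) 2) (hε0 j)
  weak_lipschitz j M := by
    obtain ⟨C, hC, h⟩ := weak_right j
    obtain ⟨C', hC', h'⟩ := weak_left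
    refine ⟨C * max M 0 + C' * max M 0, fun a b ha hb => ?_⟩
    have ha' := ha.trans (le_max_left M 0)
    have hb' := hb.trans (le_max_left M 0)
    have e : ι (P j a a) - ι (P j b b) = ι (P j a (a - b)) + ι (P j (a - b) b) := by
      rw [← map_sub, ← map_add]
      congr 1
      rw [map_sub, map_sub, sub_apply]; abel
    rw [e, ← map_sub, add_mul]
    refine (norm_add_le _ _).trans (add_le_add ((h a (a - b)).trans (by gcongr))
      ((h' j (a - b) b).trans ?_))
    rw [mul_right_comm]
    gcongr

end Abstract

variable {n : ℕ}

/-- A bilinear map on test functions that is bounded for the norm of `Γ^k` extends to `Γ^k`. -/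
theorem exists_bilinear_extension {Y : Type*} [NormedAddCommGroup Y] [NormedSpace ℝ Y]
    [CompleteSpace Y] (k : ℕ) (B : Test n →ₗ[ℝ] Test n →ₗ[ℝ] Y) {C : ℝ} (hC : 0 ≤ C)
    (h : ∀ φ ψ, ‖B φ ψ‖ ≤ C * (‖Test.toGamma k φ‖ * ‖Test.toGamma k ψ‖)) :
    ∃ P : Gamma n k →L[ℝ] Gamma n k →L[ℝ] Y, ∀ φ ψ,
      P (Test.toGamma k φ) (Test.toGamma k ψ) = B φ ψ := by
  have hd := Test.denseRange_toGamma (n := n) k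
  have h1 : ∀ φ ψ, ‖B φ ψ‖ ≤ (C * ‖Test.toGamma k φ‖) * ‖Test.toGamma k ψ‖ := fun φ ψ => by
    rw [mul_assoc]; exact h φ ψ
  have e1 : ∀ φ ψ, (B φ).extendOfNorm (Test.toGamma k) (Test.toGamma k ψ) = B φ ψ := fun φ ψ =>
    LinearMap.extendOfNorm_eq hd ⟨_, h1 φ⟩ ψ
  let E : Test n →ₗ[ℝ] (Gamma n k →L[ℝ] Y) :=
    { toFun := fun φ => (B φ).extendOfNorm (Test.toGamma k)
      map_add' := fun φ φ' => by
        refine ContinuousLinearMap.coeFn_injective (hd.equalizer (map_continuous _)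
          (map_continuous _) (funext fun ψ => ?_))
        change (B (φ + φ')).extendOfNorm (Test.toGamma k) (Test.toGamma k ψ) =
          (B φ).extendOfNorm (Test.toGamma k) (Test.toGamma k ψ) +
          (B φ').extendOfNorm (Test.toGamma k) (Test.toGamma k ψ)
        rw [e1, e1, e1, map_add, LinearMap.add_apply]
      map_smul' := fun c φ => by
        refine ContinuousLinearMap.coeFn_injective (hd.equalizer (map_continuous _)
          (map_continuous _) (funext fun ψ => ?_))
        change (B (c • φ)).extendOfNorm (Test.toGamma k) (Test.toGamma k ψ) =
          c • (B φ).extendOfNorm (Test.toGamma k) (Test.toGamma k ψ)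
        rw [e1, e1, map_smul, LinearMap.smul_apply] }
  have h2 : ∀ φ, ‖E φ‖ ≤ C * ‖Test.toGamma k φ‖ := fun φ =>
    LinearMap.opNorm_extendOfNorm_le hd (by positivity) (h1 φ)
  refine ⟨E.extendOfNorm (Test.toGamma k), fun φ ψ => ?_⟩
  rw [LinearMap.extendOfNorm_eq hd ⟨_, h2⟩ φ]
  exact e1 φ ψ

theorem exists_linear_extension {Y : Type*} [NormedAddCommGroup Y] [NormedSpace ℝ Y]
    [CompleteSpace Y] (k : ℕ) (B : Test n →ₗ[ℝ] Y) {C : ℝ}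
    (h : ∀ φ, ‖B φ‖ ≤ C * ‖Test.toGamma k φ‖) :
    ∃ P : Gamma n k →L[ℝ] Y, ∀ φ, P (Test.toGamma k φ) = B φ :=
  ⟨B.extendOfNorm (Test.toGamma k), fun φ =>
    LinearMap.extendOfNorm_eq (Test.denseRange_toGamma k) ⟨_, h⟩ φ⟩

end

end MachStem

/-! ### Approximation of the three terms of the equation. -/

namespace MachStem

noncomputable section

variable {n : ℕ}

theorem Gamma.deriv_toGamma {k : ℕ} (i : Fin (n + 1)) (φ : Test n) :
    (Test.toGamma k φ).deriv i = Test.toL2 (Test.d i φ) := by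
  rw [Gamma.deriv, Test.toL2_toGamma, Test.weightedDeriv_eq, Test.D_single]
  rfl

/-- The weak derivative as a continuous linear map. -/
def Gamma.derivL {k : ℕ} (hk : 1 ≤ k) (i : Fin (n + 1)) : Gamma n k →L[ℝ] L2 n :=
  have h1 : 0 + ∑ j, (Pi.single i 1 : Fin (n + 1) → ℕ) j ≤ k := by simpa using hk
  LinearMap.mkContinuous
    { toFun := fun u => u.deriv i
      map_add' := fun u v =>
        MachStem.weightedDeriv_eq ((u.isWeightedDeriv h1).add (v.isWeightedDeriv h1))
      map_smul' := fun c u => MachStem.weightedDeriv_eq ((u.isWeightedDeriv h1).smul c) } 1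
    fun u => by
      rw [one_mul]
      exact u.norm_weightedDeriv_le h1

theorem Gamma.derivL_apply {k : ℕ} (hk : 1 ≤ k) (i : Fin (n + 1)) (u : Gamma n k) :
    Gamma.derivL hk i u = u.deriv i := rfl

namespace Test

theorem exists_nrm_le_norm_toGamma (k : ℕ) : ∃ K, 0 ≤ K ∧ ∀ i ≤ k, ∀ φ : Test n,
    nrm i φ ≤ K * ‖toGamma k φ‖ := by
  obtain ⟨K, hK, H⟩ := nrm_le_norm_toGamma (n := n) k
  exact ⟨K, hK, fun i hi φ => (nrm_mono hi φ).trans (H φ)⟩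

theorem BilinBound.exists_extension {k : ℕ} {B : Test n →ₗ[ℝ] Test n →ₗ[ℝ] Test n}
    (h : BilinBound k k k B) : ∃ P : Gamma n k →L[ℝ] Gamma n k →L[ℝ] Gamma n k, ∀ φ ψ,
      P (toGamma k φ) (toGamma k ψ) = toGamma k (B φ ψ) := by
  obtain ⟨C, hC, H⟩ := h
  obtain ⟨K, hK, HK⟩ := nrm_le_norm_toGamma (n := n) k
  obtain ⟨L, hL, HL⟩ := norm_toGamma_le_nrm (n := n) k
  refine exists_bilinear_extension k (B.compr₂ (toGamma k)) (C := L * (C * (K * K)))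
    (by positivity) fun φ ψ => ?_
  refine (HL _).trans ?_
  rw [mul_assoc]
  refine mul_le_mul_of_nonneg_left ((H φ ψ).trans ?_) hL
  rw [mul_assoc]
  refine mul_le_mul_of_nonneg_left ?_ hC
  refine (mul_le_mul (HK φ) (HK ψ) (apply_nonneg _ _) (by positivity)).trans (le_of_eq ?_)
  ring

end Test

open Test Filter Topology

/-- The approximation of the nonlocal term. -/
theorem exists_isApproximation_fpd {δ₁ δ₃ : ℝ} (h : δ₁ ≠ δ₃) (h₁ : δ₁ ≠ 0) (h₃ : δ₃ ≠ 0) {k : ℕ}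
    (hk : n + 3 ≤ k) : ∃ P : Gamma n k →L[ℝ] Gamma n k →L[ℝ] Gamma n k,
      (∀ φ ψ, P (toGamma k φ) (toGamma k ψ) =
        toGamma k (fp h (d (Fin.last n) φ) (d (Fin.last n) ψ))) ∧
      IsApproximation (Gamma.incl n k) (fun _ a => P a a) (fun a => (P a a).toL2) := by
  have hd := denseRange_toGamma (n := n) k
  obtain ⟨P, hP⟩ := (exists_nrm_fpd_le (n := n) h h₁ h₃ (m := k) le_rfl le_rfl
    (by omega)).exists_extension
  have hP' : ∀ φ ψ, P (toGamma k φ) (toGamma k ψ) =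
      toGamma k (fp h (d (Fin.last n) φ) (d (Fin.last n) ψ)) := fun φ ψ => by
    rw [hP, fpd_apply, pow_one]
  obtain ⟨K, hK, HK⟩ := nrm_le_norm_toGamma (n := n) k
  have left : ∃ C, 0 ≤ C ∧ ∀ e b,
      ‖Gamma.incl n k (P e b)‖ ≤ C * ‖Gamma.incl n k e‖ * ‖b‖ := by
    obtain ⟨C, hC, H⟩ := exists_nrm_fpd_le (n := n) h h₁ h₃ (m := 0) (i := 0) (j := k)
      le_rfl (Nat.zero_le _) (by omega)
    refine ⟨C * K, by positivity, fun e b => ?_⟩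
    refine hd.induction_on₂ (p := fun e b =>
      ‖Gamma.incl n k (P e b)‖ ≤ C * K * ‖Gamma.incl n k e‖ * ‖b‖)
      (isClosed_le (by fun_prop) (by fun_prop)) (fun φ ψ => ?_) e b
    rw [hP]
    refine (H φ ψ).trans ?_
    rw [mul_assoc, mul_assoc]
    refine mul_le_mul_of_nonneg_left ?_ hC
    rw [mul_left_comm]
    exact mul_le_mul_of_nonneg_left (HK ψ) (apply_nonneg _ _)
  have right : ∃ C, 0 ≤ C ∧ ∀ a e,
      ‖Gamma.incl n k (P a e)‖ ≤ C * ‖a‖ * ‖Gamma.incl n k e‖ := by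
    obtain ⟨C, hC, H⟩ := exists_nrm_fpd_le (n := n) h h₁ h₃ (m := 0) (i := k) (j := 0)
      (Nat.zero_le _) le_rfl (by omega)
    refine ⟨C * K, by positivity, fun a e => ?_⟩
    refine hd.induction_on₂ (p := fun a e =>
      ‖Gamma.incl n k (P a e)‖ ≤ C * K * ‖a‖ * ‖Gamma.incl n k e‖)
      (isClosed_le (by fun_prop) (by fun_prop)) (fun φ ψ => ?_) a e
    rw [hP]
    refine (H φ ψ).trans ?_
    rw [mul_assoc, mul_assoc, ← mul_assoc K]
    exact mul_le_mul_of_nonneg_left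
      (mul_le_mul_of_nonneg_right (HK φ) (apply_nonneg _ _)) hC
  -- The nonlocal term is bounded on `Γ^k`, so it needs no regularisation: the sequence is constant
  -- and the consistency error zero.
  refine ⟨P, hP', isApproximation_of_bilinear (P := fun _ => P) (ε := fun _ => 0)
    tendsto_const_nhds (fun _ => le_rfl) ?_ ?_ ?_ ?_ fun _ => right⟩
  · refine ⟨‖P‖, norm_nonneg P, fun _ a => (abs_real_inner_le_norm _ _).trans ?_⟩
    refine (mul_le_mul_of_nonneg_right (P.le_opNorm₂ a a) (norm_nonneg _)).trans (le_of_eq ?_)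
    ring
  · obtain ⟨C, hC, H⟩ := right
    refine ⟨C, hC, fun _ a e => (abs_real_inner_le_norm _ _).trans ?_⟩
    refine (mul_le_mul_of_nonneg_right (H a e) (norm_nonneg _)).trans (le_of_eq ?_)
    ring
  · obtain ⟨C, hC, H⟩ := left
    exact ⟨C, hC, fun _ => H⟩
  · intro _ a
    simp

/-- The approximation of the transport term `a ∂_θ a`. -/
theorem exists_isApproximation_transport {k : ℕ} (hk : n + 2 ≤ k) :
    ∃ (P : ℕ → Gamma n k →L[ℝ] Gamma n k →L[ℝ] Gamma n k)
      (Q : Gamma n k →L[ℝ] Gamma n k →L[ℝ] L2 n),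
      (∀ φ ψ, Q (toGamma k φ) (toGamma k ψ) = toL2 (mul φ (d (Fin.last n) ψ))) ∧
      IsApproximation (Gamma.incl n k) (fun j a => P j a a) (fun a => Q a a) := by
  have hd := denseRange_toGamma (n := n) k
  set v := thetaDir n with hv'
  have hv : |v (Fin.last n)| ≤ 1 := by simp [hv', thetaDir]
  have hdv : ∀ φ, dv v φ = d (Fin.last n) φ := fun φ => ext' fun x => dv_apply v φ x
  have hn := oneNorm_nonneg v
  have hs0 : ∀ j, (0 : ℝ) < scale j := scale_pos
  have hs1 : ∀ j, (scale j : ℝ) ≤ 1 := scale_le_one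
  obtain ⟨K, hK, HK⟩ := exists_nrm_le_norm_toGamma (n := n) k
  have hb : ∀ j, BilinBound k k k ((mulₗ : Test n →ₗ[ℝ] _).compl₂ (cdq v (scale j : ℝ))) := by
    intro j
    obtain ⟨C, hC, H⟩ := exists_nrm_mul_le (n := n) (m := k) le_rfl le_rfl (by omega)
    have := (hs0 j).le
    -- This bound blows up with `j`; it only serves to define the regularised operators on `Γ^k`.
    refine ⟨C * ((scale j : ℝ)⁻¹ * 2 ^ k), by positivity, fun φ ψ => (H φ _).trans ?_⟩
    rw [mul_assoc C, mul_left_comm (_ * _) (nrm k φ)]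
    exact mul_le_mul_of_nonneg_left (mul_le_mul_of_nonneg_left
      (nrm_cdq_le_inv hv (hs0 j) (hs1 j) k ψ) (apply_nonneg (nrm (n := n) k) φ)) hC
  choose P hP using fun j => (hb j).exists_extension
  have hP' : ∀ j φ ψ, P j (toGamma k φ) (toGamma k ψ) =
      toGamma k (mul φ (cdq v (scale j : ℝ) ψ)) := hP
  have hmul : ∀ φ ψ : Test n, ‖toL2 (mul φ ψ)‖ ≤ nrm (n + 1) φ * ‖toL2 ψ‖ := fun φ ψ =>
    norm_mul_le (j := 0) (by omega) φ ψ
  obtain ⟨Q, hQ⟩ := exists_bilinear_extension k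
    ((mulₗ : Test n →ₗ[ℝ] _).compl₁₂ LinearMap.id (d (Fin.last n)) |>.compr₂ toL2)
    (C := K * K) (by positivity) (by
      intro φ ψ
      refine (hmul φ (d (Fin.last n) ψ)).trans ((mul_le_mul (HK (n + 1) (by omega) φ)
        ((nrm_d_le 0 _ ψ).trans (HK 1 (by omega) ψ)) (apply_nonneg _ _) (by positivity)).trans
        (le_of_eq ?_))
      ring)
  have hQ' : ∀ φ ψ, Q (toGamma k φ) (toGamma k ψ) = toL2 (mul φ (d (Fin.last n) ψ)) := hQ
  refine ⟨P, Q, hQ', isApproximation_of_bilinear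
    (ε := fun j => (scale j : ℝ) * (oneNorm v * oneNorm v * (K * K))) ?_ ?_ ?_ ?_ ?_ ?_ ?_⟩
  · simpa using tendsto_scale.mul_const (oneNorm v * oneNorm v * (K * K))
  · intro j
    have := (hs0 j).le
    positivity
  · obtain ⟨C, hC, H⟩ := exists_inner_mul_cdq_le hv hk
    refine ⟨C, hC, fun j a => ?_⟩
    -- Both sides are continuous on `Γ^k`, so the estimate need only be checked on test functions.
    refine hd.induction_on (p := fun a => |inner ℝ (P j a a) a| ≤ C * ‖a‖ ^ 3) a
      (isClosed_le (by fun_prop) (by fun_prop)) fun φ => ?_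
    rw [hP']
    exact H _ (hs0 j) (hs1 j) φ
  · refine ⟨2 ^ (n + 1) * oneNorm v * K, by positivity, fun j a e => ?_⟩
    refine hd.induction_on₂ (p := fun a e =>
      |inner ℝ (Gamma.incl n k (P j a e)) (Gamma.incl n k e)| ≤
        2 ^ (n + 1) * oneNorm v * K * ‖a‖ * ‖Gamma.incl n k e‖ ^ 2)
      (isClosed_le (by fun_prop) (by fun_prop)) (fun φ ψ => ?_) a e
    rw [hP']
    refine (abs_inner_mul_cdq_le hv (hs0 j) (hs1 j) φ ψ).trans ?_
    refine mul_le_mul_of_nonneg_right ?_ (sq_nonneg _)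
    rw [mul_assoc _ K]
    exact mul_le_mul_of_nonneg_left (HK _ hk φ) (by positivity)
  · refine ⟨2 ^ (n + 1) * oneNorm v * K, by positivity, fun j e b => ?_⟩
    refine hd.induction_on₂ (p := fun e b => ‖Gamma.incl n k (P j e b)‖ ≤
        2 ^ (n + 1) * oneNorm v * K * ‖Gamma.incl n k e‖ * ‖b‖)
      (isClosed_le (by fun_prop) (by fun_prop)) (fun φ ψ => ?_) e b
    rw [hP']
    refine (norm_mul_le (i := 0) (j := n + 1) (by omega) φ _).trans ?_
    rw [mul_assoc _ K, mul_assoc _ (K * _), mul_comm K, mul_assoc ‖_‖, mul_left_comm _ ‖_‖]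
    refine mul_le_mul_of_nonneg_left ?_ (apply_nonneg _ _)
    exact (nrm_cdq_le hv (hs0 j) (hs1 j) (n + 1) ψ).trans
      (mul_le_mul_of_nonneg_left (HK _ hk ψ) (by positivity))
  · intro j a
    refine hd.induction_on (p := fun a => ‖Gamma.incl n k (P j a a) - Q a a‖ ≤
      (scale j : ℝ) * (oneNorm v * oneNorm v * (K * K)) * ‖a‖ ^ 2) a
      (isClosed_le (by fun_prop) (by fun_prop)) fun φ => ?_
    have hs := (hs0 j).le
    rw [hP', hQ', Gamma.incl_apply, toL2_toGamma, ← map_sub]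
    have e : mul φ (cdq v (scale j : ℝ) φ) - mul φ (d (Fin.last n) φ) =
        mul φ (cdq v (scale j : ℝ) φ - dv v φ) := by
      rw [hdv]
      exact ext' fun x => (mul_sub _ _ _).symm
    rw [e]
    refine (hmul φ _).trans ((mul_le_mul (HK _ (by omega) φ)
      ((norm_cdq_sub_dv_le v (hs0 j) φ).trans (mul_le_mul_of_nonneg_left
        (mul_le_mul_of_nonneg_left (mul_le_mul_of_nonneg_left (HK 2 (by omega) φ) hn) hn) hs))
      (norm_nonneg _) (by positivity)).trans (le_of_eq ?_))
    ring
  · intro j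
    have hs := (hs0 j).le
    refine ⟨K * (scale j : ℝ)⁻¹, by positivity, fun a e => ?_⟩
    refine hd.induction_on₂ (p := fun a e => ‖Gamma.incl n k (P j a e)‖ ≤
        K * (scale j : ℝ)⁻¹ * ‖a‖ * ‖Gamma.incl n k e‖)
      (isClosed_le (by fun_prop) (by fun_prop)) (fun φ ψ => ?_) a e
    rw [hP']
    have h2 := nrm_cdq_le_inv hv (hs0 j) (hs1 j) 0 ψ
    rw [pow_zero, mul_one] at h2
    refine (hmul φ _).trans ((mul_le_mul (HK (n + 1) (by omega) φ) h2 (apply_nonneg _ _)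
      (by positivity)).trans (le_of_eq ?_))
    rw [nrm_zero, Gamma.incl_apply, toL2_toGamma]
    ring

/-- The approximation of the transport term `v · ∇ a`, for `v` transverse to `θ`. -/
theorem exists_isApproximation_dv {k : ℕ} (hk : 2 ≤ k) {v : Space n} (hv : v (Fin.last n) = 0) :
    ∃ P : ℕ → Gamma n k →L[ℝ] Gamma n k,
      IsApproximation (Gamma.incl n k) (fun j a => P j a) (fun a => ∑ i, v i • a.deriv i) := by
  have hd := denseRange_toGamma (n := n) k
  have hv1 : |v (Fin.last n)| ≤ 1 := by simp [hv]
  have hn := oneNorm_nonneg v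
  have hs0 : ∀ j, (0 : ℝ) < scale j := scale_pos
  have hs1 : ∀ j, (scale j : ℝ) ≤ 1 := scale_le_one
  obtain ⟨K, hK, HK⟩ := exists_nrm_le_norm_toGamma (n := n) k
  obtain ⟨L, hL, HL⟩ := norm_toGamma_le_nrm (n := n) k
  have hb : ∀ j, ∃ P : Gamma n k →L[ℝ] Gamma n k, ∀ φ,
      P (toGamma k φ) = toGamma k (cdq v (scale j : ℝ) φ) := by
    intro j
    have := (hs0 j).le
    refine exists_linear_extension k (toGamma k ∘ₗ cdq v (scale j : ℝ))
      (C := L * ((scale j : ℝ)⁻¹ * 2 ^ k * K)) fun φ => (HL _).trans ?_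
    rw [mul_assoc]
    refine mul_le_mul_of_nonneg_left ((nrm_cdq_le_inv hv1 (hs0 j) (hs1 j) k φ).trans ?_) hL
    rw [mul_assoc _ K]
    exact mul_le_mul_of_nonneg_left (HK k le_rfl φ) (by positivity)
  choose P hP using hb
  refine ⟨P, isApproximation_of_linear
    (ε := fun j => (scale j : ℝ) * (oneNorm v * oneNorm v * K)) ?_ ?_ ?_ ?_ ?_ ?_⟩
  · simpa using tendsto_scale.mul_const (oneNorm v * oneNorm v * K)
  · intro j
    have := (hs0 j).le
    positivity
  · intro j a
    refine hd.induction_on (p := fun a => inner ℝ (P j a) a = 0) a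
      (isClosed_eq (by fun_prop) (by fun_prop)) fun φ => ?_
    rw [hP]
    exact inner_cdq_self_eq_zero hv (hs0 j).ne' k φ
  · intro j e
    refine hd.induction_on (p := fun e => inner ℝ (Gamma.incl n k (P j e)) (Gamma.incl n k e) = 0) e
      (isClosed_eq (by fun_prop) (by fun_prop)) fun φ => ?_
    rw [hP]
    have h1 := inner_cdq v (scale j : ℝ) φ φ
    rw [real_inner_comm (toL2 (cdq v _ _))] at h1
    simp only [Gamma.incl_apply, toL2_toGamma]
    rw [real_inner_comm] at h1 ⊢
    linarith
  · intro j a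
    refine hd.induction_on (p := fun a => ‖Gamma.incl n k (P j a) -
      ∑ i, v i • Gamma.derivL (by omega : 1 ≤ k) i a‖ ≤
      (scale j : ℝ) * (oneNorm v * oneNorm v * K) * ‖a‖) a
      (isClosed_le (by fun_prop) (by fun_prop)) fun φ => ?_
    have hs := (hs0 j).le
    have e : ∑ i, v i • Gamma.derivL (by omega : 1 ≤ k) i (toGamma k φ) = toL2 (dv v φ) := by
      rw [dv_eq_sum, map_sum]
      simp only [map_smul, Gamma.derivL_apply, Gamma.deriv_toGamma]
    rw [hP, e, Gamma.incl_apply, toL2_toGamma, ← map_sub]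
    refine (norm_cdq_sub_dv_le v (hs0 j) φ).trans ((mul_le_mul_of_nonneg_left
        (mul_le_mul_of_nonneg_left (mul_le_mul_of_nonneg_left (HK 2 hk φ) hn) hn) hs).trans
        (le_of_eq ?_))
    ring
  · intro j
    refine ⟨(scale j : ℝ)⁻¹, fun e => ?_⟩
    refine hd.induction_on (p := fun e => ‖Gamma.incl n k (P j e)‖ ≤
      (scale j : ℝ)⁻¹ * ‖Gamma.incl n k e‖) e
      (isClosed_le (by fun_prop) (by fun_prop)) fun φ => ?_
    rw [hP]
    have h2 := nrm_cdq_le_inv hv1 (hs0 j) (hs1 j) 0 φ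
    rwa [pow_zero, mul_one] at h2

end

end MachStem

/-! ### Identification of the limits with the pointwise product and with `Fpul`. -/

namespace MachStem

noncomputable section

variable {n : ℕ}

/-- The change of variables on lines, with the indicator of the ball as second function and
coefficient `0`; a line in the direction of `θ` meets the ball in length at most `2 * M`. -/
theorem lintegral_closedBall_line_le {δ : ℝ} (hδ : δ ≠ 0) (M : ℝ) {f : Space n → ENNReal}
    (hf : Measurable f) :
    ∫⁻ x in Metric.closedBall 0 M, ∫⁻ X : ℝ, f (x + (δ * X) • thetaDir n) ≤
      ENNReal.ofReal |(0 - δ)⁻¹| * ((∫⁻ x, f x) * ENNReal.ofReal (2 * M)) := by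
  set S : Set (Space n) := Metric.closedBall 0 M
  have hS : MeasurableSet S := measurableSet_closedBall
  have hg : Measurable (S.indicator fun _ => (1 : ENNReal)) := measurable_const.indicator hS
  have e : ∫⁻ x in S, ∫⁻ X : ℝ, f (x + (δ * X) • thetaDir n) =
      ∫⁻ x, ∫⁻ X : ℝ, f (x + (δ * X) • thetaDir n) *
        S.indicator (fun _ => (1 : ENNReal)) (x + (0 * X) • thetaDir n) := by
    rw [← lintegral_indicator hS]
    refine lintegral_congr fun x => ?_
    simp only [zero_mul, zero_smul, add_zero]
    by_cases hx : x ∈ S <;> simp [hx]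
  rw [e, lintegral_lintegral_line hδ hf hg, ← lintegral_mul_const _ hf]
  refine mul_le_mul_right (lintegral_mono fun x => mul_le_mul_right ?_ _) _
  have h1 : ∀ s : ℝ, S.indicator (fun _ => (1 : ENNReal)) (x + s • thetaDir n) ≤
      (Metric.closedBall (-x (Fin.last n)) M).indicator (fun _ => (1 : ENNReal)) s := by
    intro s
    by_cases hs : x + s • thetaDir n ∈ S
    · have h2 : s ∈ Metric.closedBall (-x (Fin.last n)) M := by
        have h3 := (PiLp.norm_apply_le (x + s • thetaDir n) (Fin.last n)).trans
          (mem_closedBall_zero_iff.1 hs)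
        rw [mem_closedBall_iff_norm]
        simpa [thetaDir, add_comm] using h3
      rw [Set.indicator_of_mem h2]
      exact Set.indicator_le_self' (fun _ _ => zero_le) _ |>.trans le_rfl
    · rw [Set.indicator_of_notMem hs]
      exact zero_le
  refine (lintegral_mono h1).trans ?_
  rw [lintegral_indicator measurableSet_closedBall]
  simp [Real.volume_closedBall]

/-- Cauchy–Schwarz on the product of the ball and the line: on bounded sets `Fpul` is continuous
from `L² × L²` to `L¹`. Arbitrary measurable representatives are admitted, so that test functions
and classes can be mixed. -/
theorem exists_lintegral_pulse_le {δ₁ δ₃ : ℝ} (h₁ : δ₁ ≠ 0) (h₃ : δ₃ ≠ 0) (M : ℝ) :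
    ∃ K : ℝ, 0 ≤ K ∧ ∀ (f g : Space n → ℝ) (F G : L2 n), Measurable f → Measurable g →
      f =ᵐ[volume] F → g =ᵐ[volume] G →
      ∫⁻ x in Metric.closedBall 0 M, ∫⁻ X in Set.Ioi (0 : ℝ),
        ‖f (x + (δ₁ * X) • thetaDir n)‖ₑ * ‖g (x + (δ₃ * X) • thetaDir n)‖ₑ ≤
        ENNReal.ofReal (K * (‖F‖ * ‖G‖)) := by
  set c₁ := |(0 - δ₁)⁻¹| * max (2 * M) 0
  set c₃ := |(0 - δ₃)⁻¹| * max (2 * M) 0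
  have hc₁ : 0 ≤ c₁ := by positivity
  have hc₃ : 0 ≤ c₃ := by positivity
  refine ⟨√(c₁ * c₃), Real.sqrt_nonneg _, fun f g F G hf hg hfF hgG => ?_⟩
  set ν : Measure (Space n) := volume.restrict (Metric.closedBall 0 M)
  have m1 : ∀ (δ : ℝ) (f : Space n → ℝ), Measurable f →
      Measurable fun p : Space n × ℝ => ‖f (p.1 + (δ * p.2) • thetaDir n)‖ₑ := fun δ f hf =>
    (hf.comp (by fun_prop)).enorm
  have b : ∀ (δ : ℝ), δ ≠ 0 → ∀ (f : Space n → ℝ) (F : L2 n), Measurable f → f =ᵐ[volume] F →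
      ∫⁻ p, ‖f (p.1 + (δ * p.2) • thetaDir n)‖ₑ ^ 2 ∂(ν.prod volume) ≤
        ENNReal.ofReal (|(0 - δ)⁻¹| * max (2 * M) 0 * ‖F‖ ^ 2) := by
    intro δ hδ f F hf hF
    rw [lintegral_prod _ ((m1 δ f hf).pow_const 2).aemeasurable]
    refine (lintegral_closedBall_line_le hδ M (f := fun x => ‖f x‖ₑ ^ 2)
      (hf.enorm.pow_const 2)).trans ?_
    have e : ∫⁻ x, ‖f x‖ₑ ^ 2 = ENNReal.ofReal (‖F‖ ^ 2) := by
      rw [ENNReal.ofReal_pow (norm_nonneg _), ofReal_norm, enorm_L2_sq]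
      refine lintegral_congr_ae ?_
      filter_upwards [hF] with x hx
      rw [hx]
    rw [e, ← ENNReal.ofReal_mul (by positivity), ← ENNReal.ofReal_mul (by positivity)]
    refine ENNReal.ofReal_le_ofReal ?_
    rw [mul_assoc, mul_comm (max _ _)]
    gcongr
    exact le_max_left _ _
  have key : (∫⁻ x, (∫⁻ X in Set.Ioi (0 : ℝ),
        ‖f (x + (δ₁ * X) • thetaDir n)‖ₑ * ‖g (x + (δ₃ * X) • thetaDir n)‖ₑ) ∂ν) ^ 2 ≤
      ENNReal.ofReal (√(c₁ * c₃) * (‖F‖ * ‖G‖)) ^ 2 := by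
    refine (pow_le_pow_left₀ zero_le (lintegral_mono fun x =>
      lintegral_mono' Measure.restrict_le_self le_rfl) 2).trans ?_
    rw [lintegral_lintegral ((m1 δ₁ f hf).mul (m1 δ₃ g hg)).aemeasurable]
    refine (lintegral_mul_sq_le (m1 δ₁ f hf).aemeasurable (m1 δ₃ g hg).aemeasurable).trans
      ((mul_le_mul' (b δ₁ h₁ f F hf hfF) (b δ₃ h₃ g G hg hgG)).trans (le_of_eq ?_))
    rw [← ENNReal.ofReal_mul (by positivity), ← ENNReal.ofReal_pow (by positivity), mul_pow,
      Real.sq_sqrt (by positivity)]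
    congr 1
    ring
  exact (ENNReal.pow_le_pow_left_iff two_ne_zero).1 key

theorem measurable_coe_L2 (u : L2 n) : Measurable u := (Lp.stronglyMeasurable u).measurable

theorem stronglyMeasurable_Fpul (δ₁ δ₃ : ℝ) (u v : L2 n) : StronglyMeasurable (Fpul δ₁ δ₃ u v) := by
  have hu := measurable_coe_L2 u
  have hv := measurable_coe_L2 v
  have m : Measurable fun p : Space n × ℝ =>
      u (p.1 + (δ₁ * p.2) • thetaDir n) * v (p.1 + (δ₃ * p.2) • thetaDir n) :=
    (hu.comp (by fun_prop)).mul (hv.comp (by fun_prop))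
  exact m.stronglyMeasurable.integral_prod_right'

theorem ae_integrableOn_pulse {δ₁ δ₃ : ℝ} (h₁ : δ₁ ≠ 0) (h₃ : δ₃ ≠ 0) (M : ℝ) (u v : L2 n) :
    ∀ᵐ x ∂volume.restrict (Metric.closedBall (0 : Space n) M),
      IntegrableOn (fun X : ℝ => u (x + (δ₁ * X) • thetaDir n) * v (x + (δ₃ * X) • thetaDir n))
        (Set.Ioi 0) := by
  obtain ⟨K, -, H⟩ := exists_lintegral_pulse_le (n := n) h₁ h₃ M
  have hu := measurable_coe_L2 u
  have hv := measurable_coe_L2 v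
  have m : Measurable fun p : Space n × ℝ =>
      u (p.1 + (δ₁ * p.2) • thetaDir n) * v (p.1 + (δ₃ * p.2) • thetaDir n) :=
    (hu.comp (by fun_prop)).mul (hv.comp (by fun_prop))
  have m2 : Measurable fun p : Space n × ℝ =>
      ‖u (p.1 + (δ₁ * p.2) • thetaDir n)‖ₑ * ‖v (p.1 + (δ₃ * p.2) • thetaDir n)‖ₑ :=
    (hu.comp (by fun_prop)).enorm.mul (hv.comp (by fun_prop)).enorm
  have h := ae_lt_top (m2.lintegral_prod_right' (ν := volume.restrict (Set.Ioi (0 : ℝ))))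
    ((H u v u v hu hv (ae_eq_refl _) (ae_eq_refl _)).trans_lt ENNReal.ofReal_lt_top).ne
  filter_upwards [h] with x hx
  refine ⟨(m.comp measurable_prodMk_left).aestronglyMeasurable, ?_⟩
  rw [hasFiniteIntegral_iff_enorm]
  simpa only [enorm_mul] using hx

namespace Test

/-- Bilinear splitting `φψ - uv = (φ - u)ψ + u(ψ - v)` along the ray. Integrability of `uv` is
needed to subtract under the integral. -/
theorem enorm_fp_sub_Fpul_le {δ₁ δ₃ : ℝ} (h : δ₁ ≠ δ₃) (φ ψ : Test n) (u v : L2 n) (x : Space n)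
    (hx : IntegrableOn (fun X : ℝ =>
      u (x + (δ₁ * X) • thetaDir n) * v (x + (δ₃ * X) • thetaDir n)) (Set.Ioi 0)) :
    ‖fp h φ ψ x - Fpul δ₁ δ₃ u v x‖ₑ ≤
      (∫⁻ X in Set.Ioi (0 : ℝ), ‖φ (x + (δ₁ * X) • thetaDir n) - u (x + (δ₁ * X) • thetaDir n)‖ₑ *
        ‖ψ (x + (δ₃ * X) • thetaDir n)‖ₑ) +
      ∫⁻ X in Set.Ioi (0 : ℝ), ‖u (x + (δ₁ * X) • thetaDir n)‖ₑ *
        ‖ψ (x + (δ₃ * X) • thetaDir n) - v (x + (δ₃ * X) • thetaDir n)‖ₑ := by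
  have hu := measurable_coe_L2 u
  have hl : ∀ δ : ℝ, Measurable fun X : ℝ => x + (δ * X) • thetaDir n := fun δ => by fun_prop
  rw [fp_apply, Fpul, ← integral_sub (integrable_ray h φ ψ x).integrableOn hx,
    ← lintegral_add_left]
  · refine (enorm_integral_le_lintegral_enorm _).trans (lintegral_mono fun X => ?_)
    rw [← enorm_mul, ← enorm_mul]
    refine le_trans (le_of_eq ?_) (enorm_add_le _ _)
    congr 1
    rw [ray]
    ring
  · exact ((φ.continuous.measurable.comp (hl δ₁)).sub (hu.comp (hl δ₁))).enorm.mul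
      (ψ.continuous.measurable.comp (hl δ₃)).enorm

end Test

open Test Filter Topology

theorem setLIntegral_enorm_le (q : L2 n) (M : ℝ) : ∫⁻ x in Metric.closedBall 0 M, ‖q x‖ₑ ≤
    ENNReal.ofReal (√(volume.real (Metric.closedBall (0 : Space n) M)) * ‖q‖) := by
  have h := lintegral_mul_sq_le (μ := volume.restrict (Metric.closedBall (0 : Space n) M))
    (f := fun _ => 1) (g := fun x => ‖q x‖ₑ) aemeasurable_const
    (measurable_coe_L2 q).enorm.aemeasurable
  refine (ENNReal.pow_le_pow_left_iff two_ne_zero).1 ?_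
  simp only [one_mul, one_pow, lintegral_const, Measure.restrict_apply_univ] at h
  refine h.trans ?_
  rw [← ENNReal.ofReal_pow (by positivity), mul_pow, Real.sq_sqrt measureReal_nonneg,
    ENNReal.ofReal_mul measureReal_nonneg, ENNReal.ofReal_pow (norm_nonneg _), ofReal_norm,
    enorm_L2_sq, ofReal_measureReal (measure_closedBall_lt_top).ne]
  exact mul_le_mul' le_rfl (lintegral_mono' Measure.restrict_le_self le_rfl)

/-- `Fpul` is the limit of the operators `fp`. -/
theorem ae_eq_Fpul {δ₁ δ₃ : ℝ} (h : δ₁ ≠ δ₃) (h₁ : δ₁ ≠ 0) (h₃ : δ₃ ≠ 0) {φ ψ : ℕ → Test n}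
    {u v q : L2 n} (hφ : Tendsto (fun j => toL2 (φ j)) atTop (𝓝 u))
    (hψ : Tendsto (fun j => toL2 (ψ j)) atTop (𝓝 v))
    (hq : Tendsto (fun j => toL2 (fp h (φ j) (ψ j))) atTop (𝓝 q)) :
    q =ᵐ[volume] Fpul δ₁ δ₃ u v := by
  have hu := measurable_coe_L2 u
  have hv := measurable_coe_L2 v
  -- On each ball the `L¹` distance is bounded by errors of the approximating sequences, which tend
  -- to zero.
  have key : ∀ M : ℝ, ∫⁻ x in Metric.closedBall 0 M, ‖q x - Fpul δ₁ δ₃ u v x‖ₑ = 0 := by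
    intro M
    obtain ⟨K, hK, H⟩ := exists_lintegral_pulse_le (n := n) h₁ h₃ M
    set V := √(volume.real (Metric.closedBall (0 : Space n) M))
    have hV : 0 ≤ V := Real.sqrt_nonneg _
    have hb : ∀ j, ∫⁻ x in Metric.closedBall 0 M, ‖q x - Fpul δ₁ δ₃ u v x‖ₑ ≤
        ENNReal.ofReal (V * ‖q - toL2 (fp h (φ j) (ψ j))‖ +
          (K * (‖toL2 (φ j) - u‖ * ‖toL2 (ψ j)‖) + K * (‖u‖ * ‖toL2 (ψ j) - v‖))) := by
      intro j
      have mφ := (φ j).continuous.measurable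
      have mψ := (ψ j).continuous.measurable
      have a1 : ∀ (χ : Test n) (w : L2 n), (fun x => χ x - w x) =ᵐ[volume] (toL2 χ - w : L2 n) := by
        intro χ w
        filter_upwards [Lp.coeFn_sub (toL2 χ) w, coeFn_toL2 χ] with x e1 e2
        rw [e1, Pi.sub_apply, e2]
      have b1 := setLIntegral_enorm_le (q - toL2 (fp h (φ j) (ψ j))) M
      have b2 := H (fun x => φ j x - u x) (ψ j) (toL2 (φ j) - u) (toL2 (ψ j)) (mφ.sub hu) mψ
        (a1 _ _) (coeFn_toL2 _).symm
      have b3 := H u (fun x => ψ j x - v x) u (toL2 (ψ j) - v) hu (mψ.sub hv)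
        (ae_eq_refl _) (a1 _ _)
      rw [ENNReal.ofReal_add (by positivity) (by positivity),
        ENNReal.ofReal_add (by positivity) (by positivity)]
      refine le_trans ?_ (add_le_add b1 (add_le_add b2 b3))
      have ml : ∀ δ : ℝ, Measurable fun p : Space n × ℝ => p.1 + (δ * p.2) • thetaDir n :=
        fun δ => by fun_prop
      have m2 : Measurable fun x => ∫⁻ X in Set.Ioi (0 : ℝ),
          ‖φ j (x + (δ₁ * X) • thetaDir n) - u (x + (δ₁ * X) • thetaDir n)‖ₑ *
            ‖ψ j (x + (δ₃ * X) • thetaDir n)‖ₑ :=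
        Measurable.lintegral_prod_right' (f := fun p : Space n × ℝ =>
          ‖φ j (p.1 + (δ₁ * p.2) • thetaDir n) - u (p.1 + (δ₁ * p.2) • thetaDir n)‖ₑ *
            ‖ψ j (p.1 + (δ₃ * p.2) • thetaDir n)‖ₑ)
          (((mφ.comp (ml δ₁)).sub (hu.comp (ml δ₁))).enorm.mul (mψ.comp (ml δ₃)).enorm)
      rw [← lintegral_add_left m2, ← lintegral_add_left (measurable_coe_L2 _).enorm]
      refine lintegral_mono_ae ?_
      filter_upwards [ae_integrableOn_pulse h₁ h₃ M u v,
        ae_restrict_of_ae (Lp.coeFn_sub q (toL2 (fp h (φ j) (ψ j)))),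
        ae_restrict_of_ae (coeFn_toL2 (fp h (φ j) (ψ j)))] with x hx e1 e2
      rw [e1, Pi.sub_apply, e2]
      refine le_trans ?_ (add_le_add le_rfl (enorm_fp_sub_Fpul_le h (φ j) (ψ j) u v x hx))
      refine le_trans (le_of_eq ?_) (enorm_add_le _ _)
      rw [sub_add_sub_cancel]
    have hlim : Tendsto (fun j => ENNReal.ofReal (V * ‖q - toL2 (fp h (φ j) (ψ j))‖ +
          (K * (‖toL2 (φ j) - u‖ * ‖toL2 (ψ j)‖) + K * (‖u‖ * ‖toL2 (ψ j) - v‖)))) atTop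
        (𝓝 (ENNReal.ofReal (V * ‖q - q‖ + (K * (‖u - u‖ * ‖v‖) + K * (‖u‖ * ‖v - v‖))))) := by
      refine ENNReal.tendsto_ofReal ?_
      exact ((tendsto_const_nhds.sub hq).norm.const_mul _).add
        (((((hφ.sub_const u).norm).mul hψ.norm).const_mul _).add
          (((hψ.sub_const v).norm.const_mul _).const_mul _))
    have := ge_of_tendsto' hlim hb
    simpa using this
  have h2 : ∀ M : ℕ, ∀ᵐ x, x ∈ Metric.closedBall (0 : Space n) M → q x = Fpul δ₁ δ₃ u v x := by
    intro M
    rw [← ae_restrict_iff' measurableSet_closedBall]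
    have m : Measurable fun x => ‖q x - Fpul δ₁ δ₃ u v x‖ₑ :=
      ((measurable_coe_L2 q).sub (stronglyMeasurable_Fpul δ₁ δ₃ u v).measurable).enorm
    filter_upwards [(lintegral_eq_zero_iff m).1 (key M)] with x hx
    rw [Pi.zero_apply, enorm_eq_zero] at hx
    exact sub_eq_zero.1 hx
  filter_upwards [ae_all_iff.2 h2] with x hx
  obtain ⟨M, hM⟩ := exists_nat_ge ‖x‖
  exact hx M (mem_closedBall_zero_iff.2 hM)

/-- Along a common subsequence, extracted three times, all three sequences converge almost
everywhere, and limits of products are products of limits. -/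
theorem ae_eq_mul {φ ψ : ℕ → Test n} {u v q : L2 n}
    (hφ : Tendsto (fun j => toL2 (φ j)) atTop (𝓝 u))
    (hψ : Tendsto (fun j => toL2 (ψ j)) atTop (𝓝 v))
    (hq : Tendsto (fun j => toL2 (mul (φ j) (ψ j))) atTop (𝓝 q)) :
    q =ᵐ[volume] fun x => u x * v x := by
  obtain ⟨s₁, hs₁, h₁⟩ := (tendstoInMeasure_of_tendsto_Lp hφ).exists_seq_tendsto_ae
  obtain ⟨s₂, hs₂, h₂⟩ := (tendstoInMeasure_of_tendsto_Lp
    (hψ.comp hs₁.tendsto_atTop)).exists_seq_tendsto_ae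
  obtain ⟨s₃, hs₃, h₃⟩ := (tendstoInMeasure_of_tendsto_Lp
    (hq.comp (hs₁.tendsto_atTop.comp hs₂.tendsto_atTop))).exists_seq_tendsto_ae
  have a1 : ∀ χ : ℕ → Test n, ∀ᵐ x, ∀ j, toL2 (χ j) x = χ j x := fun χ =>
    ae_all_iff.2 fun j => coeFn_toL2 (χ j)
  filter_upwards [h₁, h₂, h₃, a1 φ, a1 ψ, a1 fun j => mul (φ j) (ψ j)] with x e₁ e₂ e₃ c₁ c₂ c₃
  simp only [Function.comp_apply, c₁, c₂, c₃, mul_apply] at e₁ e₂ e₃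
  refine tendsto_nhds_unique e₃ ?_
  exact (e₁.comp (hs₂.tendsto_atTop.comp hs₃.tendsto_atTop)).mul (e₂.comp hs₃.tendsto_atTop)

end

end MachStem

/-! ### Assembly and the main theorem. -/

namespace MachStem

noncomputable section

variable {n : ℕ}

open Test Filter Topology

theorem Gamma.exists_seq_tendsto {k : ℕ} (a : Gamma n k) :
    ∃ φ : ℕ → Test n, Tendsto (fun j => toGamma k (φ j)) atTop (𝓝 a) := by
  obtain ⟨x, hx, hl⟩ := mem_closure_iff_seq_limit.1 (denseRange_toGamma (n := n) k a)
  choose φ hφ using hx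
  exact ⟨φ, by simpa only [hφ] using hl⟩

/-- The field of the evolution equation is approximated by smooth fields. -/
theorem exists_isApproximation (w : EuclideanSpace ℝ (Fin n)) (c μ : ℝ) {δ₁ δ₃ : ℝ} (h : δ₁ ≠ δ₃)
    (h₁ : δ₁ ≠ 0) (h₃ : δ₃ ≠ 0) {k : ℕ} (hk : n + 4 ≤ k) :
    ∃ (F : ℕ → Gamma n k → Gamma n k) (N : Gamma n k → L2 n),
      IsApproximation (Gamma.incl n k) F N ∧ ∀ a : Gamma n k, ∀ᵐ x : Space n,
        N a x + ∑ i : Fin n, w i * a.deriv i.castSucc x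
          + c * a.toL2 x * a.deriv (Fin.last n) x
          + μ * Fpul δ₁ δ₃ (a.deriv (Fin.last n)) (a.deriv (Fin.last n)) x = 0 := by
  have hk1 : 1 ≤ k := by omega
  -- The vector `w` is extended by a zero component in the direction of `θ`, so that its difference
  -- quotients commute with the weight.
  obtain ⟨P₁, hP₁⟩ := exists_isApproximation_dv (n := n) (k := k) (by omega)
    (v := WithLp.toLp 2 (Fin.snoc (α := fun _ => ℝ) w 0)) (by simp)
  obtain ⟨P₂, Q, hQ, hP₂⟩ := exists_isApproximation_transport (n := n) (k := k) (by omega)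
  obtain ⟨B, hB, hB'⟩ := exists_isApproximation_fpd (n := n) h h₁ h₃ (k := k) (by omega)
  refine ⟨_, _, ((hP₁.add (hP₂.const_smul c)).add (hB'.const_smul μ)).neg, fun a => ?_⟩
  obtain ⟨φ, hφ⟩ := a.exists_seq_tendsto
  have t1 : Tendsto (fun j => toL2 (φ j)) atTop (𝓝 a.toL2) :=
    ((Gamma.incl n k).continuous.tendsto a).comp hφ
  have t2 : Tendsto (fun j => toL2 (d (Fin.last n) (φ j))) atTop (𝓝 (a.deriv (Fin.last n))) := by
    have := ((Gamma.derivL hk1 (Fin.last n)).continuous.tendsto a).comp hφ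
    simpa only [Function.comp_def, Gamma.derivL_apply, Gamma.deriv_toGamma] using this
  have hq : Q a a =ᵐ[volume] fun x => a.toL2 x * a.deriv (Fin.last n) x := by
    refine ae_eq_mul t1 t2 ?_
    have := ((by fun_prop : Continuous fun a => Q a a).tendsto a).comp hφ
    simpa only [Function.comp_def, hQ] using this
  have hb : (B a a).toL2 =ᵐ[volume]
      Fpul δ₁ δ₃ (a.deriv (Fin.last n)) (a.deriv (Fin.last n)) := by
    refine ae_eq_Fpul h h₁ h₃ t2 t2 ?_
    have := ((by fun_prop : Continuous fun a => Gamma.incl n k (B a a)).tendsto a).comp hφ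
    simpa only [Function.comp_def, hB, Gamma.incl_apply, toL2_toGamma] using this
  have hs : ∑ i, (WithLp.toLp 2 (Fin.snoc (α := fun _ => ℝ) w 0) : Space n) i • a.deriv i =
      ∑ i : Fin n, w i • a.deriv i.castSucc := by
    rw [Fin.sum_univ_castSucc]
    simp
  have hsm : ∀ᵐ x, ∀ i : Fin n, (w i • a.deriv i.castSucc : L2 n) x = w i * a.deriv i.castSucc x :=
    ae_all_iff.2 fun i => Lp.coeFn_smul _ _
  rw [hs]
  filter_upwards [hq, hb, hsm,
    Lp.coeFn_finsetSum Finset.univ fun i : Fin n => w i • a.deriv i.castSucc,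
    Lp.coeFn_neg (∑ i : Fin n, w i • a.deriv i.castSucc + c • Q a a + μ • (B a a).toL2),
    Lp.coeFn_add (∑ i : Fin n, w i • a.deriv i.castSucc + c • Q a a) (μ • (B a a).toL2),
    Lp.coeFn_add (∑ i : Fin n, w i • a.deriv i.castSucc) (c • Q a a),
    Lp.coeFn_smul c (Q a a), Lp.coeFn_smul μ (B a a).toL2] with x e1 e2 e3 e4 e5 e6 e7 e8 e9
  rw [e5, Pi.neg_apply, e6, Pi.add_apply, e7, Pi.add_apply, e8, e9, Pi.smul_apply, Pi.smul_apply,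
    e1, e2, e4, Finset.sum_apply]
  simp only [e3, smul_eq_mul]
  ring

end

end MachStem

/-- Local well-posedness of the pulse Mach stem equation in `Γ^k(ℝ^d)`, where `d = n + 1`. -/
theorem mainTheorem5 (n : ℕ) (w : EuclideanSpace ℝ (Fin n)) (c μ δ₁ δ₃ : ℝ)
    (hδ₁ : δ₁ ≠ 0) (hδ₃ : δ₃ ≠ 0) (hδ : δ₃ = 1 + δ₁)
    (k₀ : ℕ) (hk₀ : IsLeast {m : ℕ | (((n + 1 : ℕ) : ℝ) + 1) / 2 < (m : ℝ)} k₀)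
    (k : ℕ) (hk : 2 * k₀ + 1 ≤ k) (R : ℝ) (hR : 0 < R) :
    ∃ T : ℝ, 0 < T ∧ ∀ a₀ : MachStem.Gamma n k, ‖a₀‖ ≤ R →
      ∃ a : ℝ → MachStem.Gamma n k,
        MachStem.IsSolution w c μ δ₁ δ₃ T a₀ a ∧
        ∀ b : ℝ → MachStem.Gamma n k, MachStem.IsSolution w c μ δ₁ δ₃ T a₀ b →
          Set.EqOn b a (Set.Icc 0 T) := by
  have h13 : δ₁ ≠ δ₃ := by rw [hδ]; intro h; linarith
  -- From `k₀ > (n + 2) / 2` the integer `2 * k₀` is at least `n + 3`, and `k` exceeds it by at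
  -- least one.
  have hn : n + 4 ≤ k := by
    have h1 : (((n + 1 : ℕ) : ℝ) + 1) / 2 < (k₀ : ℝ) := hk₀.1
    have h2 : (n : ℝ) + 2 < 2 * k₀ := by push_cast at h1; linarith
    have h3 : n + 2 < 2 * k₀ := by exact_mod_cast h2
    omega
  obtain ⟨F, N, hF, hN⟩ := MachStem.exists_isApproximation w c μ h13 hδ₁ hδ₃ hn
  obtain ⟨T, hT, H⟩ := hF.exists_unique_solution (MachStem.Gamma.toL2_injective n k) hR
  refine ⟨T, hT, fun a₀ ha₀ => ?_⟩
  obtain ⟨a, ⟨hc, h0, hd⟩, hu⟩ := H a₀ ha₀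
  refine ⟨a, ⟨hc, h0, fun t ht => ⟨N (a t), hd t ht, hN (a t)⟩⟩, fun b hb => ?_⟩
  refine hu b hb.continuousOn hb.initial fun t ht => ?_
  obtain ⟨b', hb', he⟩ := hb.equation t ht
  -- The equation determines the time derivative almost everywhere, so every solution of the Cauchy
  -- problem solves the abstract equation, to which uniqueness applies.
  have e : b' = N (b t) := by
    refine MeasureTheory.Lp.ext ?_
    filter_upwards [he, hN (b t)] with x e1 e2
    linarith
  rw [← e]
  exact hb'
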